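/- **Setting.** Let $n=k+2\ge 2$, let $F(x,\theta,\lambda)\in\mathbb R^n$ be $C^\infty$ on $\mathbb R^n\times\mathbb R\times\mathbb R$ and $2\pi$-periodic in $\theta$, and consider $dv/d\theta=F(v,\theta,\lambda)$. For $\lambda$ in an open interval around $\lambda^\star$ let $v(\theta;\lambda)$ be $2\pi$-periodic orbits, and let $P(\theta;\lambda)\in\mathbb R^{n\times n}$ ($2\pi$-periodic in $\theta$, non-singular) and $E(\lambda)=\mathrm{diag}(\widehat E(\lambda),\widetilde E(\lambda))$ be Floquet variables along them, all $C^\infty$ in $(\theta,\lambda)$: $$F_x(v(\theta;\lambda),\theta,\lambda)\,P-\partial_\theta P=P\,E(\lambda),\qquad \widehat E(\lambda)=\begin{pmatrix}\alpha_R(\lambda)&-\alpha_I(\lambda)\\ \alpha_I(\lambda)&\alpha_R(\lambda)\end{pmatrix}.$$ Assume that $\lambda^\star$ is a Neimark–Sacker point: $\alpha_R(\lambda^\star)=0$, $\alpha_I(\lambda^\star)=\omega^\star\in(0,\frac12)$, $\widetilde E(\lambda^\star)$ has no eigenvalue on the imaginary axis, and $\dot\alpha_R(\lambda^\star)\ne0$.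 Assume also that there is no strong resonance: $\omega^\star\notin\{\frac13,\frac14\}$. For $\varepsilon\neq0$ put $$G(z,\lambda,\theta;\varepsilon)=\tfrac1\varepsilon P(\theta;\lambda)^{-1}\big\{F(v+\varepsilon Pz,\theta,\lambda)-F(v,\theta,\lambda)-\varepsilon(\partial_\theta P)z\big\},$$ and write $z=(\widehat z,\widetilde z)\in\mathbb R^2\times\mathbb R^{n-2}$, $a^\star(\phi)=(\cos\phi,\sin\phi,0,\dots,0)^T$, $\dot a^\star=da^\star/d\phi$. **Fourier approximation.** The $M=3$ Fourier $\phi$-mode equations for $\lambda$, $\omega$ and $$z(\theta,\phi)=a^\star(\phi)+a_0(\theta)+\sum_{m=1}^3\big(a_m(\theta)\cos m\phi+b_m(\theta)\sin m\phi\big),$$ with $C^1$, $2\pi$-periodic coefficients, are $$\mathsf S_3\,G(z(\theta,\phi),\lambda,\theta;\varepsilon)-\partial_\theta z-\omega\,\partial_\phi z=0,\qquad \langle\langle z,a^\star\rangle\rangle=1,\qquad \langle\langle z,\dot a^\star\rangle\rangle=0,$$ where $\mathsf S_3$ truncates the Fourier series in $\phi$ to the modes $0,\dots,3$ and $\langle\langle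 w_1,w_2\rangle\rangle=(2\pi)^{-2}\int_0^{2\pi}\!\int_0^{2\pi}w_1\cdot w_2\,d\theta\,d\phi$. **Normal form at $\lambda^\star$.** Let $$\widehat h(y;\theta)=|y|^2\widehat a_0+(y_1^2-y_2^2)\widehat a_2+2y_1y_2\widehat b_2+y_1|y|^2\widehat a_1+y_2|y|^2\widehat b_1+y_1(y_1^2-3y_2^2)\widehat a_3+y_2(3y_1^2-y_2^2)\widehat b_3,$$ $$\widetilde h(y;\theta)=|y|^2\widetilde a_0+(y_1^2-y_2^2)\widetilde a_2+2y_1y_2\widetilde b_2,$$ with smooth $2\pi$-periodic coefficients $\widehat a_m(\theta),\widehat b_m(\theta)\in\mathbb R^2$, $\widetilde a_m(\theta),\widetilde b_m(\theta)\in\mathbb R^{n-2}$ such that $\int_0^{2\pi}(\widehat a_1\cdot e_1+\widehat b_1\cdot e_2)\,d\theta=0=\int_0^{2\pi}(\widehat a_1\cdot e_2-\widehat b_1\cdot e_1)\,d\theta$. The substitution $\widehat z=\widehat y+\frac1\varepsilon\widehat h(\varepsilon\widehat y;\theta)$, $\widetilde z=\widetilde y+\frac1\varepsilon\widetilde h(\varepsilon\widehat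 y;\theta)$ turns the equation $G(z,\lambda^\star,\theta;\varepsilon)=(\partial_\theta+\omega\partial_\phi)z$ into $G^\dagger(y,\lambda^\star,\theta;\varepsilon)=(\partial_\theta+\omega\partial_\phi)y$. It is a normal-form transformation, with Lyapunov coefficients $\beta_R(\lambda^\star),\beta_I(\lambda^\star)$, if as $\varepsilon\to0$, for all $\widehat y$ and $\theta$, $$\widehat G^\dagger(\widehat y,0,\lambda^\star,\theta;\varepsilon)=\widehat E(\lambda^\star)\widehat y+\varepsilon^2|\widehat y|^2\begin{pmatrix}\beta_R&-\beta_I\\ \beta_I&\beta_R\end{pmatrix}\widehat y+O(\varepsilon^3),\qquad \widetilde G^\dagger(\widehat y,0,\lambda^\star,\theta;\varepsilon)=O(\varepsilon^2).$$ **Theorem.** A normal-form transformation at $\lambda^\star$ exists. There are $\delta,\varepsilon_0>0$ such that for $0<|\varepsilon|<\varepsilon_0$ the $M=3$ Fourier $\phi$-mode equations have exactly one solution $\lambda^F(\varepsilon),\omega^F(\varepsilon),z^F(\theta,\phi;\varepsilon)$, with coefficients $a^F_m(\theta;\varepsilon),b^F_m(\theta;\varepsilon)$, that satisfies $|\lambda-\lambda^\star|<\delta$,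 $|\omega-\omega^\star|<\delta$ and $\max_i|z_i(\theta,\phi)-a^\star_i(\phi)|<\delta$ for all $\theta,\phi$. For every normal-form transformation at $\lambda^\star$, and $0<|\varepsilon|<\varepsilon_0$, $$\beta_R(\lambda^\star)=-\dot\alpha_R(\lambda^\star)\frac{\lambda^F(\varepsilon)-\lambda^\star}{\varepsilon^2}+O(\varepsilon^2),$$ $$\beta_I(\lambda^\star)=\frac{\omega^F(\varepsilon)-\omega^\star}{\varepsilon^2}-\dot\alpha_I(\lambda^\star)\frac{\lambda^F(\varepsilon)-\lambda^\star}{\varepsilon^2}+O(\varepsilon^2),$$ and $$\widehat a_m=\tfrac1\varepsilon\widehat a^F_m+O(\varepsilon^2),\quad \widetilde a_m=\tfrac1\varepsilon\widetilde a^F_m+O(\varepsilon^2)\quad(m=0,2),$$ $$\widehat b_2=\tfrac1\varepsilon\widehat b^F_2+O(\varepsilon^2),\quad \widetilde b_2=\tfrac1\varepsilon\widetilde b^F_2+O(\varepsilon^2),$$ $$\widehat a_m=\tfrac1{\varepsilon^2}\widehat a^F_m+O(\varepsilon^2),\quad \widehat b_m=\tfrac1{\varepsilon^2}\widehat b^F_m+O(\varepsilon^2)\quad(m=1,3),$$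 where the last six kinds of estimate hold uniformly in $\theta$, for the functions of $\theta$ and for their first $\theta$-derivatives. -/

import Mathlib

open scoped ContDiff Matrix
open Real

noncomputable section

namespace NeimarkSacker

/-- The state space `ℝⁿ`, `n = k + 2`, with coordinates split as `ℝ² × ℝᵏ`. Functions on the circle
`𝕊¹` are `2π`-periodic functions on `ℝ`. -/
abbrev State (k : ℕ) : Type := Fin 2 ⊕ Fin k → ℝ

/-- The first two components of a state. -/
def hat {k : ℕ} (z : State k) : Fin 2 → ℝ := fun i => z (Sum.inl i)

/-- The remaining `k = n - 2` components of a state. -/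
def til {k : ℕ} (z : State k) : Fin k → ℝ := fun i => z (Sum.inr i)

/-- The `2 × 2` matrix `(p, -q; q, p)`. -/
def rot (p q : ℝ) : Matrix (Fin 2) (Fin 2) ℝ := !![p, -q; q, p]

/-- The Jacobian matrix of `f` at `x`. -/
def jacobian {k : ℕ} (f : State k → State k) (x : State k) :
    Matrix (Fin 2 ⊕ Fin k) (Fin 2 ⊕ Fin k) ℝ :=
  LinearMap.toMatrix' (fderiv ℝ f x : State k →ₗ[ℝ] State k)

/-- A forced vector field `F(x, θ, λ)`, a curve `v(θ; λ)` of periodic orbits and Floquet variables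
`P(θ; λ)`, `E(λ)` along it; the arguments `θ`, `λ` come in this order. This is only the data. -/
structure ForcedSystem (k : ℕ) where
  F : State k → ℝ → ℝ → State k
  v : ℝ → ℝ → State k
  P : ℝ → ℝ → Matrix (Fin 2 ⊕ Fin k) (Fin 2 ⊕ Fin k) ℝ
  alphaR : ℝ → ℝ
  alphaI : ℝ → ℝ
  Etil : ℝ → Matrix (Fin k) (Fin k) ℝ

namespace ForcedSystem

variable {k : ℕ} (S : ForcedSystem k)

/-- `E(λ) = diag(Ê(λ), Ẽ(λ))` with `Ê(λ) = (α_R, -α_I; α_I, α_R)`. -/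
def E (lam : ℝ) : Matrix (Fin 2 ⊕ Fin k) (Fin 2 ⊕ Fin k) ℝ :=
  Matrix.fromBlocks (rot (S.alphaR lam) (S.alphaI lam)) 0 0 (S.Etil lam)

/-- `∂P/∂θ`, entrywise. -/
def dP (θ lam : ℝ) : Matrix (Fin 2 ⊕ Fin k) (Fin 2 ⊕ Fin k) ℝ :=
  Matrix.of fun i j => deriv (fun s => S.P s lam i j) θ

/-- For `λ ∈ U`: `v(·; λ)` is a `2π`-periodic orbit and `P(·; λ)`, `E(λ)` are a `2π`-periodic
non-singular solution of the Floquet problem along it, all of them depending smoothly on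
`(θ, λ)`. -/
structure IsFloquetBranch (U : Set ℝ) : Prop where
  smooth_v : ContDiffOn ℝ ∞ (fun p : ℝ × ℝ => S.v p.1 p.2) (Set.univ ×ˢ U)
  smooth_P : ∀ i j, ContDiffOn ℝ ∞ (fun p : ℝ × ℝ => S.P p.1 p.2 i j) (Set.univ ×ˢ U)
  smooth_alphaR : ContDiffOn ℝ ∞ S.alphaR U
  smooth_alphaI : ContDiffOn ℝ ∞ S.alphaI U
  smooth_Etil : ∀ i j, ContDiffOn ℝ ∞ (fun lam => S.Etil lam i j) U
  periodic_v : ∀ lam ∈ U, Function.Periodic (fun θ => S.v θ lam) (2 * π)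
  periodic_P : ∀ lam ∈ U, Function.Periodic (fun θ => S.P θ lam) (2 * π)
  orbit : ∀ lam ∈ U, ∀ θ,
    HasDerivAt (fun s => S.v s lam) (S.F (S.v θ lam) θ lam) θ
  nonsingular : ∀ lam ∈ U, ∀ θ, IsUnit (S.P θ lam)
  floquet : ∀ lam ∈ U, ∀ θ,
    jacobian (fun x => S.F x θ lam) (S.v θ lam) * S.P θ lam - S.dP θ lam
      = S.P θ lam * S.E lam

/-- `(v(·; λ⋆), λ⋆)` is a Neimark-Sacker point with critical Floquet exponents `± i ω⋆`. -/
structure IsNeimarkSackerPoint (lamStar omStar : ℝ) : Prop where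
  smooth_F : ContDiff ℝ ∞ (fun p : State k × ℝ × ℝ => S.F p.1 p.2.1 p.2.2)
  periodic_F : ∀ x lam, Function.Periodic (fun θ => S.F x θ lam) (2 * π)
  branch : ∃ r > 0, S.IsFloquetBranch (Metric.ball lamStar r)
  alphaR_star : S.alphaR lamStar = 0
  alphaI_star : S.alphaI lamStar = omStar
  omStar_pos : 0 < omStar
  omStar_lt : omStar < 1 / 2
  hyperbolic : ∀ μ ∈ spectrum ℂ ((S.Etil lamStar).map (algebraMap ℝ ℂ)), μ.re ≠ 0
  transversal : deriv S.alphaR lamStar ≠ 0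

/-- The Crandall-Rabinowitz map `G(z, λ, θ; ε)`, `ε ≠ 0`. -/
def G (z : State k) (lam θ ε : ℝ) : State k :=
  ε⁻¹ • ((S.P θ lam)⁻¹ *ᵥ
    (S.F (S.v θ lam + ε • (S.P θ lam *ᵥ z)) θ lam - S.F (S.v θ lam) θ lam
      - ε • (S.dP θ lam *ᵥ z)))

end ForcedSystem

/-- `a⋆(φ) = (cos φ, sin φ, 0, …, 0)`. -/
def aStar {k : ℕ} (φ : ℝ) : State k := Sum.elim ![cos φ, sin φ] 0

/-- `(-sin φ, cos φ, 0, …, 0)`, the derivative of `a⋆`. -/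
def aStarDot {k : ℕ} (φ : ℝ) : State k := Sum.elim ![-sin φ, cos φ] 0

/-- The mean over the torus of the dot product of `w₁(θ, φ)` and `w₂(θ, φ)`. -/
def inner2 {k : ℕ} (w₁ w₂ : ℝ → ℝ → State k) : ℝ :=
  1 / (2 * π) ^ 2 * ∫ φ in (0 : ℝ)..2 * π, ∫ θ in (0 : ℝ)..2 * π, w₁ θ φ ⬝ᵥ w₂ θ φ

/-- The truncation of the Fourier series of `f` to the modes `0, 1, 2, 3`. -/
def trunc3 {k : ℕ} (f : ℝ → State k) (φ : ℝ) : State k :=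
  (1 / (2 * π)) • (∫ s in (0 : ℝ)..2 * π, f s)
    + ∑ m ∈ Finset.Icc (1 : ℕ) 3,
      (cos (m * φ) • ((1 / π) • ∫ s in (0 : ℝ)..2 * π, cos (m * s) • f s)
        + sin (m * φ) • ((1 / π) • ∫ s in (0 : ℝ)..2 * π, sin (m * s) • f s))

/-- The unknowns of the `M = 3` Fourier `φ`-mode approximation: `λ`, `ω` and the `θ`-dependent
Fourier coefficients. -/
@[ext]
structure FourierTorus (k : ℕ) where
  lam : ℝ
  om : ℝ
  a0 : ℝ → State k
  a1 : ℝ → State k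
  b1 : ℝ → State k
  a2 : ℝ → State k
  b2 : ℝ → State k
  a3 : ℝ → State k
  b3 : ℝ → State k

namespace FourierTorus

variable {k : ℕ} (s : FourierTorus k)

/-- `z(θ, φ) = a⋆(φ) + a₀(θ) + ∑_{m=1}^{3} (a_m(θ) cos mφ + b_m(θ) sin mφ)`. -/
def z (θ φ : ℝ) : State k :=
  aStar φ + s.a0 θ
    + (cos φ • s.a1 θ + sin φ • s.b1 θ)
    + (cos (2 * φ) • s.a2 θ + sin (2 * φ) • s.b2 θ)
    + (cos (3 * φ) • s.a3 θ + sin (3 * φ) • s.b3 θ)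

/-- `s` solves the `M = 3` Fourier `φ`-mode (Galerkin) equations, with amplitude and phase
conditions, at the amplitude parameter `ε`. -/
structure Solves (S : ForcedSystem k) (ε : ℝ) : Prop where
  smooth : ∀ f ∈ ({s.a0, s.a1, s.b1, s.a2, s.b2, s.a3, s.b3} : Set (ℝ → State k)),
    ContDiff ℝ 1 f
  periodic : ∀ f ∈ ({s.a0, s.a1, s.b1, s.a2, s.b2, s.a3, s.b3} : Set (ℝ → State k)),
    Function.Periodic f (2 * π)
  galerkin : ∀ θ φ,
    trunc3 (fun ψ => S.G (s.z θ ψ) s.lam θ ε) φ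
      - deriv (fun t => s.z t φ) θ - s.om • deriv (fun ψ => s.z θ ψ) φ = 0
  amplitude : inner2 s.z (fun _ φ => aStar φ) = 1
  phase : inner2 s.z (fun _ φ => aStarDot φ) = 0

/-- `(λ, ω, z)` lies within `δ` of `(λ⋆, ω⋆, a⋆)`. -/
def Near (lamStar omStar δ : ℝ) : Prop :=
  |s.lam - lamStar| < δ ∧ |s.om - omStar| < δ ∧ ∀ θ φ, ‖s.z θ φ - aStar φ‖ < δ

end FourierTorus

/-- The `θ`-dependent coefficients, at a fixed `λ`, of the polynomial maps `ĥ` (prefix `h`) and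
`h̃` (prefix `t`). -/
structure NFCoeffs (k : ℕ) where
  ha0 : ℝ → Fin 2 → ℝ
  ha1 : ℝ → Fin 2 → ℝ
  hb1 : ℝ → Fin 2 → ℝ
  ha2 : ℝ → Fin 2 → ℝ
  hb2 : ℝ → Fin 2 → ℝ
  ha3 : ℝ → Fin 2 → ℝ
  hb3 : ℝ → Fin 2 → ℝ
  ta0 : ℝ → Fin k → ℝ
  ta2 : ℝ → Fin k → ℝ
  tb2 : ℝ → Fin k → ℝ

namespace NFCoeffs

variable {k : ℕ} (c : NFCoeffs k)

/-- `ĥ(y; θ)`, the sum of a homogeneous quadratic and a homogeneous cubic polynomial in `y`. -/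
def hHat (θ : ℝ) (y : Fin 2 → ℝ) : Fin 2 → ℝ :=
  (y 0 ^ 2 + y 1 ^ 2) • c.ha0 θ + (y 0 ^ 2 - y 1 ^ 2) • c.ha2 θ + (2 * y 0 * y 1) • c.hb2 θ
    + (y 0 * (y 0 ^ 2 + y 1 ^ 2)) • c.ha1 θ + (y 1 * (y 0 ^ 2 + y 1 ^ 2)) • c.hb1 θ
    + (y 0 * (y 0 ^ 2 - 3 * y 1 ^ 2)) • c.ha3 θ + (y 1 * (3 * y 0 ^ 2 - y 1 ^ 2)) • c.hb3 θ

/-- `h̃(y; θ)`, a homogeneous quadratic polynomial in `y`. -/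
def hTil (θ : ℝ) (y : Fin 2 → ℝ) : Fin k → ℝ :=
  (y 0 ^ 2 + y 1 ^ 2) • c.ta0 θ + (y 0 ^ 2 - y 1 ^ 2) • c.ta2 θ + (2 * y 0 * y 1) • c.tb2 θ

/-- The near-identity transformation `ẑ = ŷ + ε⁻¹ ĥ(ε ŷ; θ)`, `z̃ = ỹ + ε⁻¹ h̃(ε ŷ; θ)`. -/
def trans (ε θ : ℝ) (y : State k) : State k :=
  Sum.elim (hat y + ε⁻¹ • c.hHat θ (ε • hat y)) (til y + ε⁻¹ • c.hTil θ (ε • hat y))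

/-- The transformed map `G†`: if `z = T(y; θ)` is the near-identity transformation and `D` denotes
`∂/∂θ + ω ∂/∂φ`, then `D z = T_y D y + T_θ`, so that `G(z) - D z = 0` becomes `G†(y) - D y = 0`
with `G† = T_y⁻¹ (G(T(y)) - T_θ)`. -/
def Gdag (S : ForcedSystem k) (y : State k) (lam θ ε : ℝ) : State k :=
  (fderiv ℝ (c.trans ε θ) y).inverse
    (S.G (c.trans ε θ y) lam θ ε - deriv (fun t => c.trans ε t y) θ)

/-- The coefficients `c` bring the system at parameter value `lam` to normal form, with Lyapunov
coefficients `betaR` and `betaI`: in the expansion of `G†(ŷ, ỹ)` in powers of `ε`, and for the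
terms in `ŷ` alone (`ỹ = 0`), the quadratic terms vanish, and the cubic terms of the first two
components are `|ŷ|² (β_R, -β_I; β_I, β_R) ŷ`. -/
structure IsNormalForm (S : ForcedSystem k) (lam betaR betaI : ℝ) : Prop where
  smooth_hat : ∀ f ∈ ({c.ha0, c.ha1, c.hb1, c.ha2, c.hb2, c.ha3, c.hb3} : Set (ℝ → Fin 2 → ℝ)),
    ContDiff ℝ ∞ f
  smooth_til : ∀ f ∈ ({c.ta0, c.ta2, c.tb2} : Set (ℝ → Fin k → ℝ)), ContDiff ℝ ∞ f
  periodic_hat : ∀ f ∈ ({c.ha0, c.ha1, c.hb1, c.ha2, c.hb2, c.ha3, c.hb3} :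
    Set (ℝ → Fin 2 → ℝ)), Function.Periodic f (2 * π)
  periodic_til : ∀ f ∈ ({c.ta0, c.ta2, c.tb2} : Set (ℝ → Fin k → ℝ)),
    Function.Periodic f (2 * π)
  restriction₁ : 1 / (2 * π) * ∫ θ in (0 : ℝ)..2 * π, (c.ha1 θ 0 + c.hb1 θ 1) = 0
  restriction₂ : 1 / (2 * π) * ∫ θ in (0 : ℝ)..2 * π, (c.ha1 θ 1 - c.hb1 θ 0) = 0
  hat_terms : ∀ (y : Fin 2 → ℝ) (θ : ℝ),
    (fun ε : ℝ => hat (c.Gdag S (Sum.elim y 0) lam θ ε)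
        - (rot (S.alphaR lam) (S.alphaI lam) *ᵥ y
          + ε ^ 2 • ((y 0 ^ 2 + y 1 ^ 2) • (rot betaR betaI *ᵥ y))))
      =O[nhdsWithin 0 {0}ᶜ] fun ε : ℝ => ε ^ 3
  til_terms : ∀ (y : Fin 2 → ℝ) (θ : ℝ),
    (fun ε : ℝ => til (c.Gdag S (Sum.elim y 0) lam θ ε))
      =O[nhdsWithin 0 {0}ᶜ] fun ε : ℝ => ε ^ 2

end NFCoeffs

/-- `g` and its derivative are bounded by `M`, uniformly in `θ`. -/
def C1Le {d : ℕ} (g : ℝ → Fin d → ℝ) (M : ℝ) : Prop :=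
  ∀ θ, ‖g θ‖ ≤ M ∧ ‖deriv g θ‖ ≤ M

end NeimarkSacker

end

/-! Write `z = a⋆ + w`, collect the Fourier coefficients of `w` in `φ` of orders `0, …, 3` into one
function of `θ` with values in `Fin 7 → State k`, and put `p = (λ - λ⋆, ω - ω⋆)`. The Galerkin
equations then become a periodic problem `w' = A w + κ (b p) + N(w, p, θ, ε)`, and the amplitude and
phase conditions say that `ℓ w` has mean zero (`FourierTorus.solves_iff`). Here `A` is the operator
`L - ω⋆ ∂_φ` at the bifurcation point, `κ` embeds its two-dimensional kernel, `ℓ` is the coordinate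
along that kernel, and `b` is the derivative of the critical exponent in the parameters, invertible
by transversality. The term `N` vanishes with its `(w, p)`-derivative at `w = 0`, `p = 0`, `ε = 0`.

Apart from the kernel, the exponents of `A` either have nonzero real part or are `i j ω⋆` with `1 ≤
|j| ≤ 4`. Since `0 < ω⋆ < 1/2` and the values `1/3`, `1/4` are excluded, no `j ω⋆` is an integer.
Hence the linear periodic problem with unknowns `w` and `q = b p` is uniquely solvable with bounds
(`isNonresonant_linOp`, `exists_isPerSol`), and a contraction argument gives a unique small branch
of size `O(ε)` (`exists_periodic_branch`).

The leading terms are `ε w₁ + ε² w₂` for `w` and `-ε² b⁻¹ β` for `p`. The forcing of `w₁` is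
quadratic in `a⋆` and has modes `0` and `2` only, so it meets no solvability condition. The forcing
of `w₂` has modes `1` and `3`, and its solvability condition defines `β`. No mode above `3` occurs
at these orders, so the truncation is harmless. The residual of the approximation is `O(ε³)`, and so
is the error. The equations are invariant under `z ↦ -z(θ, φ + π)`, `ε ↦ -ε`, which improves the
error in the odd modes and in `p` to `O(ε⁴)` (`exists_residual_bound`,
`exists_periodic_error_bound`). Division by `ε` in the even modes, and by `ε²` in the odd modes and
in `p`, leaves `O(ε²)` throughout.

On a circle `y = r a⋆(φ)` the normal form transformation is again a trigonometric polynomial of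
degree three, and the conditions on `G†` are equivalent to the linear periodic problems of `w₁` and
of the critical components of `w₂`, with the Lyapunov coefficients in the place of `β`. The two
integral restrictions are the mean condition. Solvability gives existence of a normal form, and
uniqueness identifies every normal form with the formal solution (`isNormalForm_ofFormal`,
`IsNormalForm.eq_formal`). -/

noncomputable section

set_option maxSynthPendingDepth 5

namespace NeimarkSacker

/-! ### Parametric integrals, Hadamard's lemma and Lipschitz bounds. -/

section Calculus

variable {E Q F : Type} [NormedAddCommGroup E] [NormedSpace ℝ E]
  [NormedAddCommGroup Q] [NormedSpace ℝ Q]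
  [NormedAddCommGroup F] [NormedSpace ℝ F]

/-- Differentiation under the integral sign; compactness of a unit ball times the interval supplies
a constant dominating function. -/
theorem hasFDerivAt_parametric_integral [FiniteDimensional ℝ E] {f : E × ℝ → F}
    (hf : ContDiff ℝ 1 f) (a b : ℝ) (x : E) :
    HasFDerivAt (fun x => ∫ s in a..b, f (x, s))
      (∫ s in a..b, (fderiv ℝ f (x, s)).comp (ContinuousLinearMap.inl ℝ E ℝ)) x := by
  have hprop : ProperSpace E := FiniteDimensional.proper ℝ E
  have hc : Continuous fun p => (fderiv ℝ f p).comp (ContinuousLinearMap.inl ℝ E ℝ) :=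
    (hf.continuous_fderiv one_ne_zero).clm_comp continuous_const
  have hK : IsCompact (Metric.closedBall x 1 ×ˢ Set.uIcc a b) :=
    (isCompact_closedBall x 1).prod isCompact_uIcc
  obtain ⟨M, hM⟩ := hK.exists_bound_of_continuousOn hc.continuousOn
  refine intervalIntegral.hasFDerivAt_integral_of_dominated_of_fderiv_le
    (F' := fun x s => (fderiv ℝ f (x, s)).comp (ContinuousLinearMap.inl ℝ E ℝ))
    (bound := fun _ => M)
    (Metric.closedBall_mem_nhds x one_pos) (.of_forall fun y => ?_) ?_ ?_ ?_ ?_ ?_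
  · exact (hf.continuous.comp (by fun_prop : Continuous fun s : ℝ => (y, s))).aestronglyMeasurable
  · exact (hf.continuous.comp
      (by fun_prop : Continuous fun s : ℝ => (x, s))).intervalIntegrable _ _
  · exact (hc.comp (by fun_prop : Continuous fun s : ℝ => (x, s))).aestronglyMeasurable
  · exact .of_forall fun t ht y hy => hM (y, t) ⟨hy, Set.uIoc_subset_uIcc ht⟩
  · exact intervalIntegrable_const
  · refine .of_forall fun t _ y _ => ?_
    have h1 : HasFDerivAt f (fderiv ℝ f (y, t)) (y, t) :=
      (hf.differentiable one_ne_zero _).hasFDerivAt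
    have h2 : HasFDerivAt (fun y : E => (y, t)) (ContinuousLinearMap.inl ℝ E ℝ) y :=
      hasFDerivAt_prodMk_left y t
    exact h1.comp y h2

/-- Induction on the order of smoothness. The target is generalized because the derivative is again
a parametric integral, now with values in `E →L[ℝ] F`. -/
theorem contDiff_parametric_integral [FiniteDimensional ℝ E] {f : E × ℝ → F}
    (hf : ContDiff ℝ ∞ f) (a b : ℝ) :
    ContDiff ℝ ∞ (fun x => ∫ s in a..b, f (x, s)) := by
  rw [contDiff_infty]
  intro n
  replace hf : ContDiff ℝ n f := hf.of_le (by exact_mod_cast le_top)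
  induction n generalizing F with
  | zero =>
    rw [Nat.cast_zero, contDiff_zero] at *
    exact intervalIntegral.continuous_parametric_intervalIntegral_of_continuous'
      (f := fun x s => f (x, s)) hf a b
  | succ n ih =>
    push_cast at hf ⊢
    rw [contDiff_succ_iff_hasFDerivAt]
    refine ⟨fun x => ∫ s in a..b, (fderiv ℝ f (x, s)).comp (ContinuousLinearMap.inl ℝ E ℝ), ?_, ?_⟩
    · apply ih (F := E →L[ℝ] F) (f := fun p => (fderiv ℝ f p).comp (ContinuousLinearMap.inl ℝ E ℝ))
      exact (hf.fderiv_right le_rfl).clm_comp contDiff_const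
    · exact hasFDerivAt_parametric_integral (hf.of_le (by simp)) a b

/-- Hadamard's lemma with parameters. -/
theorem exists_hadamard [FiniteDimensional ℝ E] [FiniteDimensional ℝ Q] [CompleteSpace F]
    {f : E × Q → F} (hf : ContDiff ℝ ∞ f) :
    ∃ M : E × Q → E →L[ℝ] F, ContDiff ℝ ∞ M ∧
      (∀ y q, f (y, q) = f (0, q) + M (y, q) y) ∧
      (∀ q, M (0, q) = fderiv ℝ (fun y => f (y, q)) 0) ∧
      (∀ q q', (∀ y, f (y, q) = f (y, q')) → ∀ y, M (y, q) = M (y, q')) := by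
  have hpart : ∀ (y : E) (q : Q), HasFDerivAt (fun y => f (y, q))
      ((fderiv ℝ f (y, q)).comp (ContinuousLinearMap.inl ℝ E Q)) y := fun y q =>
    ((hf.differentiable (by simp) (y, q)).hasFDerivAt).comp y (hasFDerivAt_prodMk_left y q)
  let D : E × Q → E →L[ℝ] F := fun p => (fderiv ℝ f p).comp (ContinuousLinearMap.inl ℝ E Q)
  have hD : ContDiff ℝ ∞ D := (hf.fderiv_right (by simp)).clm_comp contDiff_const
  -- The mean of the partial derivative along the segment from `0` to `y`. It sees `q` only through
  -- the slice `f (·, q)`, so periodicity of `f` in a parameter passes to the quotient; this is the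
  -- fourth property.
  refine ⟨fun p => ∫ s in (0 : ℝ)..1, D (s • p.1, p.2), ?_, ?_, ?_, ?_⟩
  · exact contDiff_parametric_integral (E := E × Q) (f := fun p => D (p.2 • p.1.1, p.1.2))
      (hD.comp (by fun_prop)) 0 1
  · intro y q
    have hcont : Continuous fun s : ℝ => D (s • y, q) := hD.continuous.comp (by fun_prop)
    have h1 : ∀ s ∈ Set.uIcc (0 : ℝ) 1,
        HasDerivAt (fun s : ℝ => f (s • y, q)) (D (s • y, q) y) s := by
      intro s _
      have := (hpart (s • y) q).comp_hasDerivAt s ((hasDerivAt_id s).smul_const y)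
      simpa [D, Function.comp_def] using this
    have h2 := intervalIntegral.integral_eq_sub_of_hasDerivAt h1
      ((hcont.clm_apply continuous_const).intervalIntegrable _ _)
    rw [ContinuousLinearMap.intervalIntegral_apply (hcont.intervalIntegrable _ _), h2]
    simp
  · intro q
    rw [(hpart 0 q).fderiv]
    simp [D]
  · intro q q' h y
    have : ∀ y, D (y, q) = D (y, q') := fun y => by
      have h1 := hpart y q
      rw [show (fun y => f (y, q)) = fun y => f (y, q') from funext h] at h1
      exact h1.unique (hpart y q')
    simp only [this]

/-- A smooth function that is `O(ε ^ n)` for every value of a parameter is `ε ^ n` times a smooth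
function. -/
theorem exists_eq_pow_smul [FiniteDimensional ℝ Q] [CompleteSpace F] (n : ℕ)
    {g : Q × ℝ → F} (hg : ContDiff ℝ ∞ g)
    (h : ∀ q, (fun ε : ℝ => g (q, ε)) =O[nhdsWithin 0 {0}ᶜ] fun ε : ℝ => ε ^ n) :
    ∃ r : Q × ℝ → F, ContDiff ℝ ∞ r ∧ ∀ q ε, g (q, ε) = ε ^ n • r (q, ε) := by
  induction n generalizing g with
  | zero => exact ⟨g, hg, by simp⟩
  | succ n ih =>
    have h0 : ∀ q, g (q, 0) = 0 := by
      intro q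
      have h1 : Filter.Tendsto (fun ε : ℝ => g (q, ε)) (nhdsWithin 0 {0}ᶜ) (nhds 0) := by
        refine (h q).trans_tendsto ?_
        have : Filter.Tendsto (fun ε : ℝ => ε ^ (n + 1)) (nhds 0) (nhds (0 ^ (n + 1))) :=
          (continuous_pow (n + 1)).tendsto 0
        rw [zero_pow (by simp)] at this
        exact this.mono_left nhdsWithin_le_nhds
      have h2 : Filter.Tendsto (fun ε : ℝ => g (q, ε)) (nhdsWithin 0 {0}ᶜ) (nhds (g (q, 0))) :=
        ((hg.continuous.comp (by fun_prop : Continuous fun ε : ℝ => (q, ε))).tendsto 0).mono_left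
          nhdsWithin_le_nhds
      exact tendsto_nhds_unique h2 h1
    -- Hadamard's lemma in `ε` splits off one factor `ε`; the quotient is `O(ε ^ n)` and feeds the
    -- induction.
    obtain ⟨M, hM, hM1, -⟩ := exists_hadamard (E := ℝ) (Q := Q) (f := fun p => g (p.2, p.1))
      (hg.comp (by fun_prop))
    have hM2 : ∀ q ε, g (q, ε) = ε • M (ε, q) 1 := by
      intro q ε
      have := hM1 ε q
      simp only [h0, zero_add] at this
      rw [this, ← map_smul]; simp
    have h3 : ContDiff ℝ ∞ (fun p : Q × ℝ => M (p.2, p.1) 1) :=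
      (hM.comp (by fun_prop : ContDiff ℝ ∞ fun p : Q × ℝ => (p.2, p.1))).clm_apply contDiff_const
    obtain ⟨r, hr, hr'⟩ := ih (g := fun p : Q × ℝ => M (p.2, p.1) 1) h3 (by
      intro q
      obtain ⟨C, hC⟩ := (h q).bound
      refine Asymptotics.IsBigO.of_bound C ?_
      filter_upwards [hC, self_mem_nhdsWithin] with ε h4 h5
      have hε : 0 < |ε| := abs_pos.2 h5
      rw [hM2, norm_smul, pow_succ, norm_mul] at h4
      refine le_of_mul_le_mul_left ?_ hε
      calc |ε| * ‖M (ε, q) 1‖ ≤ C * (‖ε ^ n‖ * ‖ε‖) := h4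
        _ = |ε| * (C * ‖ε ^ n‖) := by rw [Real.norm_eq_abs ε]; ring)
    refine ⟨r, hr, fun q ε => ?_⟩
    rw [hM2, hr', smul_smul, pow_succ']

/-- A `C¹` function is Lipschitz on compact convex sets. -/
theorem exists_lipschitz_bound [FiniteDimensional ℝ E] {f : E → F} (hf : ContDiff ℝ 1 f)
    {K : Set E} (hK : IsCompact K) :
    ∃ C : ℝ, 0 ≤ C ∧ ∀ x ∈ K, ∀ y ∈ K, ‖f x - f y‖ ≤ C * ‖x - y‖ := by
  obtain ⟨C, hC⟩ := (hf.locallyLipschitz.locallyLipschitzOn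
    (s := K)).exists_lipschitzOnWith_of_compact hK
  exact ⟨C, C.2, fun x hx y hy => by simpa [dist_eq_norm] using hC.dist_le_mul x hx y hy⟩

/-- The representative in `[0, 2π]` of a point on the circle. -/
theorem exists_mem_Icc_periodic {X : Type} {g : ℝ → X} (hg : Function.Periodic g (2 * π)) (θ : ℝ) :
    ∃ t ∈ Set.Icc 0 (2 * π), g t = g θ := by
  obtain ⟨t, ht, h⟩ := hg.exists_mem_Ico₀ two_pi_pos θ
  exact ⟨t, ⟨ht.1, ht.2.le⟩, h.symm⟩

/-- A nonlinear term `N(x, θ, ε)`, periodic in `θ`, that vanishes with its `x`-derivative at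
`(0, θ, 0)`, has a small Lipschitz constant near there. -/
theorem exists_nonlinear_bound [FiniteDimensional ℝ E] {N : E × ℝ × ℝ → F} (hN : ContDiff ℝ ∞ N)
    (hper : ∀ x ε, Function.Periodic (fun θ => N (x, θ, ε)) (2 * π))
    (h0 : ∀ θ, N (0, θ, 0) = 0) (h1 : ∀ θ, HasFDerivAt (fun x => N (x, θ, 0)) (0 : E →L[ℝ] F) 0) :
    ∃ C : ℝ, 0 ≤ C ∧ (∀ θ ε, |ε| ≤ 1 → ‖N (0, θ, ε)‖ ≤ C * |ε|) ∧
      ∀ x y θ ε ρ, ρ ≤ 1 → |ε| ≤ 1 → ‖x‖ ≤ ρ → ‖y‖ ≤ ρ →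
        ‖N (x, θ, ε) - N (y, θ, ε)‖ ≤ C * (ρ + |ε|) * ‖x - y‖ := by
  have hprop : ProperSpace E := FiniteDimensional.proper ℝ E
  let D : E × ℝ × ℝ → E →L[ℝ] F :=
    fun p => (fderiv ℝ N p).comp (ContinuousLinearMap.inl ℝ E (ℝ × ℝ))
  have hpart : ∀ x q, HasFDerivAt (fun x => N (x, q)) (D (x, q)) x := fun x q =>
    ((hN.differentiable (by simp) (x, q)).hasFDerivAt).comp x (hasFDerivAt_prodMk_left x q)
  have hD : ContDiff ℝ ∞ D := (hN.fderiv_right (by simp)).clm_comp contDiff_const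
  have hD0 : ∀ θ, D (0, θ, 0) = 0 := fun θ => (hpart 0 (θ, 0)).unique (h1 θ)
  let K : Set (E × ℝ × ℝ) :=
    Metric.closedBall 0 1 ×ˢ Set.Icc 0 (2 * π) ×ˢ Set.Icc (-1) 1
  have hK : IsCompact K := (isCompact_closedBall _ _).prod (isCompact_Icc.prod isCompact_Icc)
  obtain ⟨C1, hC1, hN1⟩ := exists_lipschitz_bound (hN.of_le (by simp)) hK
  obtain ⟨C2, hC2, hD1⟩ := exists_lipschitz_bound (hD.of_le (by simp)) hK
  refine ⟨C1 + C2, by positivity, ?_, ?_⟩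
  · intro θ ε hε
    obtain ⟨t, ht, h⟩ := exists_mem_Icc_periodic (hper 0 ε) θ
    have := hN1 (0, t, ε) ⟨by simp, ht, abs_le.1 hε⟩ (0, t, 0) ⟨by simp, ht, by simp⟩
    simp only [h0, sub_zero, Prod.mk_sub_mk, sub_self, Prod.norm_mk, norm_zero] at this
    rw [← h]
    refine this.trans ?_
    have h2 : max 0 (max 0 ‖ε‖) = |ε| := by
      rw [Real.norm_eq_abs, max_eq_right (abs_nonneg ε), max_eq_right (abs_nonneg ε)]
    rw [h2]
    gcongr; linarith
  · intro x y θ ε ρ hρ hε hx hy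
    obtain ⟨t, ht, h⟩ := exists_mem_Icc_periodic
      (g := fun θ => N (x, θ, ε) - N (y, θ, ε)) (fun θ => by
        have h1 := hper x ε θ
        have h2 := hper y ε θ
        simp only at h1 h2 ⊢
        rw [h1, h2]) θ
    rw [← h]
    have hρ0 : 0 ≤ ρ := (norm_nonneg x).trans hx
    -- Mean value inequality on the ball of radius `ρ`: the `x`-derivative is Lipschitz and vanishes
    -- at `(0, t, 0)`, hence is `O(ρ + |ε|)` there.
    refine (convex_closedBall (0 : E) ρ).norm_image_sub_le_of_norm_hasFDerivWithin_le
      (f := fun x => N (x, t, ε)) (f' := fun x => D (x, t, ε))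
      (fun z _ => (hpart z (t, ε)).hasFDerivWithinAt) (fun z hz => ?_)
      (by simpa using hy) (by simpa using hx)
    have hz' : ‖z‖ ≤ ρ := by simpa using hz
    have := hD1 (z, t, ε) ⟨by simpa using hz'.trans hρ, ht, abs_le.1 hε⟩ (0, t, 0)
      ⟨by simp, ht, by simp⟩
    simp only [hD0, sub_zero, Prod.mk_sub_mk, sub_self, Prod.norm_mk, norm_zero] at this
    refine this.trans ?_
    have h2 : max ‖z‖ (max 0 ‖ε‖) ≤ ρ + |ε| := by
      refine max_le (by linarith [abs_nonneg ε]) (max_le (by positivity) ?_)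
      rw [Real.norm_eq_abs]; linarith
    calc C2 * max ‖z‖ (max 0 ‖ε‖) ≤ C2 * (ρ + |ε|) := by gcongr
      _ ≤ (C1 + C2) * (ρ + |ε|) := by gcongr; linarith

end Calculus

/-! ### Linear periodic problems with constant coefficients. -/

section PeriodicSolver

variable {W K : Type} [NormedAddCommGroup W] [NormedSpace ℝ W] [FiniteDimensional ℝ W]
  [NormedAddCommGroup K] [NormedSpace ℝ K] [FiniteDimensional ℝ K]

/-- The flow `exp (t A)` of a linear vector field. -/
def expFlow (A : W →L[ℝ] W) (t : ℝ) : W →L[ℝ] W := NormedSpace.exp (t • A)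

theorem expFlow_zero (A : W →L[ℝ] W) : expFlow A 0 = 1 := by
  simp [expFlow]

theorem expFlow_add (A : W →L[ℝ] W) (s t : ℝ) :
    expFlow A (s + t) = expFlow A s * expFlow A t := by
  have : CompleteSpace W := FiniteDimensional.complete ℝ W
  have : NormedAlgebra ℚ (W →L[ℝ] W) := NormedAlgebra.restrictScalars ℚ ℝ (W →L[ℝ] W)
  rw [expFlow, add_smul, NormedSpace.exp_add_of_commute]
  · rfl
  · exact ((Commute.refl A).smul_left s).smul_right t

theorem hasDerivAt_expFlow (A : W →L[ℝ] W) (t : ℝ) :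
    HasDerivAt (expFlow A) (A * expFlow A t) t := by
  have : CompleteSpace W := FiniteDimensional.complete ℝ W
  exact hasDerivAt_exp_smul_const' (𝕂 := ℝ) A t

theorem hasDerivAt_expFlow' (A : W →L[ℝ] W) (t : ℝ) :
    HasDerivAt (expFlow A) (expFlow A t * A) t := by
  have : CompleteSpace W := FiniteDimensional.complete ℝ W
  exact hasDerivAt_exp_smul_const (𝕂 := ℝ) A t

theorem continuous_expFlow (A : W →L[ℝ] W) : Continuous (expFlow A) :=
  continuous_iff_continuousAt.2 fun t => (hasDerivAt_expFlow A t).continuousAt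

theorem expFlow_apply_neg (A : W →L[ℝ] W) (t : ℝ) (x : W) :
    expFlow A t (expFlow A (-t) x) = x := by
  rw [← mul_apply_eq_comp, ← expFlow_add, add_neg_cancel, expFlow_zero]; rfl

/-- Solutions of a linear equation are given by the flow. -/
theorem eq_expFlow_of_hasDerivAt {A : W →L[ℝ] W} {w : ℝ → W}
    (h : ∀ t, HasDerivAt w (A (w t)) t) (t s : ℝ) : w (t + s) = expFlow A s (w t) := by
  have h1 : ∀ s, HasDerivAt (fun s => expFlow A (-s) (w (t + s))) 0 s := by
    intro s
    have h2 : HasDerivAt (fun s : ℝ => expFlow A (-s)) (-(expFlow A (-s) * A)) s := by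
      simpa [Function.comp_def] using (hasDerivAt_expFlow' A (-s)).scomp s (hasDerivAt_neg s)
    have h3 : HasDerivAt (fun s => w (t + s)) (A (w (t + s))) s := by
      simpa [Function.comp_def] using (h (t + s)).scomp s ((hasDerivAt_id s).const_add t)
    simpa using h2.clm_apply h3
  have h4 := is_const_of_deriv_eq_zero (fun s => (h1 s).differentiableAt)
    (fun s => (h1 s).deriv) s 0
  simp only [neg_zero, expFlow_zero, add_zero] at h4
  rw [← expFlow_apply_neg A s (w (t + s)), h4]; rfl

/-- If the flow has no nonzero `2π`-periodic orbit, then the inhomogeneous equation has a periodic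
solution, bounded by the right-hand side. -/
theorem exists_periodic_solution (A : W →L[ℝ] W)
    (hinj : ∀ x, expFlow A (2 * π) x = x → x = 0) :
    ∃ C : ℝ, 0 ≤ C ∧ ∀ f : ℝ → W, Continuous f → Function.Periodic f (2 * π) →
      ∃ w : ℝ → W, Function.Periodic w (2 * π) ∧ (∀ t, HasDerivAt w (A (w t) + f t) t) ∧
        ∀ M, (∀ t, ‖f t‖ ≤ M) → ∀ t, ‖w t‖ ≤ C * M := by
  have : CompleteSpace W := FiniteDimensional.complete ℝ W
  -- The solution will be `e^{tA} B⁻¹ ∫_t^{t+2π} e^{-sA} f(s) ds`. Without nonzero periodic orbits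
  -- `B` is injective, hence invertible in finite dimension.
  let B : W →L[ℝ] W := expFlow A (-(2 * π)) - 1
  have hB : Function.Injective B := by
    refine (injective_iff_map_eq_zero B).2 fun x hx => hinj x ?_
    have hx' : expFlow A (-(2 * π)) x = x := sub_eq_zero.1 hx
    conv_lhs => rw [← hx']
    exact expFlow_apply_neg _ _ _
  let G : W ≃L[ℝ] W := (LinearEquiv.ofInjectiveEndo (B : W →ₗ[ℝ] W) hB).toContinuousLinearEquiv
  have hG : ∀ x, G x = expFlow A (-(2 * π)) x - x := fun x => rfl
  have hGG : ∀ x, G.symm (expFlow A (-(2 * π)) x) = expFlow A (-(2 * π)) (G.symm x) := by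
    intro x
    have h1 : expFlow A (-(2 * π)) x = G x + x := by rw [hG]; abel
    have h2 : expFlow A (-(2 * π)) (G.symm x) = G (G.symm x) + G.symm x := by rw [hG]; abel
    rw [h1, h2, map_add]; simp
  -- By periodicity `w` need only be estimated on `[0, 2π]`, where the integration variable stays in
  -- `[0, 4π]`.
  obtain ⟨M1, hM1⟩ := (isCompact_Icc (a := -(4 * π)) (b := 4 * π)).exists_bound_of_continuousOn
    (continuous_expFlow A).continuousOn
  have hM1' : 0 ≤ M1 := (norm_nonneg _).trans (hM1 0 (by constructor <;> linarith [pi_pos]))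
  refine ⟨M1 * (‖(G.symm : W →L[ℝ] W)‖ * (M1 * (2 * π))), by positivity, fun f hf hper => ?_⟩
  have hg : Continuous fun t => expFlow A (-t) (f t) :=
    ((continuous_expFlow A).comp continuous_neg).clm_apply hf
  have hint : ∀ a b, IntervalIntegrable (fun t => expFlow A (-t) (f t)) MeasureTheory.volume a b :=
    fun a b => hg.intervalIntegrable a b
  let J : ℝ → W := fun x => ∫ t in x..x + 2 * π, expFlow A (-t) (f t)
  have hJ : ∀ t, HasDerivAt J
      (expFlow A (-(t + 2 * π)) (f (t + 2 * π)) - expFlow A (-t) (f t)) t := by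
    intro t
    have h1 : ∀ x, HasDerivAt (fun x => ∫ t in (0 : ℝ)..x, expFlow A (-t) (f t))
        (expFlow A (-x) (f x)) x := fun x =>
      intervalIntegral.integral_hasDerivAt_right (hint _ _)
        hg.stronglyMeasurable.stronglyMeasurableAtFilter hg.continuousAt
    have h2 : HasDerivAt (fun x => ∫ t in (0 : ℝ)..x + 2 * π, expFlow A (-t) (f t))
        (expFlow A (-(t + 2 * π)) (f (t + 2 * π))) t := by
      have := (h1 (t + 2 * π)).scomp t ((hasDerivAt_id t).add_const (2 * π))
      simpa [Function.comp_def] using this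
    refine (h2.sub (h1 t)).congr_of_eventuallyEq (.of_forall fun x => ?_)
    simp only [J, Pi.sub_apply]
    rw [intervalIntegral.integral_interval_sub_left (hint _ _) (hint _ _)]
  have hJper : ∀ t, J (t + 2 * π) = expFlow A (-(2 * π)) (J t) := by
    intro t
    simp only [J]
    rw [← ContinuousLinearMap.intervalIntegral_comp_comm _ (hint _ _)]
    rw [← intervalIntegral.integral_comp_add_right]
    refine intervalIntegral.integral_congr fun s _ => ?_
    rw [← mul_apply_eq_comp, ← expFlow_add, hper s]
    congr 2; ring
  let w : ℝ → W := fun t => expFlow A t (G.symm (J t))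
  have hw : Function.Periodic w (2 * π) := by
    intro t
    simp only [w]
    rw [hJper, hGG, expFlow_add, mul_apply_eq_comp, expFlow_apply_neg]
  refine ⟨w, hw, fun t => ?_, fun M hM t => ?_⟩
  · have h1 := (hasDerivAt_expFlow A t).clm_apply
      ((G.symm : W →L[ℝ] W).hasFDerivAt.comp_hasDerivAt t (hJ t))
    refine h1.congr_deriv ?_
    have h2 : expFlow A (-(t + 2 * π)) (f (t + 2 * π)) - expFlow A (-t) (f t)
        = G (expFlow A (-t) (f t)) := by
      rw [hG, hper t, ← mul_apply_eq_comp (expFlow A (-(2 * π))), ← expFlow_add]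
      congr 3; ring
    rw [h2]
    simp [w, expFlow_apply_neg]
  · obtain ⟨s, hs, hst⟩ := exists_mem_Icc_periodic hw t
    rw [← hst]
    have hM0 : 0 ≤ M := (norm_nonneg _).trans (hM 0)
    have h1 : ‖J s‖ ≤ M1 * (2 * π) * M := by
      have := intervalIntegral.norm_integral_le_of_norm_le_const (a := s) (b := s + 2 * π)
        (C := M1 * M) (f := fun t => expFlow A (-t) (f t)) (fun x hx => ?_)
      · refine this.trans (le_of_eq ?_)
        rw [add_sub_cancel_left, abs_of_pos two_pi_pos]; ring
      · rw [Set.uIoc_of_le (by linarith [pi_pos])] at hx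
        refine (ContinuousLinearMap.le_opNorm _ _).trans ?_
        refine mul_le_mul (hM1 _ ?_) (hM _) (norm_nonneg _) hM1'
        constructor <;> linarith [hx.1, hx.2, hs.1, hs.2]
    calc ‖w s‖ ≤ ‖expFlow A s‖ * (‖(G.symm : W →L[ℝ] W)‖ * ‖J s‖) :=
          (ContinuousLinearMap.le_opNorm _ _).trans (by
            gcongr; exact (G.symm : W →L[ℝ] W).le_opNorm _)
      _ ≤ M1 * (‖(G.symm : W →L[ℝ] W)‖ * (M1 * (2 * π) * M)) := by
          gcongr
          exact hM1 s (by constructor <;> linarith [hs.1, hs.2, pi_pos])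
      _ = _ := by ring

/-- `w` is a `2π`-periodic solution of `w' = A w + κ q + f` whose image under `ℓ` has mean zero. -/
structure IsPerSol (A : W →L[ℝ] W) (κ : K →L[ℝ] W) (ℓ : W →L[ℝ] K) (f w : ℝ → W) (q : K) :
    Prop where
  periodic : Function.Periodic w (2 * π)
  hasDerivAt : ∀ t, HasDerivAt w (A (w t) + κ q + f t) t
  mean : ∫ t in (0 : ℝ)..2 * π, ℓ (w t) = 0

theorem IsPerSol.continuous {A : W →L[ℝ] W} {κ : K →L[ℝ] W} {ℓ : W →L[ℝ] K} {f w : ℝ → W} {q : K}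
    (h : IsPerSol A κ ℓ f w q) : Continuous w :=
  continuous_iff_continuousAt.2 fun t => (h.hasDerivAt t).continuousAt

theorem IsPerSol.intervalIntegrable {A : W →L[ℝ] W} {κ : K →L[ℝ] W} {ℓ : W →L[ℝ] K} {f w : ℝ → W}
    {q : K} (h : IsPerSol A κ ℓ f w q) (a b : ℝ) :
    IntervalIntegrable (fun t => ℓ (w t)) MeasureTheory.volume a b :=
  (ℓ.continuous.comp h.continuous).intervalIntegrable _ _

/-- Used for `1 ± parity` and for the projection onto the critical components: whatever commutes
with the linear problem acts on its solutions. -/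
theorem IsPerSol.map {A : W →L[ℝ] W} {κ : K →L[ℝ] W} {ℓ : W →L[ℝ] K} {f w : ℝ → W} {q : K}
    (h : IsPerSol A κ ℓ f w q) {T : W →L[ℝ] W} {U : K →L[ℝ] K} (hA : ∀ x, T (A x) = A (T x))
    (hκ : ∀ q, T (κ q) = κ (U q)) (hl : ∀ x, ℓ (T x) = U (ℓ x)) :
    IsPerSol A κ ℓ (fun t => T (f t)) (fun t => T (w t)) (U q) where
  periodic t := by simp only [h.periodic t]
  hasDerivAt t := by
    have := T.hasFDerivAt.comp_hasDerivAt t (h.hasDerivAt t)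
    simpa [Function.comp_def, hA, hκ] using this
  mean := by
    simp only [hl]
    rw [ContinuousLinearMap.intervalIntegral_comp_comm U (h.intervalIntegrable _ _), h.mean,
      map_zero]

theorem IsPerSol.sub {A : W →L[ℝ] W} {κ : K →L[ℝ] W} {ℓ : W →L[ℝ] K} {f w f' w' : ℝ → W} {q q' : K}
    (h : IsPerSol A κ ℓ f w q) (h' : IsPerSol A κ ℓ f' w' q') :
    IsPerSol A κ ℓ (fun t => f t - f' t) (fun t => w t - w' t) (q - q') where
  periodic t := by simp only [h.periodic t, h'.periodic t]
  hasDerivAt t := by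
    refine ((h.hasDerivAt t).sub (h'.hasDerivAt t)).congr_deriv ?_
    simp only [map_sub]; abel
  mean := by
    simp only [map_sub]
    rw [intervalIntegral.integral_sub (h.intervalIntegrable _ _) (h'.intervalIntegrable _ _),
      h.mean, h'.mean, sub_zero]

/-- Hypotheses on `A`, its kernel (the range of `κ`) and the projection `κ ℓ` onto it that make the
periodic problem `w' = A w + κ q + f` uniquely solvable. -/
structure IsNonresonant (A : W →L[ℝ] W) (κ : K →L[ℝ] W) (ℓ : W →L[ℝ] K) : Prop where
  map_ker : ∀ q, A (κ q) = 0
  map_range : ∀ x, ℓ (A x) = 0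
  section_apply : ∀ q, ℓ (κ q) = q
  injective : ∀ x, expFlow (A + κ.comp ℓ) (2 * π) x = x → x = 0

/-- Applying `ℓ` leaves `(ℓ w)' = q`, so periodicity forces `q = 0` and the mean condition forces `ℓ
w = 0`. Then `w` is also a periodic orbit of `A + κ ℓ`, whose only such orbit is zero. -/
theorem IsPerSol.eq_zero {A : W →L[ℝ] W} {κ : K →L[ℝ] W} {ℓ : W →L[ℝ] K}
    (hA : IsNonresonant A κ ℓ) {w : ℝ → W} {q : K}
    (h : IsPerSol A κ ℓ (fun _ => 0) w q) : q = 0 ∧ ∀ t, w t = 0 := by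
  have : CompleteSpace K := FiniteDimensional.complete ℝ K
  have h1 : ∀ t, HasDerivAt (fun t => ℓ (w t)) q t := by
    intro t
    have := ℓ.hasFDerivAt.comp_hasDerivAt t (h.hasDerivAt t)
    simpa [Function.comp_def, hA.map_range, hA.section_apply] using this
  have h2 : ∀ t, ℓ (w t) = ℓ (w 0) + t • q := by
    intro t
    have h3 : ∀ t, HasDerivAt (fun t => ℓ (w t) - t • q) 0 t := fun t => by
      simpa using (h1 t).fun_sub ((hasDerivAt_id t).smul_const q)
    have := is_const_of_deriv_eq_zero (fun s => (h3 s).differentiableAt)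
      (fun s => (h3 s).deriv) t 0
    simp only [zero_smul, sub_zero] at this
    rw [← this]; abel
  have hq : q = 0 := by
    have h3 := h2 (2 * π)
    have h4 := h.periodic 0
    rw [zero_add] at h4
    rw [h4, left_eq_add, smul_eq_zero] at h3
    exact h3.resolve_left two_pi_pos.ne'
  subst hq
  have hl : ∀ t, ℓ (w t) = 0 := by
    have h3 := h.mean
    have h4 : ∀ t, ℓ (w t) = ℓ (w 0) := fun t => by rw [h2 t, smul_zero, add_zero]
    rw [intervalIntegral.integral_congr (g := fun _ => ℓ (w 0)) fun t _ => h4 t,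
      intervalIntegral.integral_const, sub_zero, smul_eq_zero] at h3
    intro t
    rw [h4 t, h3.resolve_left two_pi_pos.ne']
  refine ⟨rfl, fun t => hA.injective _ ?_⟩
  have h3 : ∀ t, HasDerivAt w ((A + κ.comp ℓ) (w t)) t := fun t =>
    (h.hasDerivAt t).congr_deriv (by simp [hl])
  rw [← eq_expFlow_of_hasDerivAt h3 t, h.periodic t]

/-- Split `f` along `κ ℓ`. The complementary part is handled by `A + κ ℓ`; along the kernel one
integrates directly, with `q` cancelling the mean of `ℓ f` and `m` normalizing the primitive. -/
theorem exists_isPerSol {A : W →L[ℝ] W} {κ : K →L[ℝ] W} {ℓ : W →L[ℝ] K}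
    (hA : IsNonresonant A κ ℓ) :
    ∃ C : ℝ, 0 ≤ C ∧ ∀ f : ℝ → W, Continuous f → Function.Periodic f (2 * π) →
      ∃ w q, IsPerSol A κ ℓ f w q ∧
        ∀ M, (∀ t, ‖f t‖ ≤ M) → (∀ t, ‖w t‖ ≤ C * M) ∧ ‖q‖ ≤ C * M := by
  have : CompleteSpace K := FiniteDimensional.complete ℝ K
  obtain ⟨C, hC, hsol⟩ := exists_periodic_solution _ hA.injective
  refine ⟨C * (1 + ‖κ‖ * ‖ℓ‖) + ‖κ‖ * (8 * π * ‖ℓ‖) + ‖ℓ‖, by positivity, fun f hf hper => ?_⟩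
  have hlf : Continuous fun t => ℓ (f t) := ℓ.continuous.comp hf
  let q : K := -((2 * π)⁻¹ • ∫ t in (0 : ℝ)..2 * π, ℓ (f t))
  have hgc : Continuous fun t => ℓ (f t) + q := hlf.add continuous_const
  have hgi : ∀ a b, IntervalIntegrable (fun t => ℓ (f t) + q) MeasureTheory.volume a b :=
    fun a b => hgc.intervalIntegrable a b
  have hg0 : ∫ t in (0 : ℝ)..2 * π, (ℓ (f t) + q) = 0 := by
    rw [intervalIntegral.integral_add (hlf.intervalIntegrable _ _) intervalIntegrable_const,
      intervalIntegral.integral_const, sub_zero]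
    simp only [q]
    rw [smul_neg, smul_inv_smul₀ two_pi_pos.ne', add_neg_cancel]
  let H : ℝ → K := fun x => ∫ t in (0 : ℝ)..x, (ℓ (f t) + q)
  have hH : ∀ t, HasDerivAt H (ℓ (f t) + q) t := fun x =>
    intervalIntegral.integral_hasDerivAt_right (hgi _ _)
      hgc.stronglyMeasurable.stronglyMeasurableAtFilter hgc.continuousAt
  have hHc : Continuous H := continuous_iff_continuousAt.2 fun t => (hH t).continuousAt
  have hHper : Function.Periodic H (2 * π) := by
    intro t
    have hp : Function.Periodic (fun t => ℓ (f t) + q) (2 * π) := fun t => by simp only [hper t]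
    have h1 := hp.intervalIntegral_add_eq t 0
    rw [zero_add, hg0] at h1
    simp only [H]
    rw [← intervalIntegral.integral_add_adjacent_intervals (hgi 0 t) (hgi t _), h1, add_zero]
  let m : K := (2 * π)⁻¹ • ∫ t in (0 : ℝ)..2 * π, H t
  obtain ⟨s, hsper, hs, hsM⟩ := hsol (fun t => f t - κ (ℓ (f t)))
    (hf.sub (κ.continuous.comp hlf)) (fun t => by simp only [hper t])
  -- `κ ℓ s` is itself a periodic orbit of `A + κ ℓ`, hence zero; so `s` solves the equation with
  -- `A` alone.
  have hls : ∀ t, ℓ (s t) = 0 := by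
    intro t
    have h1 : ∀ t, HasDerivAt (fun t => κ (ℓ (s t))) ((A + κ.comp ℓ) (κ (ℓ (s t)))) t := by
      intro t
      have := (κ.comp ℓ).hasFDerivAt.comp_hasDerivAt t (hs t)
      simpa [Function.comp_def, hA.map_ker, hA.map_range, hA.section_apply] using this
    have h2 := hA.injective (κ (ℓ (s t))) (by
      rw [← eq_expFlow_of_hasDerivAt h1 t, hsper t])
    rw [← hA.section_apply (ℓ (s t)), h2, map_zero]
  refine ⟨fun t => s t + κ (H t - m), q, ⟨fun t => ?_, fun t => ?_, ?_⟩, fun M hM => ?_⟩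
  · simp only [hsper t, hHper t]
  · have h1 := κ.hasFDerivAt.comp_hasDerivAt t ((hH t).sub_const m)
    refine ((hs t).fun_add h1).congr_deriv ?_
    simp only [add_apply, ContinuousLinearMap.comp_apply, hls, map_zero,
      map_add, hA.map_ker]
    abel
  · simp only [map_add, hls, zero_add, hA.section_apply]
    rw [intervalIntegral.integral_sub (hHc.intervalIntegrable _ _) intervalIntegrable_const,
      intervalIntegral.integral_const, sub_zero]
    simp only [m]
    rw [smul_inv_smul₀ two_pi_pos.ne', sub_self]
  · have hM0 : 0 ≤ M := (norm_nonneg _).trans (hM 0)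
    have hlM : ∀ t, ‖ℓ (f t)‖ ≤ ‖ℓ‖ * M := fun t => (ℓ.le_opNorm _).trans (by gcongr; exact hM t)
    have hmean : ∀ (g : ℝ → K) (M' : ℝ), (∀ t ∈ Set.Icc 0 (2 * π), ‖g t‖ ≤ M') →
        ‖(2 * π)⁻¹ • ∫ t in (0 : ℝ)..2 * π, g t‖ ≤ M' := by
      intro g M' hg
      have h1 := intervalIntegral.norm_integral_le_of_norm_le_const (a := 0) (b := 2 * π)
        (C := M') (f := g) (fun x hx => by
          rw [Set.uIoc_of_le two_pi_pos.le] at hx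
          exact hg x ⟨hx.1.le, hx.2⟩)
      rw [norm_smul, norm_inv, Real.norm_of_nonneg two_pi_pos.le, inv_mul_le_iff₀ two_pi_pos]
      rw [sub_zero, abs_of_pos two_pi_pos] at h1
      linarith
    have hq : ‖q‖ ≤ ‖ℓ‖ * M := by
      simp only [q, norm_neg]
      exact hmean _ _ fun t _ => hlM t
    have hHM : ∀ t ∈ Set.Icc 0 (2 * π), ‖H t‖ ≤ 4 * π * (‖ℓ‖ * M) := by
      intro t ht
      have h1 := intervalIntegral.norm_integral_le_of_norm_le_const (a := 0) (b := t)
        (C := 2 * (‖ℓ‖ * M)) (f := fun t => ℓ (f t) + q) (fun x _ =>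
          (norm_add_le _ _).trans (by linarith [hlM x]))
      rw [sub_zero, abs_of_nonneg ht.1] at h1
      refine h1.trans ?_
      have : 0 ≤ ‖ℓ‖ * M := by positivity
      nlinarith [ht.2]
    have hm : ‖m‖ ≤ 4 * π * (‖ℓ‖ * M) := hmean _ _ hHM
    have hHM' : ∀ t, ‖H t - m‖ ≤ 8 * π * ‖ℓ‖ * M := by
      intro t
      obtain ⟨t', ht', h⟩ := exists_mem_Icc_periodic hHper t
      rw [← h]
      refine (norm_sub_le _ _).trans ?_
      linarith [hHM t' ht']
    have hfM : ∀ t, ‖f t - κ (ℓ (f t))‖ ≤ (1 + ‖κ‖ * ‖ℓ‖) * M := by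
      intro t
      refine (norm_sub_le _ _).trans ?_
      have := (κ.le_opNorm (ℓ (f t))).trans (mul_le_mul_of_nonneg_left (hlM t) (norm_nonneg κ))
      linarith [hM t]
    have e1 : 0 ≤ ‖ℓ‖ * M := by positivity
    have e2 : 0 ≤ C * ((1 + ‖κ‖ * ‖ℓ‖) * M) := by positivity
    have e3 : 0 ≤ ‖κ‖ * (8 * π * ‖ℓ‖ * M) := by positivity
    refine ⟨fun t => ?_, ?_⟩
    · refine (norm_add_le _ _).trans ?_
      have h1 := hsM _ hfM t
      have h2 := (κ.le_opNorm (H t - m)).trans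
        (mul_le_mul_of_nonneg_left (hHM' t) (norm_nonneg κ))
      linarith
    · linarith

/-- Periodic solutions are bounded by the right-hand side. -/
theorem exists_isPerSol_bound {A : W →L[ℝ] W} {κ : K →L[ℝ] W} {ℓ : W →L[ℝ] K}
    (hA : IsNonresonant A κ ℓ) :
    ∃ C : ℝ, 0 ≤ C ∧ ∀ (f w : ℝ → W) (q : K) (M : ℝ), IsPerSol A κ ℓ f w q → Continuous f →
      Function.Periodic f (2 * π) → (∀ t, ‖f t‖ ≤ M) → (∀ t, ‖w t‖ ≤ C * M) ∧ ‖q‖ ≤ C * M := by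
  obtain ⟨C, hC, h⟩ := exists_isPerSol hA
  refine ⟨C, hC, fun f w q M hw hf hper hM => ?_⟩
  obtain ⟨w', q', hw', hb⟩ := h f hf hper
  have h1 := hw.sub hw'
  simp only [sub_self] at h1
  obtain ⟨h2, h3⟩ := h1.eq_zero hA
  rw [sub_eq_zero.1 h2, show w = w' from funext fun t => sub_eq_zero.1 (h3 t)]
  exact hb M hM

end PeriodicSolver

/-! ### Small nonlinear periodic problems: branch, uniqueness, error bound. -/

section NonlinearSolver

variable {W K : Type} [NormedAddCommGroup W] [NormedSpace ℝ W] [FiniteDimensional ℝ W]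
  [NormedAddCommGroup K] [NormedSpace ℝ K] [FiniteDimensional ℝ K]

/-- Absorption: for the least common bound `M` of `d` and `p` the hypothesis gives `M ≤ a + M / 2`.
The crude bound `M₀` only makes the supremum finite. -/
theorem bound_of_half {d : ℝ → W} {p : K} {a M₀ : ℝ} (h₀ : ∀ t, ‖d t‖ ≤ M₀)
    (h : ∀ M, (∀ t, ‖d t‖ ≤ M) → ‖p‖ ≤ M → (∀ t, ‖d t‖ ≤ a + M / 2) ∧ ‖p‖ ≤ a + M / 2) :
    (∀ t, ‖d t‖ ≤ 2 * a) ∧ ‖p‖ ≤ 2 * a := by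
  have hb : BddAbove (Set.range fun t => ‖d t‖) := ⟨M₀, by rintro _ ⟨t, rfl⟩; exact h₀ t⟩
  have h1 : ∀ t, ‖d t‖ ≤ max ‖p‖ (⨆ t, ‖d t‖) := fun t =>
    (le_ciSup hb t).trans (le_max_right _ _)
  obtain ⟨h2, h3⟩ := h _ h1 (le_max_left _ _)
  have h4 : max ‖p‖ (⨆ t, ‖d t‖) ≤ a + max ‖p‖ (⨆ t, ‖d t‖) / 2 := max_le h3 (ciSup_le h2)
  have h5 : max ‖p‖ (⨆ t, ‖d t‖) ≤ 2 * a := by linarith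
  exact ⟨fun t => (h1 t).trans h5, (le_max_left _ _).trans h5⟩

theorem exists_small_constants (a : ℝ) (ha : 0 ≤ a) :
    ∃ δ > (0 : ℝ), δ ≤ 1 / 2 ∧ a * (δ + δ) ≤ 1 / 2 := by
  refine ⟨1 / (4 * a + 2), by positivity, ?_, ?_⟩
  · rw [div_le_div_iff₀ (by positivity) (by positivity)]; linarith
  · have : (0 : ℝ) < 4 * a + 2 := by positivity
    field_simp
    linarith

open scoped BoundedContinuousFunction in
/-- Existence for a periodic problem that is a small perturbation of a nonresonant one. -/
theorem exists_fixed_periodic {A : W →L[ℝ] W} {κ : K →L[ℝ] W} {ℓ : W →L[ℝ] K}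
    (hA : IsNonresonant A κ ℓ) (b : K ≃L[ℝ] K) {C δ : ℝ} (hδ : 0 < δ)
    (hC : ∀ (f w : ℝ → W) (p : K) (M : ℝ), IsPerSol A κ ℓ f w (b p) → Continuous f →
      Function.Periodic f (2 * π) → (∀ t, ‖f t‖ ≤ M) → (∀ t, ‖w t‖ ≤ C * M) ∧ ‖p‖ ≤ C * M)
    {g : W × K → ℝ → W} (hg : Continuous fun q : (W × K) × ℝ => g q.1 q.2)
    (hgper : ∀ x, Function.Periodic (g x) (2 * π)) {B : ℝ} (hB : C * B ≤ δ)
    (hgB : ∀ x t, ‖x‖ ≤ δ → ‖g x t‖ ≤ B) {a : ℝ} (ha0 : 0 ≤ a) (ha : C * a ≤ 1 / 2)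
    (hga : ∀ x y t, ‖x‖ ≤ δ → ‖y‖ ≤ δ → ‖g x t - g y t‖ ≤ a * ‖x - y‖) :
    ∃ w p, IsPerSol A κ ℓ (fun t => g (w t, p) t) w (b p) ∧ (∀ t, ‖w t‖ ≤ δ) ∧ ‖p‖ ≤ δ := by
  have : CompleteSpace W := FiniteDimensional.complete ℝ W
  have : CompleteSpace K := FiniteDimensional.complete ℝ K
  -- The iteration takes place in a closed subset of the complete space of bounded continuous
  -- functions times `K`; periodicity is a closed condition.
  let X : Set ((ℝ →ᵇ W) × K) := {x | Function.Periodic x.1 (2 * π) ∧ ‖x.1‖ ≤ δ ∧ ‖x.2‖ ≤ δ}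
  have hX : IsClosed X := by
    have h1 : X = (⋂ t : ℝ, {x : (ℝ →ᵇ W) × K | x.1 (t + 2 * π) = x.1 t}) ∩
        ({x | ‖x.1‖ ≤ δ} ∩ {x | ‖x.2‖ ≤ δ}) := by
      ext x; simp [X, Function.Periodic]
    rw [h1]
    refine (isClosed_iInter fun t => ?_).inter ((isClosed_le ?_ ?_).inter (isClosed_le ?_ ?_))
    · exact isClosed_eq ((BoundedContinuousFunction.lipschitz_eval_const (t + 2 * π)).continuous.comp
        continuous_fst) ((BoundedContinuousFunction.lipschitz_eval_const t).continuous.comp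
        continuous_fst)
    all_goals fun_prop
  have hx : ∀ x ∈ X, ∀ t, ‖(x.1 t, x.2)‖ ≤ δ := fun x hx t =>
    max_le ((x.1.norm_coe_le_norm t).trans hx.2.1) hx.2.2
  have hcont : ∀ x : (ℝ →ᵇ W) × K, Continuous fun t => g (x.1 t, x.2) t := fun x =>
    hg.comp ((x.1.continuous.prodMk continuous_const).prodMk continuous_id)
  have hper : ∀ x ∈ X, Function.Periodic (fun t => g (x.1 t, x.2) t) (2 * π) := fun x hx t => by
    simp only [hx.1 t]; exact hgper _ t
  -- One iteration freezes the nonlinearity and solves the linear problem; `C * B ≤ δ` keeps the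
  -- iterate in `X`.
  have hstep : ∀ x : X, ∃ y : X,
      IsPerSol A κ ℓ (fun t => g (x.1.1 t, x.1.2) t) y.1.1 (b y.1.2) := by
    rintro ⟨x, hxX⟩
    obtain ⟨_, _, hs⟩ := exists_isPerSol hA
    obtain ⟨w, q, hw, -⟩ := hs _ (hcont x) (hper x hxX)
    have hw' : IsPerSol A κ ℓ (fun t => g (x.1 t, x.2) t) w (b (b.symm q)) := by simpa using hw
    obtain ⟨h1, h2⟩ := hC _ _ _ _ hw' (hcont x) (hper x hxX) fun t => hgB _ t (hx x hxX t)
    have h1' : ∀ t, ‖w t‖ ≤ δ := fun t => (h1 t).trans hB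
    refine ⟨⟨(BoundedContinuousFunction.ofNormedAddCommGroup w hw.continuous δ h1', b.symm q),
      hw.periodic, ?_, h2.trans hB⟩, hw'⟩
    exact BoundedContinuousFunction.norm_ofNormedAddCommGroup_le hw.continuous hδ.le h1'
  choose Φ hΦ using hstep
  have hXc : CompleteSpace X := hX.completeSpace_coe
  have hXn : Nonempty X := ⟨⟨0, fun t => rfl, by simpa using hδ.le, by simpa using hδ.le⟩⟩
  have hcontr : ContractingWith (1 / 2) Φ := by
    refine ⟨by rw [← NNReal.coe_lt_coe]; norm_num, LipschitzWith.of_dist_le_mul fun x y => ?_⟩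
    have h1 := (hΦ x).sub (hΦ y)
    rw [← map_sub] at h1
    obtain ⟨h2, h3⟩ := hC _ _ _ (a * dist x y) h1 ((hcont x.1).sub (hcont y.1))
      ((hper x.1 x.2).sub (hper y.1 y.2)) (fun t => by
        refine (hga _ _ t (hx x.1 x.2 t) (hx y.1 y.2 t)).trans ?_
        gcongr
        rw [Subtype.dist_eq, dist_eq_norm, Prod.mk_sub_mk]
        refine max_le ?_ (norm_snd_le (x.1 - y.1))
        exact ((x.1.1 - y.1.1).norm_coe_le_norm t).trans (norm_fst_le (x.1 - y.1)))
    have h4 : C * (a * dist x y) ≤ 1 / 2 * dist x y := by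
      rw [← mul_assoc]; gcongr
    rw [Subtype.dist_eq (Φ x), dist_eq_norm]
    have h5 : (0 : ℝ) ≤ 1 / 2 * dist x y := by positivity
    refine max_le ?_ ?_
    · exact ((BoundedContinuousFunction.norm_le h5).2 fun t => (h2 t).trans h4).trans
        (by push_cast; rfl)
    · exact (h3.trans h4).trans (by push_cast; rfl)
  have hfix := hcontr.fixedPoint_isFixedPt
  set x := ContractingWith.fixedPoint Φ hcontr
  have h1 := hΦ x
  rw [hfix] at h1
  exact ⟨x.1.1, x.1.2, h1, fun t => (x.1.1.norm_coe_le_norm t).trans x.2.2.1, x.2.2.2⟩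

theorem exists_isPerSol_bound_equiv {A : W →L[ℝ] W} {κ : K →L[ℝ] W} {ℓ : W →L[ℝ] K}
    (hA : IsNonresonant A κ ℓ) (b : K ≃L[ℝ] K) :
    ∃ C : ℝ, 0 ≤ C ∧ ∀ (f w : ℝ → W) (p : K) (M : ℝ), IsPerSol A κ ℓ f w (b p) → Continuous f →
      Function.Periodic f (2 * π) → (∀ t, ‖f t‖ ≤ M) → (∀ t, ‖w t‖ ≤ C * M) ∧ ‖p‖ ≤ C * M := by
  obtain ⟨C, hC, h⟩ := exists_isPerSol_bound hA
  refine ⟨C + ‖(b.symm : K →L[ℝ] K)‖ * C, by positivity, fun f w p M hw hf hper hM => ?_⟩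
  have hM0 : 0 ≤ M := (norm_nonneg _).trans (hM 0)
  obtain ⟨h1, h2⟩ := h f w (b p) M hw hf hper hM
  have e1 : 0 ≤ C * M := by positivity
  have e2 : 0 ≤ ‖(b.symm : K →L[ℝ] K)‖ * (C * M) := by positivity
  refine ⟨fun t => (h1 t).trans (by linarith), ?_⟩
  have h3 := (b.symm : K →L[ℝ] K).le_opNorm (b p)
  simp only [ContinuousLinearEquiv.coe_coe, ContinuousLinearEquiv.symm_apply_apply] at h3
  have h4 := mul_le_mul_of_nonneg_left h2 (norm_nonneg (b.symm : K →L[ℝ] K))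
  linarith

/-- The branch of small periodic solutions of `w' = A w + κ (b p) + N(w, p, θ, ε)`. -/
theorem exists_periodic_branch {A : W →L[ℝ] W} {κ : K →L[ℝ] W} {ℓ : W →L[ℝ] K}
    (hA : IsNonresonant A κ ℓ) (b : K ≃L[ℝ] K) {N : (W × K) × ℝ × ℝ → W} (hN : ContDiff ℝ ∞ N)
    (hper : ∀ x ε, Function.Periodic (fun θ => N (x, θ, ε)) (2 * π))
    (h0 : ∀ θ, N (0, θ, 0) = 0)
    (h1 : ∀ θ, HasFDerivAt (fun x => N (x, θ, 0)) (0 : W × K →L[ℝ] W) 0) :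
    ∃ δ > (0 : ℝ), ∃ C ≥ (0 : ℝ), ∃ ε₁ > (0 : ℝ), ∃ sol : ℝ → (ℝ → W) × K, ∀ ε, |ε| < ε₁ →
      IsPerSol A κ ℓ (fun t => N (((sol ε).1 t, (sol ε).2), t, ε)) (sol ε).1 (b (sol ε).2) ∧
      (∀ t, ‖(sol ε).1 t‖ ≤ C * |ε|) ∧ ‖(sol ε).2‖ ≤ C * |ε| ∧
      ∀ w p, IsPerSol A κ ℓ (fun t => N ((w t, p), t, ε)) w (b p) →
        (∀ t, ‖w t‖ ≤ δ) → ‖p‖ ≤ δ → w = (sol ε).1 ∧ p = (sol ε).2 := by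
  obtain ⟨C₁, hC₁, hS⟩ := exists_isPerSol_bound_equiv hA b
  obtain ⟨C₂, hC₂, hN0, hN1⟩ := exists_nonlinear_bound hN hper h0 h1
  obtain ⟨δ, hδ, hδ1, hδ2⟩ := exists_small_constants (C₁ * C₂) (by positivity)
  have hδ3 : C₁ * C₂ * δ ≤ 1 / 4 := by linarith
  -- Below the threshold `δ²` the forcing `C₂ |ε|` is small compared with `δ`, and the `δ`-ball is
  -- mapped into itself because `3 C₁ C₂ δ² ≤ δ`.
  have hε : ∀ ε, |ε| < δ * δ → |ε| ≤ δ ∧ |ε| ≤ 1 := fun ε h => by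
    constructor <;> nlinarith
  have hnorm : ∀ (x : W × K) (ε θ : ℝ), |ε| < δ * δ → ‖x‖ ≤ δ →
      ‖N (x, θ, ε)‖ ≤ C₂ * |ε| + C₂ * (δ + δ) * ‖x‖ := by
    intro x ε θ h hx
    have h2 := hN1 x 0 θ ε δ (by linarith) (hε ε h).2 hx (by simpa using hδ.le)
    rw [sub_zero] at h2
    have h3 := hN0 θ ε (hε ε h).2
    have h4 : N (x, θ, ε) = N (0, θ, ε) + (N (x, θ, ε) - N (0, θ, ε)) := by abel
    rw [h4]
    refine (norm_add_le _ _).trans (add_le_add h3 (h2.trans ?_))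
    gcongr
    exact (hε ε h).1
  have hexists : ∀ ε, |ε| < δ * δ → ∃ w p,
      IsPerSol A κ ℓ (fun t => N ((w t, p), t, ε)) w (b p) ∧ (∀ t, ‖w t‖ ≤ δ) ∧ ‖p‖ ≤ δ := by
    intro ε h
    refine exists_fixed_periodic hA b hδ hS (g := fun x t => N (x, t, ε))
      (hN.continuous.comp (by fun_prop)) (fun x => hper x ε)
      (B := C₂ * (δ * δ) + C₂ * (δ + δ) * δ) ?_ (fun x t hx => (hnorm x ε t h hx).trans ?_)
      (a := C₂ * (δ + δ)) (by positivity) (by linarith) fun x y t hx hy => ?_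
    · nlinarith
    · gcongr
    · refine (hN1 x y t ε δ (by linarith) (hε ε h).2 hx hy).trans ?_
      gcongr
      exact (hε ε h).1
  choose! w p hsol hw hp using hexists
  have hcont : ∀ (w : ℝ → W) (p : K) (ε : ℝ), Continuous w →
      Continuous fun t => N ((w t, p), t, ε) := fun w p ε hw => hN.continuous.comp (by fun_prop)
  have hper' : ∀ (w : ℝ → W) (p : K) (ε : ℝ), Function.Periodic w (2 * π) →
      Function.Periodic (fun t => N ((w t, p), t, ε)) (2 * π) := fun w p ε hw t => by
    simp only [hw t]; exact hper _ ε t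
  refine ⟨δ, hδ, 2 * (C₁ * C₂), by positivity, δ * δ, by positivity,
    fun ε => (w ε, p ε), fun ε h => ⟨hsol ε h, ?_⟩⟩
  rw [← and_assoc]
  constructor
  · rw [mul_assoc]
    refine bound_of_half (hw ε h) fun M hM hpM => ?_
    have hx : ∀ t, ‖(w ε t, p ε)‖ ≤ δ := fun t => max_le (hw ε h t) (hp ε h)
    have h5 := hS _ _ _ (C₂ * |ε| + C₂ * (δ + δ) * M) (hsol ε h)
      (hcont _ _ ε (hsol ε h).continuous) (hper' _ _ ε (hsol ε h).periodic) (fun t => by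
        refine (hnorm _ ε t h (hx t)).trans ?_
        gcongr
        exact max_le (hM t) hpM)
    have hM0 : 0 ≤ M := (norm_nonneg _).trans hpM
    have h6 : C₁ * (C₂ * |ε| + C₂ * (δ + δ) * M) ≤ C₁ * C₂ * |ε| + M / 2 := by nlinarith
    exact ⟨fun t => (h5.1 t).trans h6, h5.2.trans h6⟩
  · intro w' p' hsol' hw' hp'
    have h2 := (hsol'.sub (hsol ε h))
    rw [← map_sub] at h2
    -- The difference of two small solutions satisfies the absorption inequality with `a = 0`, so it
    -- vanishes.
    have h3 := bound_of_half (d := fun t => w' t - w ε t) (p := p' - p ε) (a := 0) (M₀ := δ + δ)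
      (fun t => (norm_sub_le _ _).trans (add_le_add (hw' t) (hw ε h t))) (fun M hM hpM => by
        have h5 := hS _ _ _ (C₂ * (δ + δ) * M) h2 ((hcont _ _ ε hsol'.continuous).sub
          (hcont _ _ ε (hsol ε h).continuous)) ((hper' _ _ ε hsol'.periodic).sub
          (hper' _ _ ε (hsol ε h).periodic)) (fun t => by
            refine (hN1 _ _ t ε δ (by linarith) (hε ε h).2 (max_le (hw' t) hp')
              (max_le (hw ε h t) (hp ε h))).trans ?_
            gcongr
            · exact (hε ε h).1
            · exact max_le (hM t) hpM)
        have hM0 : 0 ≤ M := (norm_nonneg _).trans hpM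
        have h6 : C₁ * (C₂ * (δ + δ) * M) ≤ 0 + M / 2 := by nlinarith
        exact ⟨fun t => (h5.1 t).trans h6, h5.2.trans h6⟩)
    rw [mul_zero] at h3
    exact ⟨funext fun t => sub_eq_zero.1 (norm_le_zero_iff.1 (h3.1 t)),
      sub_eq_zero.1 (norm_le_zero_iff.1 h3.2)⟩

/-- The distance between the periodic solution and an approximate solution with residual
`O(ε³)`; the image under a symmetry `T` is more accurate if that of the residual is. -/
theorem exists_periodic_error_bound {A : W →L[ℝ] W} {κ : K →L[ℝ] W} {ℓ : W →L[ℝ] K}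
    (hA : IsNonresonant A κ ℓ) (b : K ≃L[ℝ] K) {N : (W × K) × ℝ × ℝ → W} (hN : ContDiff ℝ ∞ N)
    (hper : ∀ x ε, Function.Periodic (fun θ => N (x, θ, ε)) (2 * π))
    (h0 : ∀ θ, N (0, θ, 0) = 0)
    (h1 : ∀ θ, HasFDerivAt (fun x => N (x, θ, 0)) (0 : W × K →L[ℝ] W) 0)
    {T : W →L[ℝ] W} (hTA : ∀ x, T (A x) = A (T x)) (hTκ : ∀ q, T (κ q) = κ ((2 : ℝ) • q))
    (hTl : ∀ x, ℓ (T x) = (2 : ℝ) • ℓ x) (C₁ : ℝ) (hC₁ : 0 ≤ C₁) :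
    ∃ ε₁ > (0 : ℝ), ∃ C ≥ (0 : ℝ), ∀ ε, |ε| < ε₁ → ∀ (w w' : ℝ → W) (p p' : K) (R : ℝ → W),
      IsPerSol A κ ℓ (fun t => N ((w t, p), t, ε)) w (b p) →
      (∀ t, ‖w t‖ ≤ C₁ * |ε|) → ‖p‖ ≤ C₁ * |ε| →
      IsPerSol A κ ℓ (fun t => N ((w' t, p'), t, ε) - R t) w' (b p') →
      (∀ t, ‖w' t‖ ≤ C₁ * |ε|) → ‖p'‖ ≤ C₁ * |ε| →
      Continuous R → Function.Periodic R (2 * π) →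
      (∀ t, ‖R t‖ ≤ C₁ * |ε| ^ 3) → (∀ t, ‖T (R t)‖ ≤ C₁ * |ε| ^ 4) →
      ‖p - p'‖ ≤ C * |ε| ^ 4 ∧ ∀ t,
        ‖w t - w' t‖ ≤ C * |ε| ^ 3 ∧ ‖deriv (fun t => w t - w' t) t‖ ≤ C * |ε| ^ 3 ∧
        ‖T (w t - w' t)‖ ≤ C * |ε| ^ 4 ∧
        ‖T (deriv (fun t => w t - w' t) t)‖ ≤ C * |ε| ^ 4 := by
  obtain ⟨C₂, hC₂, hS⟩ := exists_isPerSol_bound_equiv hA b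
  obtain ⟨C₃, hC₃, hN0, hN1⟩ := exists_nonlinear_bound hN hper h0 h1
  let L := C₃ * (C₁ + 1)
  have hL : 0 ≤ L := by positivity
  -- Up to powers of `|ε|`, `E` bounds the error, `F` its right-hand side, `G` the `T`-image of that
  -- right-hand side, and `k` is the norm of the linear part `A x + κ (b q)`.
  let E := 2 * (C₂ * C₁)
  have hE : 0 ≤ E := by positivity
  let F := L * E + C₁
  have hF : 0 ≤ F := by positivity
  let G := ‖T‖ * (L * E) + C₁
  have hG : 0 ≤ G := by positivity
  let k := ‖A‖ + ‖κ‖ * ‖(b : K →L[ℝ] K)‖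
  have hk : 0 ≤ k := by positivity
  let C := E + (k * E + F) + C₂ * G + (k * (C₂ * G) + G)
  have hC : 0 ≤ C := by positivity
  have e1 : 0 ≤ k * E := by positivity
  have e2 : 0 ≤ C₂ * G := by positivity
  have e3 : 0 ≤ k * (C₂ * G) := by positivity
  have hCE : E ≤ C := by simp only [C]; linarith
  have hCF : k * E + F ≤ C := by simp only [C]; linarith
  have hCG : C₂ * G ≤ C := by simp only [C]; linarith
  have hCk : k * (C₂ * G) + G ≤ C := by simp only [C]; linarith
  refine ⟨1 / (1 + C₁ + 2 * (C₂ * L)), by positivity, C, hC, ?_⟩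
  intro ε hε w w' p p' R hw hwb hpb hw' hwb' hpb' hR hRper hRb hTR
  have hη : 0 ≤ |ε| := abs_nonneg ε
  rw [lt_div_iff₀ (by positivity)] at hε
  have f1 : 0 ≤ |ε| * C₁ := by positivity
  have f2 : 0 ≤ |ε| * (C₂ * L) := by positivity
  have hη1 : |ε| ≤ 1 := by linarith
  have hηC : C₁ * |ε| ≤ 1 := by linarith
  have hηL : C₂ * L * |ε| ≤ 1 / 2 := by linarith
  have he := hw.sub hw'
  rw [← map_sub] at he
  have hNd : ∀ M, (∀ t, ‖w t - w' t‖ ≤ M) → ‖p - p'‖ ≤ M → ∀ t,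
      ‖N ((w t, p), t, ε) - N ((w' t, p'), t, ε)‖ ≤ L * |ε| * M := by
    intro M hM hpM t
    refine (hN1 _ _ t ε (C₁ * |ε|) hηC hη1 (max_le (hwb t) hpb) (max_le (hwb' t) hpb')).trans ?_
    have : C₃ * (C₁ * |ε| + |ε|) = L * |ε| := by simp only [L]; ring
    rw [this]
    gcongr
    exact max_le (hM t) hpM
  have hNc : ∀ (w : ℝ → W) (p : K), Continuous w → Continuous fun t => N ((w t, p), t, ε) :=
    fun w p hw => hN.continuous.comp (by fun_prop)
  have hNp : ∀ (w : ℝ → W) (p : K), Function.Periodic w (2 * π) →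
      Function.Periodic (fun t => N ((w t, p), t, ε)) (2 * π) := fun w p hw t => by
    simp only [hw t]; exact hper _ ε t
  let f : ℝ → W := fun t => N ((w t, p), t, ε) - (N ((w' t, p'), t, ε) - R t)
  have hfc : Continuous f :=
    (hNc w p hw.continuous).sub ((hNc w' p' hw'.continuous).sub hR)
  have hfp : Function.Periodic f (2 * π) :=
    (hNp w p hw.periodic).sub ((hNp w' p' hw'.periodic).sub hRper)
  have hfeq : ∀ t, f t = N ((w t, p), t, ε) - N ((w' t, p'), t, ε) + R t := fun t => by
    simp only [f]; abel
  obtain ⟨hE1, hE2⟩ := bound_of_half (d := fun t => w t - w' t) (p := p - p')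
    (a := C₂ * C₁ * |ε| ^ 3) (M₀ := C₁ * |ε| + C₁ * |ε|)
    (fun t => (norm_sub_le _ _).trans (add_le_add (hwb t) (hwb' t))) (fun M hM hpM => by
      have h5 := hS _ _ _ (L * |ε| * M + C₁ * |ε| ^ 3) he hfc hfp (fun t => by
        change ‖f t‖ ≤ _
        rw [hfeq]
        exact (norm_add_le _ _).trans (add_le_add (hNd M hM hpM t) (hRb t)))
      have hM0 : 0 ≤ M := (norm_nonneg _).trans hpM
      have h6 : C₂ * (L * |ε| * M + C₁ * |ε| ^ 3) ≤ C₂ * C₁ * |ε| ^ 3 + M / 2 := by nlinarith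
      exact ⟨fun t => (h5.1 t).trans h6, h5.2.trans h6⟩)
  have hE3 : 2 * (C₂ * C₁ * |ε| ^ 3) = E * |ε| ^ 3 := by simp only [E]; ring
  rw [hE3] at hE1 hE2
  have hfb : ∀ t, ‖f t‖ ≤ F * |ε| ^ 3 := by
    intro t
    rw [hfeq]
    refine (norm_add_le _ _).trans ((add_le_add (hNd _ hE1 hE2 t) (hRb t)).trans ?_)
    have h7 : L * |ε| * (E * |ε| ^ 3) ≤ L * 1 * (E * |ε| ^ 3) := by gcongr
    refine (add_le_add h7 le_rfl).trans (le_of_eq ?_)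
    simp only [F]; ring
  -- The difference of the nonlinear terms is already `O(ε) · O(ε³)`; only the residual needs `T` to
  -- reach order four.
  have hTf : ∀ t, ‖T (f t)‖ ≤ G * |ε| ^ 4 := by
    intro t
    rw [hfeq, map_add]
    refine (norm_add_le _ _).trans ?_
    have h7 := (T.le_opNorm _).trans
      (mul_le_mul_of_nonneg_left (hNd _ hE1 hE2 t) (norm_nonneg T))
    refine (add_le_add h7 (hTR t)).trans (le_of_eq ?_)
    simp only [G]; ring
  have hTe := he.map (T := T) (U := (2 : ℝ) • ContinuousLinearMap.id ℝ K) hTA (by simpa using hTκ)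
    (by simpa using hTl)
  -- `T` doubles the kernel component, so the improved rate reaches `p - p'` itself.
  have hUb : ((2 : ℝ) • ContinuousLinearMap.id ℝ K) (b (p - p')) = b ((2 : ℝ) • (p - p')) := by
    simp
  rw [hUb] at hTe
  obtain ⟨hT1, hT2⟩ := hS _ _ _ (G * |ε| ^ 4) hTe (T.continuous.comp hfc)
    (fun t => congrArg T (hfp t)) hTf
  have hder : ∀ t, deriv (fun t => w t - w' t) t = A (w t - w' t) + κ (b (p - p')) + f t :=
    fun t => (he.hasDerivAt t).deriv
  have hTder : ∀ t, T (deriv (fun t => w t - w' t) t)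
      = A (T (w t - w' t)) + κ (b ((2 : ℝ) • (p - p'))) + T (f t) := by
    intro t
    rw [hder, map_add, map_add, hTA, hTκ, ← map_smul b]
  have hlin : ∀ (x : W) (q : K) (M : ℝ), ‖x‖ ≤ M → ‖q‖ ≤ M → ‖A x + κ (b q)‖ ≤ k * M := by
    intro x q M hx hq
    have h7 := (A.le_opNorm x).trans (mul_le_mul_of_nonneg_left hx (norm_nonneg A))
    have h8 := ((b : K →L[ℝ] K).le_opNorm q).trans
      (mul_le_mul_of_nonneg_left hq (norm_nonneg _))
    have h9 := (κ.le_opNorm (b q)).trans (mul_le_mul_of_nonneg_left h8 (norm_nonneg κ))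
    refine (norm_add_le _ _).trans ((add_le_add h7 h9).trans (le_of_eq ?_))
    simp only [k]; ring
  have hη3 : 0 ≤ |ε| ^ 3 := by positivity
  have hη4 : 0 ≤ |ε| ^ 4 := by positivity
  refine ⟨?_, fun t => ⟨?_, ?_, ?_, ?_⟩⟩
  · rw [norm_smul, Real.norm_of_nonneg zero_le_two] at hT2
    have h7 := mul_le_mul_of_nonneg_right hCG hη4
    have h8 := norm_nonneg (p - p')
    linarith
  · exact (hE1 t).trans (by gcongr)
  · rw [hder]
    refine (norm_add_le _ _).trans
      ((add_le_add (hlin _ _ _ (hE1 t) hE2) (hfb t)).trans ?_)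
    have h7 := mul_le_mul_of_nonneg_right hCF hη3
    linarith
  · have h7 := mul_le_mul_of_nonneg_right hCG hη4
    exact (hT1 t).trans (by linarith)
  · rw [hTder]
    refine (norm_add_le _ _).trans
      ((add_le_add (hlin _ _ _ (hT1 t) hT2) (hTf t)).trans ?_)
    have h7 := mul_le_mul_of_nonneg_right hCk hη4
    linarith

end NonlinearSolver

/-! ### Trigonometric polynomials of degree three. -/

section TrigPolynomials

variable {V : Type} [NormedAddCommGroup V] [NormedSpace ℝ V]

/-- Frequencies of the trigonometric monomials `1, cos φ, sin φ, …, cos 3φ, sin 3φ`. -/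
def freq : Fin 7 → ℤ := ![0, 1, 1, 2, 2, 3, 3]

def isCos : Fin 7 → Bool := ![true, true, false, true, false, true, false]

/-- The trigonometric monomials `1, cos φ, sin φ, …, cos 3φ, sin 3φ`. -/
def mono (j : Fin 7) (φ : ℝ) : ℝ := if isCos j then cos (freq j * φ) else sin (freq j * φ)

/-- The normalizing weights of the Fourier coefficients. -/
def weight (j : Fin 7) : ℝ := if j = 0 then 1 / (2 * π) else 1 / π

/-- The trigonometric polynomial with given coefficients, evaluated at `φ`. -/
def trig (φ : ℝ) : (Fin 7 → V) →L[ℝ] V :=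
  ∑ j, mono j φ • ContinuousLinearMap.proj (R := ℝ) (φ := fun _ : Fin 7 => V) j

/-- The Fourier coefficients of orders `0, …, 3`. -/
def coef (g : ℝ → V) : Fin 7 → V := fun j => weight j • ∫ φ in (0 : ℝ)..2 * π, mono j φ • g φ

theorem trig_apply (φ : ℝ) (u : Fin 7 → V) : trig φ u = ∑ j, mono j φ • u j := by
  simp [trig]

theorem contDiff_mono (j : Fin 7) : ContDiff ℝ ∞ (mono j) := by
  unfold mono
  split_ifs
  · exact contDiff_cos.comp (by fun_prop)
  · exact contDiff_sin.comp (by fun_prop)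

theorem continuous_mono (j : Fin 7) : Continuous (mono j) := (contDiff_mono j).continuous

theorem abs_mono_le (j : Fin 7) (φ : ℝ) : |mono j φ| ≤ 1 := by
  unfold mono
  split_ifs
  · exact abs_cos_le_one _
  · exact abs_sin_le_one _

theorem contDiff_trig_comp {E : Type} [NormedAddCommGroup E] [NormedSpace ℝ E] {f : E → ℝ}
    {u : E → Fin 7 → V} (hf : ContDiff ℝ ∞ f) (hu : ContDiff ℝ ∞ u) :
    ContDiff ℝ ∞ fun x => trig (f x) (u x) := by
  simp only [trig_apply]
  exact ContDiff.sum fun j _ => ((contDiff_mono j).comp hf).smul (contDiff_pi.1 hu j)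

theorem continuous_trig (u : Fin 7 → V) : Continuous fun φ => trig φ u :=
  (contDiff_trig_comp contDiff_id contDiff_const).continuous

theorem integral_cos_int_mul (n : ℤ) :
    ∫ φ in (0 : ℝ)..2 * π, cos (n * φ) = if n = 0 then 2 * π else 0 := by
  split_ifs with h
  · simp [h]
  · have hn : (n : ℝ) ≠ 0 := by exact_mod_cast h
    rw [intervalIntegral.integral_comp_mul_left _ hn, integral_cos]
    have : sin (n * (2 * π)) = 0 := by simpa using Real.sin_int_mul_two_pi_sub 0 n
    simp [this]

theorem integral_sin_int_mul (n : ℤ) : ∫ φ in (0 : ℝ)..2 * π, sin (n * φ) = 0 := by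
  by_cases h : n = 0
  · simp [h]
  · have hn : (n : ℝ) ≠ 0 := by exact_mod_cast h
    rw [intervalIntegral.integral_comp_mul_left _ hn, integral_sin]
    simp [Real.cos_int_mul_two_pi]

theorem integral_cos_mul_cos (m n : ℤ) : ∫ φ in (0 : ℝ)..2 * π, cos (m * φ) * cos (n * φ)
    = ((if m - n = 0 then 2 * π else 0) + (if m + n = 0 then 2 * π else 0)) / 2 := by
  have h : ∀ φ : ℝ, cos (m * φ) * cos (n * φ)
      = (cos ((m - n : ℤ) * φ) + cos ((m + n : ℤ) * φ)) / 2 := fun φ => by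
    push_cast; rw [sub_mul, add_mul, cos_sub, cos_add]; ring
  simp only [h]
  rw [intervalIntegral.integral_div, intervalIntegral.integral_add, integral_cos_int_mul,
    integral_cos_int_mul] <;> exact Continuous.intervalIntegrable (by fun_prop) _ _

theorem integral_sin_mul_sin (m n : ℤ) : ∫ φ in (0 : ℝ)..2 * π, sin (m * φ) * sin (n * φ)
    = ((if m - n = 0 then 2 * π else 0) - (if m + n = 0 then 2 * π else 0)) / 2 := by
  have h : ∀ φ : ℝ, sin (m * φ) * sin (n * φ)
      = (cos ((m - n : ℤ) * φ) - cos ((m + n : ℤ) * φ)) / 2 := fun φ => by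
    push_cast; rw [sub_mul, add_mul, cos_sub, cos_add]; ring
  simp only [h]
  rw [intervalIntegral.integral_div, intervalIntegral.integral_sub, integral_cos_int_mul,
    integral_cos_int_mul] <;> exact Continuous.intervalIntegrable (by fun_prop) _ _

theorem integral_sin_mul_cos' (m n : ℤ) :
    ∫ φ in (0 : ℝ)..2 * π, sin (m * φ) * cos (n * φ) = 0 := by
  have h : ∀ φ : ℝ, sin (m * φ) * cos (n * φ)
      = (sin ((m - n : ℤ) * φ) + sin ((m + n : ℤ) * φ)) / 2 := fun φ => by
    push_cast; rw [sub_mul, add_mul, sin_sub, sin_add]; ring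
  simp only [h]
  rw [intervalIntegral.integral_div, intervalIntegral.integral_add, integral_sin_int_mul,
    integral_sin_int_mul]
  · simp
  all_goals exact Continuous.intervalIntegrable (by fun_prop) _ _

theorem integral_mono_mul_mono (i j : Fin 7) :
    ∫ φ in (0 : ℝ)..2 * π, mono i φ * mono j φ = if i = j then (weight i)⁻¹ else 0 := by
  have h : ∀ m n : ℤ, ∫ φ in (0 : ℝ)..2 * π, cos (m * φ) * sin (n * φ) = 0 := fun m n => by
    simp only [mul_comm (cos _), integral_sin_mul_cos']
  unfold mono weight
  by_cases hi : isCos i <;> by_cases hj : isCos j <;>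
    simp only [hi, hj, if_true, if_false, Bool.false_eq_true, integral_cos_mul_cos,
      integral_sin_mul_sin, integral_sin_mul_cos', h] <;>
    revert hi hj <;> fin_cases i <;> fin_cases j <;> simp [isCos, freq]

theorem weight_pos (i : Fin 7) : 0 < weight i := by
  unfold weight; split_ifs <;> positivity

/-- Orthogonality of the monomials; the weights are their inverse squared norms. -/
theorem coef_trig [CompleteSpace V] (u : Fin 7 → V) : coef (fun φ => trig φ u) = u := by
  funext i
  have h1 : ∀ φ, mono i φ • trig φ u = ∑ j, (mono i φ * mono j φ) • u j := fun φ => by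
    rw [trig_apply, Finset.smul_sum]; simp only [smul_smul]
  have hc : ∀ j, Continuous fun φ => mono i φ * mono j φ := fun j =>
    (continuous_mono i).mul (continuous_mono j)
  simp only [coef, h1]
  rw [intervalIntegral.integral_finsetSum fun j _ =>
    Continuous.intervalIntegrable (by have := hc j; fun_prop) _ _]
  simp only [intervalIntegral.integral_smul_const, integral_mono_mul_mono]
  simp [(weight_pos i).ne']

theorem eq_of_trig_eq [CompleteSpace V] {u v : Fin 7 → V} (h : ∀ φ, trig φ u = trig φ v) :
    u = v := by
  rw [← coef_trig u, ← coef_trig v, funext h]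

theorem norm_trig_le (φ : ℝ) (u : Fin 7 → V) : ‖trig φ u‖ ≤ 7 * ‖u‖ := by
  rw [trig_apply]
  refine (norm_sum_le_of_le (n := fun _ => ‖u‖) _ fun j _ => ?_).trans (by simp)
  rw [norm_smul, Real.norm_eq_abs]
  calc |mono j φ| * ‖u j‖ ≤ 1 * ‖u‖ :=
        mul_le_mul (abs_mono_le j φ) (norm_le_pi_norm u j) (norm_nonneg _) zero_le_one
    _ = ‖u‖ := one_mul _

theorem norm_coef_le {g : ℝ → V} {M : ℝ} (h : ∀ φ ∈ Set.Icc 0 (2 * π), ‖g φ‖ ≤ M) :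
    ‖coef g‖ ≤ 2 * M := by
  have hM : 0 ≤ M := (norm_nonneg _).trans (h 0 ⟨le_rfl, two_pi_pos.le⟩)
  refine (pi_norm_le_iff_of_nonneg (by positivity)).2 fun j => ?_
  have h1 := intervalIntegral.norm_integral_le_of_norm_le_const (a := 0) (b := 2 * π)
    (C := M) (f := fun φ => mono j φ • g φ) (fun x hx => by
      rw [Set.uIoc_of_le two_pi_pos.le] at hx
      rw [norm_smul, Real.norm_eq_abs]
      calc |mono j x| * ‖g x‖ ≤ 1 * M :=
            mul_le_mul (abs_mono_le j x) (h x ⟨hx.1.le, hx.2⟩) (norm_nonneg _) zero_le_one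
        _ = M := one_mul _)
  rw [sub_zero, abs_of_pos two_pi_pos] at h1
  have h2 : weight j ≤ 1 / π := by
    unfold weight
    split_ifs
    · exact one_div_le_one_div_of_le pi_pos (by linarith [pi_pos])
    · rfl
  rw [coef, norm_smul, Real.norm_of_nonneg (weight_pos j).le]
  calc weight j * ‖∫ φ in (0 : ℝ)..2 * π, mono j φ • g φ‖ ≤ 1 / π * (M * (2 * π)) := by gcongr
    _ = 2 * M := by field_simp

theorem coef_add {f g : ℝ → V} (hf : Continuous f) (hg : Continuous g) :
    coef (fun φ => f φ + g φ) = coef f + coef g := by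
  funext j
  simp only [coef, smul_add, Pi.add_apply]
  have hj := continuous_mono j
  rw [intervalIntegral.integral_add (Continuous.intervalIntegrable (by fun_prop) _ _)
    (Continuous.intervalIntegrable (by fun_prop) _ _), smul_add]

theorem coef_smul (c : ℝ) (f : ℝ → V) : coef (fun φ => c • f φ) = c • coef f := by
  funext j
  simp only [coef, Pi.smul_apply, smul_comm _ c, intervalIntegral.integral_smul]

theorem contDiff_coef {E : Type} [NormedAddCommGroup E] [NormedSpace ℝ E] [FiniteDimensional ℝ E]
    {g : E × ℝ → V} (hg : ContDiff ℝ ∞ g) :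
    ContDiff ℝ ∞ fun x => coef fun φ => g (x, φ) := by
  refine contDiff_pi.2 fun j => contDiff_const.smul ?_
  exact contDiff_parametric_integral (f := fun p : E × ℝ => mono j p.2 • g p)
    (((contDiff_mono j).comp contDiff_snd).smul hg) 0 (2 * π)

/-- The derivative with respect to `φ` on Fourier coefficients. -/
def dphi : (Fin 7 → V) →L[ℝ] (Fin 7 → V) :=
  ContinuousLinearMap.pi
    ![0, ContinuousLinearMap.proj 2, -ContinuousLinearMap.proj 1,
      (2 : ℝ) • ContinuousLinearMap.proj 4, -((2 : ℝ) • ContinuousLinearMap.proj 3),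
      (3 : ℝ) • ContinuousLinearMap.proj 6, -((3 : ℝ) • ContinuousLinearMap.proj 5)]

theorem dphi_apply (u : Fin 7 → V) :
    dphi u = ![0, u 2, -u 1, (2 : ℝ) • u 4, -((2 : ℝ) • u 3), (3 : ℝ) • u 6,
      -((3 : ℝ) • u 5)] := by
  funext j
  fin_cases j <;> simp [dphi]

theorem trig_apply' (φ : ℝ) (u : Fin 7 → V) :
    trig φ u = u 0 + (cos φ • u 1 + sin φ • u 2) + (cos (2 * φ) • u 3 + sin (2 * φ) • u 4)
      + (cos (3 * φ) • u 5 + sin (3 * φ) • u 6) := by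
  rw [trig_apply, Fin.sum_univ_seven]
  simp [mono, isCos, freq]
  abel

theorem hasDerivAt_trig (φ : ℝ) (u : Fin 7 → V) :
    HasDerivAt (fun φ => trig φ u) (trig φ (dphi u)) φ := by
  simp only [trig_apply', dphi_apply]
  have hc : ∀ m : ℝ, HasDerivAt (fun φ => cos (m * φ)) (-(m * sin (m * φ))) φ := fun m => by
    simpa [mul_comm] using ((hasDerivAt_id φ).const_mul m).cos
  have hs : ∀ m : ℝ, HasDerivAt (fun φ => sin (m * φ)) (m * cos (m * φ)) φ := fun m => by
    simpa [mul_comm] using ((hasDerivAt_id φ).const_mul m).sin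
  refine (((((hasDerivAt_const φ (u 0)).fun_add
    (((hasDerivAt_cos φ).smul_const (u 1)).fun_add ((hasDerivAt_sin φ).smul_const (u 2)))).fun_add
    (((hc 2).smul_const (u 3)).fun_add ((hs 2).smul_const (u 4)))).fun_add
    (((hc 3).smul_const (u 5)).fun_add ((hs 3).smul_const (u 6))))).congr_deriv ?_
  simp
  module

/-- The action on Fourier coefficients of `z ↦ -z(· + π)`. -/
def parity : (Fin 7 → V) →L[ℝ] (Fin 7 → V) :=
  ContinuousLinearMap.pi fun j =>
    (-(-1 : ℝ) ^ (freq j).natAbs) • ContinuousLinearMap.proj (R := ℝ) (φ := fun _ : Fin 7 => V) j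

theorem parity_apply (u : Fin 7 → V) :
    parity u = ![-u 0, u 1, u 2, -u 3, -u 4, u 5, u 6] := by
  funext j
  fin_cases j <;> simp [parity, freq, pow_succ]

theorem mono_add_pi (j : Fin 7) (φ : ℝ) :
    mono j (φ + π) = (-1 : ℝ) ^ (freq j).natAbs * mono j φ := by
  have h1 : ∀ φ, cos (2 * (φ + π)) = cos (2 * φ) := fun φ => by
    rw [mul_add, cos_add_two_pi]
  have h2 : ∀ φ, sin (2 * (φ + π)) = sin (2 * φ) := fun φ => by
    rw [mul_add, sin_add_two_pi]
  have h3 : ∀ φ, cos (3 * (φ + π)) = -cos (3 * φ) := fun φ => by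
    rw [show 3 * (φ + π) = 3 * φ + π + 2 * π by ring, cos_add_two_pi, cos_add_pi]
  have h4 : ∀ φ, sin (3 * (φ + π)) = -sin (3 * φ) := fun φ => by
    rw [show 3 * (φ + π) = 3 * φ + π + 2 * π by ring, sin_add_two_pi, sin_add_pi]
  fin_cases j <;> simp [mono, isCos, freq, h1, h2, h3, h4] <;> norm_num

theorem trig_add_pi (φ : ℝ) (u : Fin 7 → V) : trig (φ + π) u = -trig φ (parity u) := by
  simp only [trig_apply, mono_add_pi, parity, ContinuousLinearMap.coe_pi',
    smul_apply, ContinuousLinearMap.proj_apply, ← Finset.sum_neg_distrib]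
  refine Finset.sum_congr rfl fun j _ => ?_
  rw [smul_smul, ← neg_smul]; congr 1; ring

/-- Shift the integration variable by `π`: a monomial of frequency `m` picks up the sign `(-1)^m`,
and periodicity restores the interval. -/
theorem coef_neg_add_pi {f : ℝ → V} (hf : Function.Periodic f (2 * π)) :
    coef (fun φ => -f (φ + π)) = parity (coef f) := by
  funext j
  have h1 : ∀ φ, mono j φ • -f (φ + π)
      = (-(-1 : ℝ) ^ (freq j).natAbs) • (mono j (φ + π) • f (φ + π)) := fun φ => by
    rw [mono_add_pi, smul_smul, smul_neg, ← neg_smul]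
    congr 1
    have : ((-1 : ℝ) ^ (freq j).natAbs) * (-1) ^ (freq j).natAbs = 1 := by
      rw [← mul_pow]; simp
    linear_combination (mono j φ) * this
  have h2 : Function.Periodic (fun φ => mono j φ • f φ) (2 * π) := fun φ => by
    have h3 : mono j (φ + 2 * π) = mono j φ := by
      rw [show φ + 2 * π = φ + π + π by ring, mono_add_pi, mono_add_pi, ← mul_assoc, ← mul_pow]
      simp
    simp only [h3, hf φ]
  simp only [coef, h1, intervalIntegral.integral_smul]
  rw [intervalIntegral.integral_comp_add_right (fun φ => mono j φ • f φ)]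
  have h4 := h2.intervalIntegral_add_eq π 0
  rw [zero_add, add_comm π] at h4
  rw [zero_add, h4]
  simp [parity, coef, smul_comm (weight j)]

end TrigPolynomials

theorem trunc3_eq {k : ℕ} (f : ℝ → State k) (φ : ℝ) : trunc3 f φ = trig φ (coef f) := by
  rw [trig_apply', trunc3]
  have h : Finset.Icc (1 : ℕ) 3 = {1, 2, 3} := by decide
  rw [h]
  simp [coef, weight, mono, isCos, freq]
  module

/-! ### Periodic solutions of complex linear equations. -/

section ComplexLinear

variable {V : Type} [NormedAddCommGroup V] [NormedSpace ℂ V] [FiniteDimensional ℂ V]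

/-- A complex linear equation `y' = M y` has no nonzero `2π`-periodic solution if no eigenvalue of
`M` is `i` times an integer. -/
theorem eq_zero_of_periodic_of_hasDerivAt (M : V →L[ℂ] V)
    (hM : ∀ (μ : ℂ) (v : V), v ≠ 0 → M v = μ • v → Complex.exp (2 * π * μ) ≠ 1)
    {y : ℝ → V} (hy : ∀ t, HasDerivAt y (M (y t)) t) (hper : Function.Periodic y (2 * π)) (t : ℝ) :
    y t = 0 := by
  have : FiniteDimensional ℝ V := FiniteDimensional.trans ℝ ℂ V
  -- The initial values of periodic solutions form an `M`-invariant subspace. If it is nonzero it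
  -- contains an eigenvector `v`, whose orbit `e^{tμ} v` is periodic, and so `e^{2πμ} = 1`.
  let U : Submodule ℂ V :=
    { carrier := {x | ∃ y : ℝ → V, (∀ t, HasDerivAt y (M (y t)) t) ∧
        Function.Periodic y (2 * π) ∧ y 0 = x}
      add_mem' := by
        rintro _ _ ⟨y, h1, h2, rfl⟩ ⟨z, h3, h4, rfl⟩
        exact ⟨fun t => y t + z t, fun t => by simpa using (h1 t).fun_add (h3 t), h2.add h4, rfl⟩
      zero_mem' := ⟨fun _ => 0, fun t => by simpa using hasDerivAt_const t (0 : V), fun t => rfl, rfl⟩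
      smul_mem' := by
        rintro c _ ⟨y, h1, h2, rfl⟩
        exact ⟨fun t => c • y t, fun t => by simpa using (h1 t).fun_const_smul c,
          fun t => by simp only [h2 t], rfl⟩ }
  have hU : ∀ x ∈ U, M x ∈ U := by
    rintro _ ⟨y, h1, h2, rfl⟩
    refine ⟨fun t => M (y t), fun t => ?_, fun t => by simp only [h2 t], rfl⟩
    exact (M.restrictScalars ℝ).hasFDerivAt.comp_hasDerivAt t (h1 t)
  by_contra hne
  have hyU : y t ∈ U := by
    refine ⟨fun s => y (t + s), fun s => ?_, fun s => ?_, by simp⟩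
    · simpa [Function.comp_def] using (hy (t + s)).scomp s ((hasDerivAt_id s).const_add t)
    · simp only [← add_assoc]; exact hper _
  have hnt : Nontrivial U := ⟨⟨y t, hyU⟩, 0, fun h => hne (congrArg Subtype.val h)⟩
  obtain ⟨μ, hμ⟩ := Module.End.exists_eigenvalue ((M : V →ₗ[ℂ] V).restrict hU)
  obtain ⟨⟨v, z, hz, hzper, hz0⟩, hv⟩ := hμ.exists_hasEigenvector
  have hv0 : v ≠ 0 := fun h => hv.2 (Subtype.ext h)
  have hMv : M v = μ • v := congrArg Subtype.val hv.apply_eq_smul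
  refine hM μ v hv0 hMv ?_
  have h5 : ∀ t : ℝ, HasDerivAt (fun t : ℝ => Complex.exp (t * μ) • v)
      ((M.restrictScalars ℝ) (Complex.exp (t * μ) • v)) t := by
    intro t
    have h6 : HasDerivAt (fun t : ℝ => Complex.exp (t * μ)) (Complex.exp (t * μ) * μ) t := by
      have := ((Complex.ofRealCLM.hasDerivAt (x := t)).mul_const μ).cexp
      simpa using this
    refine (h6.smul_const v).congr_deriv ?_
    simp [hMv, smul_smul]
  have h7 := eq_expFlow_of_hasDerivAt (A := M.restrictScalars ℝ) hz 0 (2 * π)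
  have h8 := eq_expFlow_of_hasDerivAt h5 0 (2 * π)
  simp only [hzper 0, hz0] at h7
  simp only [Complex.ofReal_zero, zero_mul, Complex.exp_zero, one_smul, zero_add] at h8
  rw [← h7] at h8
  have h9 : (Complex.exp (2 * π * μ) - 1) • v = 0 := by
    rw [sub_smul, one_smul, sub_eq_zero]; simpa using h8
  exact sub_eq_zero.1 ((smul_eq_zero.1 h9).resolve_right hv0)

theorem eq_zero_of_periodic_of_hasDerivAt_mul {μ : ℂ} (hμ : Complex.exp (2 * π * μ) ≠ 1)
    {c : ℝ → ℂ} (hc : ∀ t, HasDerivAt c (μ * c t) t) (hper : Function.Periodic c (2 * π)) (t : ℝ) :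
    c t = 0 := by
  refine eq_zero_of_periodic_of_hasDerivAt (μ • ContinuousLinearMap.id ℂ ℂ) ?_
    (fun t => by simpa using hc t) hper t
  intro ν v hv h
  simp only [smul_apply, ContinuousLinearMap.id_apply, smul_eq_mul] at h
  rwa [← mul_right_cancel₀ hv h]

end ComplexLinear

/-- If `j ω` is an integer it can only be `±1`, because `0 < |j ω| < 2`; this leaves `ω = 1/|j|`,
and all four values are excluded. The bound `4` on `|j|` is what the modes `m ≤ 3` need, through `j
= 1 ± m`. -/
theorem exp_ne_one_of_nonresonant {om : ℝ} (h0 : 0 < om) (h1 : om < 1 / 2) (h3 : om ≠ 1 / 3)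
    (h4 : om ≠ 1 / 4) (j : ℤ) (hj : j ≠ 0) (hj' : |j| ≤ 4) :
    Complex.exp (2 * π * (Complex.I * (j * om))) ≠ 1 := by
  rw [Ne, Complex.exp_eq_one_iff]
  rintro ⟨n, hn⟩
  have h : (j : ℝ) * om = n := by
    have : (2 * π * Complex.I) * (j * om) = (2 * π * Complex.I) * n := by
      linear_combination hn
    exact_mod_cast mul_left_cancel₀ Complex.two_pi_I_ne_zero this
  rw [abs_le] at hj'
  obtain ⟨hj1, hj2⟩ := hj'
  have hn1 : (n : ℝ) < 2 ∧ (-2 : ℝ) < n := by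
    have : (-4 : ℝ) ≤ j := by exact_mod_cast hj1
    have : (j : ℝ) ≤ 4 := by exact_mod_cast hj2
    constructor <;> nlinarith
  have hn2 : n < 2 := by exact_mod_cast hn1.1
  have hn3 : -2 < n := by exact_mod_cast hn1.2
  interval_cases j <;> interval_cases n <;> push_cast at h <;>
    first
    | exact absurd rfl hj
    | linarith
    | exact h3 (by linarith)
    | exact h4 (by linarith)

/-! ### The critical linear operator, its kernel and its symmetries. -/

section LinearPart

variable {k : ℕ}

theorem state_ext {x y : State k} (h0 : x (Sum.inl 0) = y (Sum.inl 0))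
    (h1 : x (Sum.inl 1) = y (Sum.inl 1)) (h2 : ∀ i, x (Sum.inr i) = y (Sum.inr i)) : x = y := by
  funext i
  rcases i with i | i
  · fin_cases i
    · exact h0
    · exact h1
  · exact h2 i

/-- Multiplication by a matrix as a continuous linear map. -/
def matL (M : Matrix (Fin 2 ⊕ Fin k) (Fin 2 ⊕ Fin k) ℝ) : State k →L[ℝ] State k :=
  LinearMap.toContinuousLinearMap (Matrix.toLin' M)

theorem matL_apply (M : Matrix (Fin 2 ⊕ Fin k) (Fin 2 ⊕ Fin k) ℝ) (x : State k) :
    matL M x = M *ᵥ x := by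
  simp [matL]

/-- The block diagonal matrix `diag((p, -q; q, p), B)`. -/
def blockL (p q : ℝ) (B : Matrix (Fin k) (Fin k) ℝ) : State k →L[ℝ] State k :=
  matL (Matrix.fromBlocks (rot p q) 0 0 B)

theorem blockL_inl_zero (p q : ℝ) (B : Matrix (Fin k) (Fin k) ℝ) (x : State k) :
    blockL p q B x (Sum.inl 0) = p * x (Sum.inl 0) - q * x (Sum.inl 1) := by
  rw [blockL, matL_apply, Matrix.fromBlocks_mulVec]
  simp [rot, Matrix.mulVec, dotProduct, Fin.sum_univ_two]
  ring

theorem blockL_inl_one (p q : ℝ) (B : Matrix (Fin k) (Fin k) ℝ) (x : State k) :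
    blockL p q B x (Sum.inl 1) = q * x (Sum.inl 0) + p * x (Sum.inl 1) := by
  rw [blockL, matL_apply, Matrix.fromBlocks_mulVec]
  simp [rot, Matrix.mulVec, dotProduct, Fin.sum_univ_two]

theorem blockL_inr (p q : ℝ) (B : Matrix (Fin k) (Fin k) ℝ) (x : State k) (i : Fin k) :
    blockL p q B x (Sum.inr i) = (B *ᵥ til x) i := by
  rw [blockL, matL_apply, Matrix.fromBlocks_mulVec]
  simp only [Sum.elim_inr, Pi.add_apply]
  simp [til, Function.comp_def]
  rfl

/-- The embedding of the kernel of the critical linear operator. -/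
def kap : ℝ × ℝ →L[ℝ] (Fin 7 → State k) :=
  LinearMap.toContinuousLinearMap
    { toFun := fun x => ![0, Sum.elim ![x.1, x.2] 0, Sum.elim ![-x.2, x.1] 0, 0, 0, 0, 0]
      map_add' := fun x y => by
        funext j
        fin_cases j <;> refine state_ext ?_ ?_ fun i => ?_ <;> simp <;> ring
      map_smul' := fun c x => by
        funext j
        fin_cases j <;> refine state_ext ?_ ?_ fun i => ?_ <;> simp }

theorem kap_apply (x : ℝ × ℝ) : kap (k := k) x =
    ![0, Sum.elim ![x.1, x.2] 0, Sum.elim ![-x.2, x.1] 0, 0, 0, 0, 0] := rfl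

/-- The coordinates along the kernel of the critical linear operator. -/
def ell : (Fin 7 → State k) →L[ℝ] ℝ × ℝ :=
  LinearMap.toContinuousLinearMap
    { toFun := fun u => ((u 1 (Sum.inl 0) + u 2 (Sum.inl 1)) / 2,
        (u 1 (Sum.inl 1) - u 2 (Sum.inl 0)) / 2)
      map_add' := fun x y => by ext <;> simp <;> ring
      map_smul' := fun c x => by ext <;> simp <;> ring }

theorem ell_apply (u : Fin 7 → State k) : ell u = ((u 1 (Sum.inl 0) + u 2 (Sum.inl 1)) / 2,
        (u 1 (Sum.inl 1) - u 2 (Sum.inl 0)) / 2) := rfl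

/-- The operator `z ↦ L z - ω ∂z/∂φ` on Fourier coefficients. -/
def linOp (L : State k →L[ℝ] State k) (om : ℝ) : (Fin 7 → State k) →L[ℝ] (Fin 7 → State k) :=
  ContinuousLinearMap.pi (fun j => L.comp (ContinuousLinearMap.proj j)) - om • dphi

theorem linOp_apply (L : State k →L[ℝ] State k) (om : ℝ) (u : Fin 7 → State k) :
    linOp L om u = ![L (u 0), L (u 1) - om • u 2, L (u 2) + om • u 1, L (u 3) - om • (2 : ℝ) • u 4,
      L (u 4) + om • (2 : ℝ) • u 3, L (u 5) - om • (3 : ℝ) • u 6, L (u 6) + om • (3 : ℝ) • u 5] := by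
  funext j
  simp only [linOp, sub_apply, smul_apply, dphi_apply]
  fin_cases j <;> simp

theorem trig_linOp (L : State k →L[ℝ] State k) (om φ : ℝ) (u : Fin 7 → State k) :
    trig φ (linOp L om u) = L (trig φ u) - om • trig φ (dphi u) := by
  rw [linOp, sub_apply, map_sub, smul_apply, map_smul]
  congr 1
  simp only [trig_apply, map_sum, map_smul]
  rfl

/-- In complex notation `kap x` is `e^{iφ} (x₁ + i x₂)` in the critical plane, where the operator
multiplies by `p + i (q - ω)`. This factor is zero at the bifurcation point. -/
theorem linOp_kap (p q om : ℝ) (B : Matrix (Fin k) (Fin k) ℝ) (x : ℝ × ℝ) :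
    linOp (blockL p q B) om (kap x) =
      kap (p * x.1 - (q - om) * x.2, (q - om) * x.1 + p * x.2) := by
  rw [linOp_apply]
  have ht : ∀ x y : ℝ, til (Sum.elim ![x, y] 0 : State k) = 0 := fun x y => rfl
  funext j
  fin_cases j <;> refine state_ext ?_ ?_ fun i => ?_ <;>
    simp [kap_apply, blockL_inl_zero, blockL_inl_one, blockL_inr, ht] <;> ring

/-- `ell` reads off the `e^{iφ}` component in the critical plane, which the critical operator
annihilates. -/
theorem ell_linOp (om : ℝ) (B : Matrix (Fin k) (Fin k) ℝ) (u : Fin 7 → State k) :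
    ell (linOp (blockL 0 om B) om u) = 0 := by
  rw [linOp_apply, ell_apply]
  ext <;> simp [blockL_inl_zero, blockL_inl_one] <;> ring

theorem ell_kap (x : ℝ × ℝ) : ell (kap (k := k) x) = x := by
  rw [kap_apply, ell_apply]
  ext <;> simp

theorem parity_linOp (L : State k →L[ℝ] State k) (om : ℝ) (u : Fin 7 → State k) :
    parity (linOp L om u) = linOp L om (parity u) := by
  rw [linOp_apply, linOp_apply, parity_apply, parity_apply]
  funext j
  fin_cases j <;> simp <;> abel

theorem parity_kap (x : ℝ × ℝ) : parity (kap (k := k) x) = kap x := by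
  rw [kap_apply, parity_apply]
  funext j
  fin_cases j <;> simp

theorem ell_parity (u : Fin 7 → State k) : ell (parity u) = ell u := by
  rw [parity_apply, ell_apply, ell_apply]; simp

end LinearPart

/-! ### Nonresonance of the critical operator. -/

section Nonresonance

/-- `r + i s` solves a scalar equation with exponent `a + i ν`. -/
theorem eq_zero_of_periodic_planar {a ν : ℝ}
    (hμ : Complex.exp (2 * π * (a + Complex.I * ν)) ≠ 1) {r s : ℝ → ℝ}
    (hr : ∀ t, HasDerivAt r (a * r t - ν * s t) t) (hs : ∀ t, HasDerivAt s (ν * r t + a * s t) t)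
    (hrp : Function.Periodic r (2 * π)) (hsp : Function.Periodic s (2 * π)) (t : ℝ) :
    r t = 0 ∧ s t = 0 := by
  have h := eq_zero_of_periodic_of_hasDerivAt_mul hμ (c := fun t => (r t : ℂ) + Complex.I * s t)
    (fun t => by
      refine ((hr t).ofReal_comp.fun_add ((hs t).ofReal_comp.const_mul Complex.I)).congr_deriv ?_
      push_cast
      linear_combination (-(ν : ℂ) * (s t)) * Complex.I_sq)
    (fun t => by simp only [hrp t, hsp t]) t
  constructor
  · simpa using congrArg Complex.re h
  · simpa using congrArg Complex.im h

variable {k : ℕ}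

theorem exp_ne_one_of_re_ne_zero {μ : ℂ} (h : μ.re ≠ 0) : Complex.exp (2 * π * μ) ≠ 1 := by
  intro h1
  have h2 := congrArg (‖·‖) h1
  simp only [Complex.norm_exp, norm_one, Real.exp_eq_one_iff] at h2
  have h3 : (2 * π * μ : ℂ).re = 2 * π * μ.re := by
    simp [Complex.mul_re]
  rw [h3] at h2
  exact h ((mul_eq_zero.1 h2).resolve_left two_pi_pos.ne')

/-- `x - i y` solves a complex equation with matrix `B - i ν`, and the imaginary shift leaves the
real parts of the eigenvalues alone. -/
theorem eq_zero_of_periodic_hyperbolic {B : Matrix (Fin k) (Fin k) ℝ}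
    (hB : ∀ μ ∈ spectrum ℂ (B.map (algebraMap ℝ ℂ)), μ.re ≠ 0) {ν : ℝ} {x y : ℝ → Fin k → ℝ}
    (hx : ∀ t, HasDerivAt x (B *ᵥ x t - ν • y t) t) (hy : ∀ t, HasDerivAt y (B *ᵥ y t + ν • x t) t)
    (hxp : Function.Periodic x (2 * π)) (hyp : Function.Periodic y (2 * π)) (t : ℝ) :
    x t = 0 ∧ y t = 0 := by
  let Bc : Matrix (Fin k) (Fin k) ℂ := B.map (algebraMap ℝ ℂ)
  let M : (Fin k → ℂ) →L[ℂ] (Fin k → ℂ) :=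
    LinearMap.toContinuousLinearMap (Matrix.toLin' Bc) -
      (Complex.I * ν) • ContinuousLinearMap.id ℂ _
  have hM : ∀ v, M v = Bc *ᵥ v - (Complex.I * ν) • v := fun v => by simp [M]
  have h := eq_zero_of_periodic_of_hasDerivAt M (y := fun t i => (x t i : ℂ) - Complex.I * y t i)
    (fun μ v hv h => ?_) (fun t => ?_) (fun t => by simp only [hxp t, hyp t]) t
  · constructor <;> funext i
    · simpa using congrArg Complex.re (congrFun h i)
    · simpa using congrArg Complex.im (congrFun h i)
  · have h1 : Bc *ᵥ v = (μ + Complex.I * ν) • v := by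
      rw [add_smul, ← h, hM]; abel
    have h2 : μ + Complex.I * ν ∈ spectrum ℂ Bc := by
      have h3 : Module.End.HasEigenvalue (Matrix.toLin' Bc) (μ + Complex.I * ν) :=
        Module.End.hasEigenvalue_of_hasEigenvector (x := v)
          ⟨Module.End.mem_eigenspace_iff.2 (by simpa using h1), hv⟩
      have := h3.mem_spectrum
      rwa [Matrix.spectrum_toLin'] at this
    have h3 := hB _ h2
    refine exp_ne_one_of_re_ne_zero ?_
    simpa using h3
  · refine hasDerivAt_pi.2 fun i => ?_
    have h1 := (hasDerivAt_pi.1 (hx t) i).ofReal_comp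
    have h2 := (hasDerivAt_pi.1 (hy t) i).ofReal_comp
    refine (h1.fun_sub (h2.const_mul Complex.I)).congr_deriv ?_
    have h3 : (Bc *ᵥ fun i => (x t i : ℂ) - Complex.I * y t i) i
        = ((B *ᵥ x t) i : ℂ) - Complex.I * ((B *ᵥ y t) i : ℂ) := by
      simp only [Matrix.mulVec, dotProduct, Bc, Matrix.map_apply, mul_sub, Finset.sum_sub_distrib]
      push_cast
      rw [Finset.mul_sum]
      congr 1
      refine Finset.sum_congr rfl fun j _ => ?_
      simp only [Complex.coe_algebraMap]; ring
    rw [hM, Pi.sub_apply (Bc *ᵥ _), h3]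
    simp only [Pi.sub_apply, Pi.add_apply, Pi.smul_apply, smul_eq_mul]
    push_cast
    linear_combination (-(ν * y t i) : ℂ) * Complex.I_sq

/-- The Fourier modes decouple. In the critical plane mode `m` splits into two complex scalar
equations with exponents `i ω (1 ∓ m)`; in the hyperbolic block the eigenvalues of `B` are shifted
by imaginary numbers. The only resonant exponent is the zero in mode one, and adding `κ ℓ` moves it
to one. -/
theorem isNonresonant_linOp {om : ℝ} (h0 : 0 < om) (h1 : om < 1 / 2) (h3 : om ≠ 1 / 3)
    (h4 : om ≠ 1 / 4) {B : Matrix (Fin k) (Fin k) ℝ}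
    (hB : ∀ μ ∈ spectrum ℂ (B.map (algebraMap ℝ ℂ)), μ.re ≠ 0) :
    IsNonresonant (linOp (blockL 0 om B) om) kap ell where
  map_ker q := by
    rw [linOp_kap, ← map_zero kap]
    congr 1
    ext <;> simp
  map_range := ell_linOp om B
  section_apply := ell_kap
  injective x hx := by
    let T := linOp (blockL 0 om B) om + kap.comp ell
    let w : ℝ → Fin 7 → State k := fun t => expFlow T t x
    have hw : ∀ t, HasDerivAt w (T (w t)) t := fun t => by
      simpa [w] using (hasDerivAt_expFlow T t).clm_apply (hasDerivAt_const t x)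
    have hwp : Function.Periodic w (2 * π) := fun t => by
      simp only [w]; rw [expFlow_add, mul_apply_eq_comp, hx]
    have hT : ∀ u, T u = linOp (blockL 0 om B) om u + kap (ell u) := fun u => rfl
    have hc : ∀ j i t, HasDerivAt (fun t => w t j i) (T (w t) j i) t := fun j i t =>
      hasDerivAt_pi.1 (hasDerivAt_pi.1 (hw t) j) i
    have hp : ∀ j i, Function.Periodic (fun t => w t j i) (2 * π) := fun j i t => by
      simp only [hwp t]
    have hnr := exp_ne_one_of_nonresonant h0 h1 h3 h4
    have hnr' : ∀ j : ℤ, j ≠ 0 → |j| ≤ 4 →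
        Complex.exp (2 * π * ((0 : ℝ) + Complex.I * (j * om : ℝ))) ≠ 1 := fun j hj hj' => by
      simpa using hnr j hj hj'
    have hw0 : ∀ t, w t = 0 := by
      intro t
      -- For cosine coefficient `a` and sine coefficient `b`, the exponents belong to `(a₁ + b₂) + i
      -- (a₂ - b₁)` and `(a₁ - b₂) + i (a₂ + b₁)`, which together determine `a` and `b`.
      have hat : ∀ (j j' : Fin 7) (m : ℤ), 1 - m ≠ 0 → |1 - m| ≤ 4 → 1 + m ≠ 0 → |1 + m| ≤ 4 →
          (∀ t, T (w t) j (Sum.inl 0) = -om * w t j (Sum.inl 1) - om * m * w t j' (Sum.inl 0)) →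
          (∀ t, T (w t) j (Sum.inl 1) = om * w t j (Sum.inl 0) - om * m * w t j' (Sum.inl 1)) →
          (∀ t, T (w t) j' (Sum.inl 0) = -om * w t j' (Sum.inl 1) + om * m * w t j (Sum.inl 0)) →
          (∀ t, T (w t) j' (Sum.inl 1) = om * w t j' (Sum.inl 0) + om * m * w t j (Sum.inl 1)) →
          w t j (Sum.inl 0) = 0 ∧ w t j (Sum.inl 1) = 0 ∧
            w t j' (Sum.inl 0) = 0 ∧ w t j' (Sum.inl 1) = 0 := by
        intro j j' m hm1 hm2 hm3 hm4 e1 e2 e3 e4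
        have h5 := eq_zero_of_periodic_planar (hnr' (1 - m) hm1 hm2)
          (r := fun t => w t j (Sum.inl 0) + w t j' (Sum.inl 1))
          (s := fun t => w t j (Sum.inl 1) - w t j' (Sum.inl 0))
          (fun t => ((hc j _ t).fun_add (hc j' _ t)).congr_deriv (by
            rw [e1, e4]; push_cast; ring))
          (fun t => ((hc j _ t).fun_sub (hc j' _ t)).congr_deriv (by
            rw [e2, e3]; push_cast; ring))
          ((hp j _).add (hp j' _)) ((hp j _).sub (hp j' _)) t
        have h6 := eq_zero_of_periodic_planar (hnr' (1 + m) hm3 hm4)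
          (r := fun t => w t j (Sum.inl 0) - w t j' (Sum.inl 1))
          (s := fun t => w t j (Sum.inl 1) + w t j' (Sum.inl 0))
          (fun t => ((hc j _ t).fun_sub (hc j' _ t)).congr_deriv (by
            rw [e1, e4]; push_cast; ring))
          (fun t => ((hc j _ t).fun_add (hc j' _ t)).congr_deriv (by
            rw [e2, e3]; push_cast; ring))
          ((hp j _).sub (hp j' _)) ((hp j _).add (hp j' _)) t
        obtain ⟨h7, h8⟩ := h5
        obtain ⟨h9, h10⟩ := h6
        refine ⟨?_, ?_, ?_, ?_⟩ <;> linarith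
      have tl : ∀ (j j' : Fin 7) (m : ℝ),
          (∀ t, til (T (w t) j) = B *ᵥ til (w t j) - (om * m) • til (w t j')) →
          (∀ t, til (T (w t) j') = B *ᵥ til (w t j') + (om * m) • til (w t j)) →
          til (w t j) = 0 ∧ til (w t j') = 0 := by
        intro j j' m e1 e2
        refine eq_zero_of_periodic_hyperbolic hB (ν := om * m) (x := fun t => til (w t j))
          (y := fun t => til (w t j')) (fun t => ?_) (fun t => ?_) (fun t => by simp only [hwp t])
          (fun t => by simp only [hwp t]) t
        · rw [← e1]; exact hasDerivAt_pi.2 fun i => hc j _ t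
        · rw [← e2]; exact hasDerivAt_pi.2 fun i => hc j' _ t
      have h5 : ∀ t j, T (w t) j = linOp (blockL 0 om B) om (w t) j + kap (k := k) (ell (w t)) j :=
        fun t j => rfl
      have htil : ∀ x : State k, til (blockL 0 om B x) = B *ᵥ til x := fun x =>
        funext fun i => blockL_inr _ _ _ _ _
      have htadd : ∀ x y : State k, til (x + y) = til x + til y := fun x y => rfl
      have htsub : ∀ x y : State k, til (x - y) = til x - til y := fun x y => rfl
      have htsmul : ∀ (c : ℝ) (x : State k), til (c • x) = c • til x := fun c x => rfl
      have htz : til (0 : State k) = 0 := rfl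
      have hk1 : ∀ x y : ℝ, til (Sum.elim ![x, y] 0 : State k) = 0 := fun _ _ => rfl
      -- Mode zero has no sine coefficient; index `0` plays both roles, which is consistent because
      -- `m = 0`.
      obtain ⟨a1, a2, -, -⟩ := hat 0 0 0 (by simp) (by simp) (by simp) (by simp)
        (fun t => by rw [h5, linOp_apply, kap_apply]; simp [blockL_inl_zero])
        (fun t => by rw [h5, linOp_apply, kap_apply]; simp [blockL_inl_one])
        (fun t => by rw [h5, linOp_apply, kap_apply]; simp [blockL_inl_zero])
        (fun t => by rw [h5, linOp_apply, kap_apply]; simp [blockL_inl_one])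
      obtain ⟨b1, b2, b3, b4⟩ := hat 3 4 2 (by simp) (by simp) (by simp) (by simp)
        (fun t => by rw [h5, linOp_apply, kap_apply]; simp [blockL_inl_zero]; ring)
        (fun t => by rw [h5, linOp_apply, kap_apply]; simp [blockL_inl_one]; ring)
        (fun t => by rw [h5, linOp_apply, kap_apply]; simp [blockL_inl_zero]; ring)
        (fun t => by rw [h5, linOp_apply, kap_apply]; simp [blockL_inl_one]; ring)
      obtain ⟨c1, c2, c3, c4⟩ := hat 5 6 3 (by simp) (by norm_num) (by simp) (by norm_num)
        (fun t => by rw [h5, linOp_apply, kap_apply]; simp [blockL_inl_zero]; ring)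
        (fun t => by rw [h5, linOp_apply, kap_apply]; simp [blockL_inl_one]; ring)
        (fun t => by rw [h5, linOp_apply, kap_apply]; simp [blockL_inl_zero]; ring)
        (fun t => by rw [h5, linOp_apply, kap_apply]; simp [blockL_inl_one]; ring)
      -- The kernel direction of mode one, where `κ ℓ` contributes the exponent `1`.
      obtain ⟨d1, d2⟩ := eq_zero_of_periodic_planar (a := 1) (ν := 0)
        (by
          have := exp_ne_one_of_re_ne_zero (μ := 1) (by simp)
          simpa using this)
        (r := fun t => w t 1 (Sum.inl 0) + w t 2 (Sum.inl 1))
        (s := fun t => w t 1 (Sum.inl 1) - w t 2 (Sum.inl 0))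
        (fun t => ((hc 1 _ t).fun_add (hc 2 _ t)).congr_deriv (by
          rw [h5, h5, linOp_apply, kap_apply, ell_apply]
          simp [blockL_inl_zero, blockL_inl_one]; ring))
        (fun t => ((hc 1 _ t).fun_sub (hc 2 _ t)).congr_deriv (by
          rw [h5, h5, linOp_apply, kap_apply, ell_apply]
          simp [blockL_inl_zero, blockL_inl_one]; ring))
        ((hp 1 _).add (hp 2 _)) ((hp 1 _).sub (hp 2 _)) t
      obtain ⟨d3, d4⟩ := eq_zero_of_periodic_planar (hnr' 2 (by simp) (by simp))
        (r := fun t => w t 1 (Sum.inl 0) - w t 2 (Sum.inl 1))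
        (s := fun t => w t 1 (Sum.inl 1) + w t 2 (Sum.inl 0))
        (fun t => ((hc 1 _ t).fun_sub (hc 2 _ t)).congr_deriv (by
          rw [h5, h5, linOp_apply, kap_apply, ell_apply]
          simp [blockL_inl_zero, blockL_inl_one]; ring))
        (fun t => ((hc 1 _ t).fun_add (hc 2 _ t)).congr_deriv (by
          rw [h5, h5, linOp_apply, kap_apply, ell_apply]
          simp [blockL_inl_zero, blockL_inl_one]; ring))
        ((hp 1 _).sub (hp 2 _)) ((hp 1 _).add (hp 2 _)) t
      obtain ⟨t0, -⟩ := tl 0 0 0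
        (fun t => by
          rw [h5, linOp_apply, kap_apply]; simp [htadd, htz, htil])
        (fun t => by
          rw [h5, linOp_apply, kap_apply]; simp [htadd, htz, htil])
      obtain ⟨t1, t2⟩ := tl 1 2 1
        (fun t => by
          rw [h5, linOp_apply, kap_apply]; simp [htadd, htsub, htsmul, hk1, htil])
        (fun t => by
          rw [h5, linOp_apply, kap_apply]; simp [htadd, htsmul, hk1, htil])
      obtain ⟨t3, t4⟩ := tl 3 4 2
        (fun t => by
          rw [h5, linOp_apply, kap_apply]; simp [htadd, htsub, htsmul, htz, htil, smul_smul])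
        (fun t => by
          rw [h5, linOp_apply, kap_apply]; simp [htadd, htsmul, htz, htil, smul_smul])
      obtain ⟨t5, t6⟩ := tl 5 6 3
        (fun t => by
          rw [h5, linOp_apply, kap_apply]; simp [htadd, htsub, htsmul, htz, htil, smul_smul])
        (fun t => by
          rw [h5, linOp_apply, kap_apply]; simp [htadd, htsmul, htz, htil, smul_smul])
      funext j
      fin_cases j
      · exact state_ext a1 a2 (congrFun t0)
      · exact state_ext (by simp; linarith) (by simp; linarith) (congrFun t1)
      · exact state_ext (by simp; linarith) (by simp; linarith) (congrFun t2)
      · exact state_ext b1 b2 (congrFun t3)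
      · exact state_ext b3 b4 (congrFun t4)
      · exact state_ext c1 c2 (congrFun t5)
      · exact state_ext c3 c4 (congrFun t6)
    have := hw0 0
    simpa [w, expFlow_zero] using this

end Nonresonance

/-! ### Reduction to a globally smooth model. -/

section Model

variable {k : ℕ}

/-- Globally smooth data for the expansion `G(z, λ, θ; ε) = E(λ) z + ε M(εz, θ, λ)(z, z)`. -/
structure Model (k : ℕ) where
  p : ℝ → ℝ
  q : ℝ → ℝ
  B : ℝ → Matrix (Fin k) (Fin k) ℝ
  M : State k × (ℝ × ℝ) → State k →L[ℝ] State k →L[ℝ] State k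
  M₃ : State k × (ℝ × ℝ) → State k →L[ℝ] State k →L[ℝ] State k →L[ℝ] State k
  smooth_p : ContDiff ℝ ∞ p
  smooth_q : ContDiff ℝ ∞ q
  smooth_B : ∀ i j, ContDiff ℝ ∞ fun lam => B lam i j
  smooth_M : ContDiff ℝ ∞ M
  smooth_M₃ : ContDiff ℝ ∞ M₃
  periodic_M : ∀ y lam θ, M (y, (θ + 2 * π, lam)) = M (y, (θ, lam))
  periodic_M₃ : ∀ y lam θ, M₃ (y, (θ + 2 * π, lam)) = M₃ (y, (θ, lam))
  M_eq : ∀ y q, M (y, q) = M (0, q) + M₃ (y, q) y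

namespace Model

/-- The linear part of a model. -/
def L (m : Model k) (lam : ℝ) : State k →L[ℝ] State k := blockL (m.p lam) (m.q lam) (m.B lam)

/-- The vector field of a model. -/
def g (m : Model k) (z : State k) (lam θ ε : ℝ) : State k :=
  m.L lam z + ε • m.M (ε • z, (θ, lam)) z z

end Model

/-- A smooth retraction of the line into a ball that is the identity near the centre. -/
theorem exists_smooth_cutoff (x : ℝ) {r : ℝ} (hr : 0 < r) :
    ∃ c : ℝ → ℝ, ContDiff ℝ ∞ c ∧ (∀ y, c y ∈ Metric.ball x r) ∧ ∀ y, |y - x| < r / 2 → c y = y := by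
  let f : ContDiffBump x := ⟨r / 2, r, by positivity, by linarith⟩
  refine ⟨fun y => x + f y * (y - x), ?_, fun y => ?_, fun y hy => ?_⟩
  · exact contDiff_const.add (f.contDiff.mul (contDiff_id.sub contDiff_const))
  · rw [Metric.mem_ball, Real.dist_eq, add_sub_cancel_left, abs_mul, abs_of_nonneg f.nonneg]
    by_cases h : |y - x| < r
    · exact (mul_le_of_le_one_left (abs_nonneg _) f.le_one).trans_lt h
    · rw [f.zero_of_le_dist (by simpa [Real.dist_eq] using h), zero_mul]
      exact hr
  · have h : f y = 1 := f.one_of_mem_closedBall (by simpa [Real.dist_eq, f] using hy.le)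
    simp only [h, one_mul, add_sub_cancel]

theorem contDiff_matL {E : Type} [NormedAddCommGroup E] [NormedSpace ℝ E]
    {M : E → Matrix (Fin 2 ⊕ Fin k) (Fin 2 ⊕ Fin k) ℝ} (h : ∀ i j, ContDiff ℝ ∞ fun x => M x i j) :
    ContDiff ℝ ∞ fun x => matL (M x) := by
  refine contDiff_clm_apply_iff.2 fun y => contDiff_pi.2 fun i => ?_
  simp only [matL_apply, Matrix.mulVec, dotProduct]
  exact ContDiff.sum fun j _ => (h i j).mul contDiff_const

/-- Multiplication by an invertible matrix as a linear equivalence. -/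
def matEquiv (M : Matrix (Fin 2 ⊕ Fin k) (Fin 2 ⊕ Fin k) ℝ) (h : IsUnit M) :
    State k ≃L[ℝ] State k :=
  ContinuousLinearEquiv.equivOfInverse (matL M) (matL M⁻¹)
    (fun x => by
      rw [matL_apply, matL_apply, Matrix.mulVec_mulVec,
        Matrix.nonsing_inv_mul _ ((Matrix.isUnit_iff_isUnit_det _).1 h), Matrix.one_mulVec])
    (fun x => by
      rw [matL_apply, matL_apply, Matrix.mulVec_mulVec,
        Matrix.mul_nonsing_inv _ ((Matrix.isUnit_iff_isUnit_det _).1 h), Matrix.one_mulVec])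

theorem matL_inverse {M : Matrix (Fin 2 ⊕ Fin k) (Fin 2 ⊕ Fin k) ℝ} (h : IsUnit M) :
    (matL M).inverse = matL M⁻¹ :=
  ContinuousLinearMap.inverse_equiv (matEquiv M h)

theorem contDiff_matL_inverse {E : Type} [NormedAddCommGroup E] [NormedSpace ℝ E]
    {M : E → Matrix (Fin 2 ⊕ Fin k) (Fin 2 ⊕ Fin k) ℝ} (h : ∀ i j, ContDiff ℝ ∞ fun x => M x i j)
    (hu : ∀ x, IsUnit (M x)) : ContDiff ℝ ∞ fun x => matL (M x)⁻¹ := by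
  have h1 : (fun x => matL (M x)⁻¹) = fun x => (matL (M x)).inverse :=
    funext fun x => (matL_inverse (hu x)).symm
  rw [h1]
  refine contDiff_iff_contDiffAt.2 fun x => ?_
  exact (contDiffAt_map_inverse (matEquiv (M x) (hu x))).comp x (contDiff_matL h).contDiffAt

/-- In Floquet coordinates the increment of the field is a smooth function of `ε z` that vanishes at
zero, and three applications of Hadamard's lemma extract its linear, quadratic and cubic parts. The
Floquet equation turns the linear part minus `P⁻¹ ∂P` into `E(λ)`. Data smooth only near `λ⋆` are
composed with a cutoff in `λ`, which changes nothing close to `λ⋆`. -/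
theorem exists_model {S : ForcedSystem k} {lamStar omStar : ℝ}
    (hNS : S.IsNeimarkSackerPoint lamStar omStar) :
    ∃ (m : Model k) (r : ℝ), 0 < r ∧ ∀ lam, |lam - lamStar| < r →
      m.p lam = S.alphaR lam ∧ m.q lam = S.alphaI lam ∧ m.B lam = S.Etil lam ∧
      ∀ z θ ε, ε ≠ 0 → S.G z lam θ ε = m.g z lam θ ε := by
  obtain ⟨r, hr, hb⟩ := hNS.branch
  obtain ⟨c, hc, hcb, hcid⟩ := exists_smooth_cutoff lamStar hr
  have hcp : ContDiff ℝ ∞ fun q : ℝ × ℝ => (q.1, c q.2) :=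
    contDiff_fst.prodMk (hc.comp contDiff_snd)
  have hcm : ∀ q : ℝ × ℝ, (q.1, c q.2) ∈ Set.univ ×ˢ Metric.ball lamStar r :=
    fun q => ⟨trivial, hcb _⟩
  have hP : ∀ i j, ContDiff ℝ ∞ fun q : ℝ × ℝ => S.P q.1 (c q.2) i j := fun i j =>
    (hb.smooth_P i j).comp_contDiff hcp hcm
  have hu : ∀ q : ℝ × ℝ, IsUnit (S.P q.1 (c q.2)) := fun q => hb.nonsingular _ (hcb _) _
  have hv : ContDiff ℝ ∞ fun q : ℝ × ℝ => S.v q.1 (c q.2) := hb.smooth_v.comp_contDiff hcp hcm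
  have hPL := contDiff_matL hP
  have hPI := contDiff_matL_inverse hP hu
  let f : State k × (ℝ × ℝ) → State k := fun x =>
    matL (S.P x.2.1 (c x.2.2))⁻¹
      (S.F (S.v x.2.1 (c x.2.2) + matL (S.P x.2.1 (c x.2.2)) x.1) x.2.1 (c x.2.2)
        - S.F (S.v x.2.1 (c x.2.2)) x.2.1 (c x.2.2))
  have hF := hNS.smooth_F
  have hf : ContDiff ℝ ∞ f := by
    refine (hPI.comp contDiff_snd).clm_apply (ContDiff.sub ?_ ?_)
    · exact hF.comp (((hv.comp contDiff_snd).add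
        ((hPL.comp contDiff_snd).clm_apply contDiff_fst)).prodMk (hcp.comp contDiff_snd))
    · exact hF.comp ((hv.comp contDiff_snd).prodMk (hcp.comp contDiff_snd))
  obtain ⟨M₁, hM₁, hM₁f, hM₁0, hM₁p⟩ := exists_hadamard hf
  obtain ⟨M₂, hM₂, hM₂f, -, hM₂p⟩ := exists_hadamard hM₁
  obtain ⟨M₃, hM₃, hM₃f, -, hM₃p⟩ := exists_hadamard hM₂
  have hfp : ∀ y θ lam, f (y, (θ + 2 * π, lam)) = f (y, (θ, lam)) := fun y θ lam => by
    simp only [f]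
    have h1 : ∀ x, S.F x (θ + 2 * π) (c lam) = S.F x θ (c lam) := fun x =>
      hNS.periodic_F x (c lam) θ
    have h2 : S.P (θ + 2 * π) (c lam) = S.P θ (c lam) := hb.periodic_P _ (hcb lam) θ
    have h3 : S.v (θ + 2 * π) (c lam) = S.v θ (c lam) := hb.periodic_v _ (hcb lam) θ
    rw [h1, h1, h2, h3]
  let m : Model k :=
    { p := fun lam => S.alphaR (c lam)
      q := fun lam => S.alphaI (c lam)
      B := fun lam => S.Etil (c lam)
      M := M₂
      M₃ := M₃
      smooth_p := hb.smooth_alphaR.comp_contDiff hc hcb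
      smooth_q := hb.smooth_alphaI.comp_contDiff hc hcb
      smooth_B := fun i j => (hb.smooth_Etil i j).comp_contDiff hc hcb
      smooth_M := hM₂
      smooth_M₃ := hM₃
      periodic_M := fun y lam θ => hM₂p _ _ (hM₁p _ _ fun y => hfp y θ lam) y
      periodic_M₃ := fun y lam θ =>
        hM₃p _ _ (hM₂p _ _ (hM₁p _ _ fun y => hfp y θ lam)) y
      M_eq := hM₃f }
  refine ⟨m, r / 2, by positivity, fun lam hlam => ?_⟩
  have hcl := hcid lam hlam
  have hlb : lam ∈ Metric.ball lamStar r := hcl ▸ hcb lam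
  refine ⟨by simp only [m, hcl], by simp only [m, hcl], by simp only [m, hcl], ?_⟩
  intro z θ ε hε
  have hFx : DifferentiableAt ℝ (fun x => S.F x θ lam) (S.v θ lam) :=
    (hF.comp (contDiff_id.prodMk contDiff_const :
      ContDiff ℝ ∞ fun x : State k => (x, (θ, lam)))).differentiable (by simp) _
  have hJ : ∀ x, jacobian (fun x => S.F x θ lam) (S.v θ lam) *ᵥ x
      = fderiv ℝ (fun x => S.F x θ lam) (S.v θ lam) x := fun x => by
    rw [jacobian, ← Matrix.toLin'_apply, Matrix.toLin'_toMatrix']; rfl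
  have hD : ∀ y, M₁ (0, (θ, lam)) y = matL (S.P θ lam)⁻¹
      (jacobian (fun x => S.F x θ lam) (S.v θ lam) *ᵥ (S.P θ lam *ᵥ y)) := by
    intro y
    rw [hM₁0, hJ]
    have h1 : HasFDerivAt (fun y => S.v θ lam + matL (S.P θ lam) y) (matL (S.P θ lam)) 0 :=
      (matL (S.P θ lam)).hasFDerivAt.const_add _
    have h2 : HasFDerivAt (fun x => S.F x θ lam)
        (fderiv ℝ (fun x => S.F x θ lam) (S.v θ lam))
        (S.v θ lam + matL (S.P θ lam) 0) := by
      rw [map_zero, add_zero]; exact hFx.hasFDerivAt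
    have h3 := (matL (S.P θ lam)⁻¹).hasFDerivAt.comp (0 : State k)
      ((h2.comp (0 : State k) h1).sub_const (S.F (S.v θ lam) θ lam))
    have h4 : (fun y => f (y, (θ, lam))) = (matL (S.P θ lam)⁻¹) ∘ fun y =>
        ((fun x => S.F x θ lam) ∘ fun y => S.v θ lam + matL (S.P θ lam) y) y
          - S.F (S.v θ lam) θ lam := by
      funext y; simp only [f, hcl, Function.comp_apply]
    rw [h4, h3.fderiv]
    simp [matL_apply]
  have hfl : ∀ y, matL (S.P θ lam)⁻¹
      (jacobian (fun x => S.F x θ lam) (S.v θ lam) *ᵥ (S.P θ lam *ᵥ y) - S.dP θ lam *ᵥ y)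
        = matL (S.E lam) y := by
    intro y
    rw [Matrix.mulVec_mulVec, ← Matrix.sub_mulVec, hb.floquet lam hlb θ, matL_apply, matL_apply,
      Matrix.mulVec_mulVec, ← mul_assoc, Matrix.nonsing_inv_mul _
        ((Matrix.isUnit_iff_isUnit_det _).1 (hb.nonsingular lam hlb θ)), one_mul]
  have hmL : m.L lam = matL (S.E lam) := by
    simp only [Model.L, m, hcl, blockL, ForcedSystem.E]
  have h5 : f (ε • z, (θ, lam)) = ε • M₁ (0, (θ, lam)) z
      + (ε * ε) • M₂ (ε • z, (θ, lam)) z z := by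
    rw [hM₁f, hM₂f]
    have : f (0, (θ, lam)) = 0 := by simp [f]
    rw [this]
    simp [smul_smul]
  have h6 : S.G z lam θ ε = ε⁻¹ • (f (ε • z, (θ, lam)) - ε • matL (S.P θ lam)⁻¹ (S.dP θ lam *ᵥ z)) := by
    simp only [ForcedSystem.G, f, hcl, matL_apply]
    rw [Matrix.mulVec_sub, Matrix.mulVec_smul, Matrix.mulVec_smul]
  rw [h6, h5, Model.g, hmL, ← hfl, map_sub, ← hD]
  simp only [m, smul_sub, smul_add, smul_smul, inv_mul_cancel₀ hε, inv_mul_cancel_left₀ hε,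
    one_smul]
  abel

end Model

/-! ### The Galerkin equations as an ordinary differential equation in `θ`. -/

section Galerkin

variable {k : ℕ}

theorem aStar_eq (φ : ℝ) : aStar φ = trig φ (kap (k := k) (1, 0)) := by
  rw [trig_apply', kap_apply]
  refine state_ext ?_ ?_ fun i => ?_ <;> simp [aStar]

theorem trig_comp (L : State k →L[ℝ] State k) (φ : ℝ) (u : Fin 7 → State k) :
    L (trig φ u) = trig φ fun j => L (u j) := by
  simp only [trig_apply, map_sum, map_smul]

theorem linOp_eq (L : State k →L[ℝ] State k) (om : ℝ) (u : Fin 7 → State k) :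
    linOp L om u = (fun j => L (u j)) - om • dphi u := rfl

namespace FourierTorus

/-- The Fourier coefficients of `z - a⋆` as a single function. -/
def toCoef (s : FourierTorus k) (θ : ℝ) : Fin 7 → State k :=
  ![s.a0 θ, s.a1 θ, s.b1 θ, s.a2 θ, s.b2 θ, s.a3 θ, s.b3 θ]

/-- The unknowns with given parameters and Fourier coefficients. -/
def ofCoef (lam om : ℝ) (w : ℝ → Fin 7 → State k) : FourierTorus k where
  lam := lam
  om := om
  a0 θ := w θ 0
  a1 θ := w θ 1
  b1 θ := w θ 2
  a2 θ := w θ 3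
  b2 θ := w θ 4
  a3 θ := w θ 5
  b3 θ := w θ 6

theorem toCoef_ofCoef (lam om : ℝ) (w : ℝ → Fin 7 → State k) :
    (ofCoef lam om w).toCoef = w := by
  funext θ j
  fin_cases j <;> rfl

theorem eq_ofCoef {s : FourierTorus k} {lam om : ℝ} {w : ℝ → Fin 7 → State k} (h1 : s.lam = lam)
    (h2 : s.om = om) (h : s.toCoef = w) : s = ofCoef lam om w := by
  subst h
  ext1
  · exact h1
  · exact h2
  all_goals rfl

theorem z_eq (s : FourierTorus k) (θ φ : ℝ) :
    s.z θ φ = trig φ (kap (1, 0) + s.toCoef θ) := by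
  rw [map_add, ← aStar_eq, z, trig_apply']
  simp only [toCoef]
  simp
  abel

end FourierTorus

/-- The quadratic and higher order terms of the Galerkin vector field. -/
def Model.gal₂ (m : Model k) (u : Fin 7 → State k) (lam θ ε : ℝ) : Fin 7 → State k :=
  coef fun φ => m.M (ε • trig φ u, (θ, lam)) (trig φ u) (trig φ u)

/-- The vector field of the Galerkin equations on Fourier coefficients. -/
def Model.gal (m : Model k) (u : Fin 7 → State k) (lam om θ ε : ℝ) : Fin 7 → State k :=
  linOp (m.L lam) om u + ε • m.gal₂ u lam θ ε

/-- The linear part preserves trigonometric polynomials of degree three, so truncation affects the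
nonlinear term only; `om • dphi u` compensates for the `φ`-derivative contained in `gal`. -/
theorem Model.coef_g (m : Model k) (u : Fin 7 → State k) (lam om θ ε : ℝ) :
    coef (fun φ => m.g (trig φ u) lam θ ε) = m.gal u lam om θ ε + om • dphi u := by
  have hc := continuous_trig u
  have hM := m.smooth_M.continuous
  simp only [Model.g]
  rw [coef_add (by fun_prop) (by fun_prop), coef_smul]
  simp only [trig_comp (m.L lam)]
  rw [coef_trig, Model.gal, linOp_eq, Model.gal₂]
  abel

theorem Model.contDiff_gal₂ (m : Model k) : ContDiff ℝ ∞
    fun x : (Fin 7 → State k) × (ℝ × ℝ × ℝ) => m.gal₂ x.1 x.2.1 x.2.2.1 x.2.2.2 := by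
  have hT : ContDiff ℝ ∞ fun y : ((Fin 7 → State k) × (ℝ × ℝ × ℝ)) × ℝ =>
      trig y.2 y.1.1 :=
    contDiff_trig_comp (f := fun y : ((Fin 7 → State k) × (ℝ × ℝ × ℝ)) × ℝ => y.2)
      (u := fun y => y.1.1) (by fun_prop) (by fun_prop)
  refine contDiff_coef (g := fun y : ((Fin 7 → State k) × (ℝ × ℝ × ℝ)) × ℝ =>
    m.M (y.1.2.2.2 • trig y.2 y.1.1, (y.1.2.2.1, y.1.2.1)) (trig y.2 y.1.1) (trig y.2 y.1.1)) ?_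
  refine ContDiff.clm_apply (ContDiff.clm_apply (m.smooth_M.comp ?_) hT) hT
  have h1 : ContDiff ℝ ∞ fun y : ((Fin 7 → State k) × (ℝ × ℝ × ℝ)) × ℝ => y.1.2.2.2 := by fun_prop
  have h2 : ContDiff ℝ ∞ fun y : ((Fin 7 → State k) × (ℝ × ℝ × ℝ)) × ℝ =>
    (y.1.2.2.1, y.1.2.1) := by fun_prop
  exact (h1.smul hT).prodMk h2

theorem Model.contDiff_L (m : Model k) : ContDiff ℝ ∞ m.L := by
  refine contDiff_matL fun i j => ?_
  have hp := m.smooth_p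
  have hq := m.smooth_q
  rcases i with i | i <;> rcases j with j | j
  · fin_cases i <;> fin_cases j
    · simpa [rot] using hp
    · simpa [rot] using hq.neg
    · simpa [rot] using hq
    · simpa [rot] using hp
  · simpa using contDiff_const
  · simpa using contDiff_const
  · simpa using m.smooth_B i j

theorem contDiff_linOp {E : Type} [NormedAddCommGroup E] [NormedSpace ℝ E]
    {L : E → State k →L[ℝ] State k} {om : E → ℝ} (hL : ContDiff ℝ ∞ L) (hom : ContDiff ℝ ∞ om) :
    ContDiff ℝ ∞ fun x => linOp (L x) (om x) := by
  refine contDiff_clm_apply_iff.2 fun u => ?_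
  simp only [linOp_eq]
  exact (contDiff_pi.2 fun j => hL.clm_apply contDiff_const).sub (hom.smul contDiff_const)

theorem Model.contDiff_gal (m : Model k) : ContDiff ℝ ∞
    fun x : (Fin 7 → State k) × (ℝ × ℝ × ℝ × ℝ) =>
      m.gal x.1 x.2.1 x.2.2.1 x.2.2.2.1 x.2.2.2.2 := by
  have h1 : ContDiff ℝ ∞ fun x : (Fin 7 → State k) × (ℝ × ℝ × ℝ × ℝ) =>
      linOp (m.L x.2.1) x.2.2.1 :=
    contDiff_linOp (m.contDiff_L.comp (by fun_prop)) (by fun_prop)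
  have h2 := m.contDiff_gal₂.comp (by fun_prop : ContDiff ℝ ∞
      fun x : (Fin 7 → State k) × (ℝ × ℝ × ℝ × ℝ) => (x.1, (x.2.1, x.2.2.2.1, x.2.2.2.2)))
  have h3 : ContDiff ℝ ∞ fun x : (Fin 7 → State k) × (ℝ × ℝ × ℝ × ℝ) => x.2.2.2.2 := by
    fun_prop
  exact (h1.clm_apply contDiff_fst).add (h3.smul h2)

theorem Model.continuous_gal (m : Model k) {w : ℝ → Fin 7 → State k} (hw : Continuous w)
    (lam om ε : ℝ) : Continuous fun θ => m.gal (w θ) lam om θ ε := by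
  have h : Continuous fun θ => (w θ, (lam, om, θ, ε)) := by fun_prop
  have h' := m.contDiff_gal.continuous.comp h
  exact h'

theorem Model.gal_periodic (m : Model k) (u : Fin 7 → State k) (lam om ε : ℝ) :
    Function.Periodic (fun θ => m.gal u lam om θ ε) (2 * π) := fun θ => by
  simp only [Model.gal, Model.gal₂, m.periodic_M]

theorem dotProduct_planar (x : State k) (a b : ℝ) :
    x ⬝ᵥ Sum.elim ![a, b] 0 = a * x (Sum.inl 0) + b * x (Sum.inl 1) := by
  simp [dotProduct, Fin.sum_univ_two]; ring

theorem integral_cos_mul_trig (u : Fin 7 → State k) (i : Fin 2 ⊕ Fin k) :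
    ∫ φ in (0 : ℝ)..2 * π, cos φ * trig φ u i = π * u 1 i := by
  have h := congrFun (congrFun (coef_trig u) 1) i
  have hc := continuous_trig u
  have h1 := (ContinuousLinearMap.proj (R := ℝ) (φ := fun _ : Fin 2 ⊕ Fin k => ℝ)
    i).intervalIntegral_comp_comm (μ := MeasureTheory.volume) (a := 0) (b := 2 * π)
    (f := fun φ => mono 1 φ • trig φ u)
    (((continuous_mono 1).smul hc).intervalIntegrable _ _)
  simp only [coef, Pi.smul_apply] at h
  simp only [ContinuousLinearMap.proj_apply, Pi.smul_apply, smul_eq_mul] at h1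
  rw [← h1] at h
  rw [← h]
  simp [weight, mono, isCos, freq, pi_ne_zero]

theorem integral_sin_mul_trig (u : Fin 7 → State k) (i : Fin 2 ⊕ Fin k) :
    ∫ φ in (0 : ℝ)..2 * π, sin φ * trig φ u i = π * u 2 i := by
  have h := congrFun (congrFun (coef_trig u) 2) i
  have hc := continuous_trig u
  have h1 := (ContinuousLinearMap.proj (R := ℝ) (φ := fun _ : Fin 2 ⊕ Fin k => ℝ)
    i).intervalIntegral_comp_comm (μ := MeasureTheory.volume) (a := 0) (b := 2 * π)
    (f := fun φ => mono 2 φ • trig φ u)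
    (((continuous_mono 2).smul hc).intervalIntegrable _ _)
  simp only [coef, Pi.smul_apply] at h
  simp only [ContinuousLinearMap.proj_apply, Pi.smul_apply, smul_eq_mul] at h1
  rw [← h1] at h
  rw [← h]
  simp [weight, mono, isCos, freq, pi_ne_zero]

theorem inner2_trig {w : ℝ → Fin 7 → State k} (hw : Continuous w) {c : ℝ → State k} {a b : ℝ → ℝ}
    (hcab : ∀ φ, c φ = Sum.elim ![a φ, b φ] 0) :
    inner2 (fun θ φ => trig φ (w θ)) (fun _ φ => c φ) = 1 / (2 * π) ^ 2 *
      ∫ φ in (0 : ℝ)..2 * π, (a φ * trig φ (∫ θ in (0 : ℝ)..2 * π, w θ) (Sum.inl 0)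
        + b φ * trig φ (∫ θ in (0 : ℝ)..2 * π, w θ) (Sum.inl 1)) := by
  rw [inner2]
  congr 1
  refine intervalIntegral.integral_congr fun φ _ => ?_
  let T : (Fin 7 → State k) →L[ℝ] ℝ :=
    a φ • (ContinuousLinearMap.proj (R := ℝ) (φ := fun _ : Fin 2 ⊕ Fin k => ℝ)
      (Sum.inl 0)).comp (trig φ) +
    b φ • (ContinuousLinearMap.proj (R := ℝ) (φ := fun _ : Fin 2 ⊕ Fin k => ℝ)
      (Sum.inl 1)).comp (trig φ)
  have h := T.intervalIntegral_comp_comm (μ := MeasureTheory.volume)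
    (hw.intervalIntegrable 0 (2 * π))
  simp only [hcab, dotProduct_planar]
  exact h

/-- Pairing with `a⋆` picks out the mode-one coefficients in the combination `ell`, so the amplitude
condition concerns the mean of `ell` only. -/
theorem inner2_aStar {w : ℝ → Fin 7 → State k} (hw : Continuous w) :
    inner2 (fun θ φ => trig φ (w θ)) (fun _ φ => aStar φ)
      = 1 / (2 * π) * (∫ θ in (0 : ℝ)..2 * π, ell (w θ)).1 := by
  rw [inner2_trig hw (c := aStar) (a := cos) (b := sin) fun φ => rfl,
    ContinuousLinearMap.intervalIntegral_comp_comm ell (hw.intervalIntegrable _ _),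
    intervalIntegral.integral_add, integral_cos_mul_trig, integral_sin_mul_trig, ell_apply]
  · field_simp
  all_goals
    have hc := continuous_trig (∫ θ in (0 : ℝ)..2 * π, w θ)
    exact Continuous.intervalIntegrable (by fun_prop) _ _

theorem inner2_aStarDot {w : ℝ → Fin 7 → State k} (hw : Continuous w) :
    inner2 (fun θ φ => trig φ (w θ)) (fun _ φ => aStarDot φ)
      = 1 / (2 * π) * (∫ θ in (0 : ℝ)..2 * π, ell (w θ)).2 := by
  rw [inner2_trig hw (c := aStarDot) (a := fun φ => -sin φ) (b := cos) fun φ => rfl,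
    ContinuousLinearMap.intervalIntegral_comp_comm ell (hw.intervalIntegrable _ _),
    intervalIntegral.integral_add, integral_cos_mul_trig]
  · simp only [neg_mul]
    rw [intervalIntegral.integral_neg, integral_sin_mul_trig, ell_apply]
    field_simp
    ring
  all_goals
    have hc := continuous_trig (∫ θ in (0 : ℝ)..2 * π, w θ)
    exact Continuous.intervalIntegrable (by fun_prop) _ _

/-- A trigonometric polynomial is determined by its coefficients, so the Galerkin identity for all
`φ` is a differential equation for them. As `ell (kap (1, 0)) = (1, 0)`, the amplitude and phase
conditions are the two components of the mean condition. Conversely, the differential equation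
supplies the `C¹` regularity. -/
theorem FourierTorus.solves_iff {S : ForcedSystem k} {m : Model k} {s : FourierTorus k} {ε : ℝ}
    (hG : ∀ z θ, S.G z s.lam θ ε = m.g z s.lam θ ε) :
    s.Solves S ε ↔ Function.Periodic s.toCoef (2 * π) ∧
      (∀ θ, HasDerivAt s.toCoef (m.gal (kap (1, 0) + s.toCoef θ) s.lam s.om θ ε) θ) ∧
      ∫ θ in (0 : ℝ)..2 * π, ell (s.toCoef θ) = 0 := by
  have hz : s.z = fun θ φ => trig φ (kap (1, 0) + s.toCoef θ) := by
    funext θ φ; exact s.z_eq θ φ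
  have hmean : Continuous s.toCoef → (∫ θ in (0 : ℝ)..2 * π, ell (kap (k := k) (1, 0) + s.toCoef θ))
      = (2 * π) • (1, 0) + ∫ θ in (0 : ℝ)..2 * π, ell (s.toCoef θ) := fun hw => by
    simp only [map_add, ell_kap]
    rw [intervalIntegral.integral_add intervalIntegrable_const
      (Continuous.intervalIntegrable (by fun_prop) _ _), intervalIntegral.integral_const, sub_zero]
  have hgal : ∀ θ φ, HasDerivAt s.toCoef (deriv s.toCoef θ) θ →
      (trunc3 (fun ψ => S.G (s.z θ ψ) s.lam θ ε) φ
      - deriv (fun t => s.z t φ) θ - s.om • deriv (fun ψ => s.z θ ψ) φ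
      = trig φ (m.gal (kap (1, 0) + s.toCoef θ) s.lam s.om θ ε - deriv s.toCoef θ)) := by
    intro θ φ h
    simp only [hG, hz, trunc3_eq, m.coef_g _ _ s.om, (hasDerivAt_trig _ _).deriv]
    have h1 : HasDerivAt (fun t => trig φ (kap (1, 0) + s.toCoef t))
        (trig φ (deriv s.toCoef θ)) θ := by
      have h2 := (trig (V := State k) φ).hasFDerivAt.comp_hasDerivAt θ
        (h.const_add (kap (k := k) (1, 0)))
      exact h2
    rw [h1.deriv, map_add, map_sub, map_smul]
    abel
  constructor
  · rintro ⟨h1, h2, h3, h4, h5⟩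
    have hw : ContDiff ℝ 1 s.toCoef := contDiff_pi.2 fun j => by
      fin_cases j
      exacts [h1 s.a0 (by simp), h1 s.a1 (by simp), h1 s.b1 (by simp), h1 s.a2 (by simp),
        h1 s.b2 (by simp), h1 s.a3 (by simp), h1 s.b3 (by simp)]
    have hd : ∀ θ, HasDerivAt s.toCoef (deriv s.toCoef θ) θ := fun θ =>
      (hw.differentiable one_ne_zero θ).hasDerivAt
    refine ⟨fun θ => ?_, fun θ => ?_, ?_⟩
    · have := fun f hf => h2 f hf θ
      simp only [toCoef]
      rw [this s.a0 (by simp), this s.a1 (by simp), this s.b1 (by simp), this s.a2 (by simp),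
        this s.b2 (by simp), this s.a3 (by simp), this s.b3 (by simp)]
    · refine (hd θ).congr_deriv ?_
      refine (sub_eq_zero.1 (eq_of_trig_eq fun φ => ?_)).symm
      rw [← hgal θ φ (hd θ), h3, map_zero]
    · have hc := hw.continuous
      rw [hz, inner2_aStar (by fun_prop), hmean hc] at h4
      rw [hz, inner2_aStarDot (by fun_prop), hmean hc] at h5
      ext
      · have := pi_ne_zero
        rw [Prod.fst_add, Prod.smul_fst, smul_eq_mul, mul_one, one_div,
          inv_mul_eq_iff_eq_mul₀ two_pi_pos.ne'] at h4
        simpa using h4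
      · simpa [pi_ne_zero] using h5
  · rintro ⟨h1, h2, h3⟩
    have hc : Continuous s.toCoef :=
      continuous_iff_continuousAt.2 fun t => (h2 t).continuousAt
    have hw : ContDiff ℝ 1 s.toCoef := by
      rw [contDiff_one_iff_deriv]
      refine ⟨fun t => (h2 t).differentiableAt, ?_⟩
      rw [show deriv s.toCoef = _ from funext fun t => (h2 t).deriv]
      exact m.continuous_gal (by fun_prop) _ _ _
    refine ⟨?_, ?_, fun θ φ => ?_, ?_, ?_⟩
    · simp only [Set.mem_insert_iff, Set.mem_singleton_iff]
      rintro f (rfl | rfl | rfl | rfl | rfl | rfl | rfl)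
      exacts [contDiff_pi.1 hw 0, contDiff_pi.1 hw 1, contDiff_pi.1 hw 2, contDiff_pi.1 hw 3,
        contDiff_pi.1 hw 4, contDiff_pi.1 hw 5, contDiff_pi.1 hw 6]
    · simp only [Set.mem_insert_iff, Set.mem_singleton_iff]
      rintro f (rfl | rfl | rfl | rfl | rfl | rfl | rfl) θ
      exacts [congrFun (h1 θ) 0, congrFun (h1 θ) 1, congrFun (h1 θ) 2, congrFun (h1 θ) 3,
        congrFun (h1 θ) 4, congrFun (h1 θ) 5, congrFun (h1 θ) 6]
    · rw [hgal θ φ ((h2 θ).differentiableAt.hasDerivAt), (h2 θ).deriv, sub_self, map_zero]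
    · rw [hz, inner2_aStar (by fun_prop), hmean hc, h3]
      have := pi_ne_zero
      simp
      field_simp
    · rw [hz, inner2_aStarDot (by fun_prop), hmean hc, h3]
      simp

end Galerkin

/-! ### The remainder after linearization at the bifurcation point. -/

section NonlinearTerm

variable {k : ℕ}

/-- The dependence of the critical exponent on the parameters, to first order. -/
def paramEquiv (a c : ℝ) (ha : a ≠ 0) : (ℝ × ℝ) ≃L[ℝ] (ℝ × ℝ) :=
  LinearEquiv.toContinuousLinearEquiv
    { toFun := fun x => (a * x.1, c * x.1 - x.2)
      invFun := fun x => (a⁻¹ * x.1, c * (a⁻¹ * x.1) - x.2)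
      map_add' := fun x y => by ext <;> simp <;> ring
      map_smul' := fun t x => by ext <;> simp <;> ring
      left_inv := fun x => by ext <;> simp [ha]
      right_inv := fun x => by ext <;> simp [ha] }

theorem paramEquiv_apply (a c : ℝ) (ha : a ≠ 0) (x : ℝ × ℝ) :
    paramEquiv a c ha x = (a * x.1, c * x.1 - x.2) := rfl

namespace Model

/-- The Galerkin vector field without its linear part at the bifurcation point. -/
def nonlin (m : Model k) (lamStar omStar : ℝ) (b : (ℝ × ℝ) ≃L[ℝ] (ℝ × ℝ))
    (x : ((Fin 7 → State k) × (ℝ × ℝ)) × ℝ × ℝ) : Fin 7 → State k :=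
  m.gal (kap (1, 0) + x.1.1) (lamStar + x.1.2.1) (omStar + x.1.2.2) x.2.1 x.2.2
    - linOp (m.L lamStar) omStar x.1.1 - kap (b x.1.2)

variable (m : Model k) (lamStar omStar : ℝ)

theorem contDiff_nonlin (b : (ℝ × ℝ) ≃L[ℝ] (ℝ × ℝ)) :
    ContDiff ℝ ∞ (m.nonlin lamStar omStar b) := by
  have h0 : ContDiff ℝ ∞ fun x : ((Fin 7 → State k) × (ℝ × ℝ)) × ℝ × ℝ =>
      (kap (k := k) (1, 0) + x.1.1, (lamStar + x.1.2.1, omStar + x.1.2.2, x.2.1, x.2.2)) := by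
    fun_prop
  have h1 := m.contDiff_gal.comp h0
  have h2 : ContDiff ℝ ∞ fun x : ((Fin 7 → State k) × (ℝ × ℝ)) × ℝ × ℝ =>
      linOp (m.L lamStar) omStar x.1.1 := by fun_prop
  have h3 : ContDiff ℝ ∞ fun x : ((Fin 7 → State k) × (ℝ × ℝ)) × ℝ × ℝ =>
      kap (k := k) (b x.1.2) := by fun_prop
  exact (h1.sub h2).sub h3

theorem nonlin_periodic (b : (ℝ × ℝ) ≃L[ℝ] (ℝ × ℝ)) (x : (Fin 7 → State k) × (ℝ × ℝ)) (ε : ℝ) :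
    Function.Periodic (fun θ => m.nonlin lamStar omStar b (x, θ, ε)) (2 * π) := fun θ => by
  simp only [nonlin]
  congr 2
  exact m.gal_periodic _ _ _ _ θ

/-- At `ε = 0` only the linear part is left, and `a⋆` lies in its kernel. -/
theorem nonlin_zero (b : (ℝ × ℝ) ≃L[ℝ] (ℝ × ℝ)) (hp : m.p lamStar = 0)
    (hq : m.q lamStar = omStar) (θ : ℝ) : m.nonlin lamStar omStar b (0, θ, 0) = 0 := by
  simp only [nonlin, gal, L, Prod.fst_zero, Prod.snd_zero, add_zero, zero_smul, linOp_kap, hp, hq,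
    map_zero, sub_zero]
  simp only [sub_self, mul_one, mul_zero, zero_mul, add_zero]
  exact map_zero kap

/-- At `ε = 0` the remainder is `kap` of the second-order Taylor remainder of the critical exponent,
plus an operator that vanishes at the origin applied to `w`. `paramEquiv` is chosen to cancel the
first-order dependence on the parameters. -/
theorem hasFDerivAt_nonlin (ha : deriv m.p lamStar ≠ 0) (θ : ℝ) :
    HasFDerivAt (fun x => m.nonlin lamStar omStar
      (paramEquiv (deriv m.p lamStar) (deriv m.q lamStar) ha) (x, θ, 0))
      (0 : (Fin 7 → State k) × (ℝ × ℝ) →L[ℝ] Fin 7 → State k) 0 := by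
  have hd : ∀ f : ℝ → ℝ, ContDiff ℝ ∞ f → HasFDerivAt
      (fun x : (Fin 7 → State k) × (ℝ × ℝ) =>
        f (lamStar + x.2.1) - deriv f lamStar * x.2.1)
      (0 : (Fin 7 → State k) × (ℝ × ℝ) →L[ℝ] ℝ) 0 := by
    intro f hf
    have h1 : HasDerivAt (fun t : ℝ => f (lamStar + t) - deriv f lamStar * t) 0 0 := by
      have h2 : HasDerivAt f (deriv f lamStar) (lamStar + 0) := by
        rw [add_zero]; exact (hf.differentiable (by simp) _).hasDerivAt
      have h3 := (h2.comp_const_add lamStar 0).fun_sub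
        ((hasDerivAt_id (0 : ℝ)).const_mul (deriv f lamStar))
      simpa using h3
    let T : (Fin 7 → State k) × (ℝ × ℝ) →L[ℝ] ℝ :=
      (ContinuousLinearMap.fst ℝ ℝ ℝ).comp (ContinuousLinearMap.snd ℝ _ _)
    have h4 : HasFDerivAt (fun t : ℝ => f (lamStar + t) - deriv f lamStar * t)
        (ContinuousLinearMap.toSpanSingleton ℝ (0 : ℝ)) (T 0) := by
      rw [map_zero]; exact h1.hasFDerivAt
    have h5 := h4.comp (0 : (Fin 7 → State k) × (ℝ × ℝ)) T.hasFDerivAt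
    refine h5.congr_fderiv ?_
    ext <;> simp
  have h1 : HasFDerivAt (fun x : (Fin 7 → State k) × (ℝ × ℝ) => kap (k := k)
      ((m.p (lamStar + x.2.1) - deriv m.p lamStar * x.2.1,
        m.q (lamStar + x.2.1) - deriv m.q lamStar * x.2.1 - omStar)))
      (0 : (Fin 7 → State k) × (ℝ × ℝ) →L[ℝ] Fin 7 → State k) 0 := by
    have h2 := (kap (k := k)).hasFDerivAt.comp (0 : (Fin 7 → State k) × (ℝ × ℝ))
      ((hd m.p m.smooth_p).prodMk ((hd m.q m.smooth_q).sub_const omStar))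
    exact h2.congr_fderiv (ContinuousLinearMap.ext fun _ => map_zero kap)
  have h2 : HasFDerivAt (fun x : (Fin 7 → State k) × (ℝ × ℝ) =>
      (linOp (m.L (lamStar + x.2.1)) (omStar + x.2.2) - linOp (m.L lamStar) omStar) x.1)
      (0 : (Fin 7 → State k) × (ℝ × ℝ) →L[ℝ] Fin 7 → State k) 0 := by
    have h3 : ContDiff ℝ ∞ fun x : (Fin 7 → State k) × (ℝ × ℝ) =>
        linOp (m.L (lamStar + x.2.1)) (omStar + x.2.2) - linOp (m.L lamStar) omStar :=
      (contDiff_linOp (m.contDiff_L.comp (by fun_prop)) (by fun_prop)).sub contDiff_const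
    have h4 := ((h3.differentiable (by simp) 0).hasFDerivAt).clm_apply
      (hasFDerivAt_fst (𝕜 := ℝ) (p := (0 : (Fin 7 → State k) × (ℝ × ℝ))))
    refine h4.congr_fderiv ?_
    simp
  have h3 := h1.add h2
  rw [add_zero] at h3
  refine h3.congr_of_eventuallyEq (.of_forall fun x => ?_)
  simp only [nonlin, gal, zero_smul, add_zero, map_add, Pi.add_apply, L, linOp_kap, sub_apply,
    paramEquiv_apply]
  have h4 : kap (k := k) (m.p (lamStar + x.2.1) * 1 - (m.q (lamStar + x.2.1) - (omStar + x.2.2)) * 0,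
      (m.q (lamStar + x.2.1) - (omStar + x.2.2)) * 1 + m.p (lamStar + x.2.1) * 0)
      = kap (m.p (lamStar + x.2.1) - deriv m.p lamStar * x.2.1,
        m.q (lamStar + x.2.1) - deriv m.q lamStar * x.2.1 - omStar)
      + kap (deriv m.p lamStar * x.2.1, deriv m.q lamStar * x.2.1 - x.2.2) := by
    rw [← map_add]
    congr 1
    ext <;> simp <;> ring
  rw [h4]
  abel

end Model

end NonlinearTerm

/-! ### Expansions along the unit circle. -/

section Expansion

variable {k : ℕ}

theorem exists_first_order {F : Type} [NormedAddCommGroup F] [NormedSpace ℝ F] [CompleteSpace F]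
    {f : ℝ → F} (hf : ContDiff ℝ ∞ f) :
    ∃ r : ℝ → F, ContDiff ℝ ∞ r ∧ (∀ t, f t = f 0 + t • r t) ∧ r 0 = deriv f 0 := by
  obtain ⟨M, hM, h1, h2, -⟩ := exists_hadamard (E := ℝ) (Q := ℝ) (f := fun p => f p.1)
    (hf.comp contDiff_fst)
  refine ⟨fun t => M (t, 0) 1, ?_, fun t => ?_, ?_⟩
  · exact (hM.comp (contDiff_id.prodMk contDiff_const)).clm_apply contDiff_const
  · have := h1 t 0
    simp only at this
    rw [this, ← map_smul]; simp
  · show M (0, 0) 1 = deriv f 0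
    rw [h2]; rfl

set_option maxHeartbeats 2000000 in
/-- The expansion of the vector field along `z₀ + ε z₁ + ε² z₂`, `λ = λ⋆ + ε² λ₂`. -/
theorem Model.g_expansion (m : Model k) (lamStar lam₂ θ : ℝ) (z₀ z₁ z₂ : State k) :
    ∃ R : ℝ → State k, Continuous R ∧ ∀ ε : ℝ,
      m.g (z₀ + ε • z₁ + ε ^ 2 • z₂) (lamStar + ε ^ 2 * lam₂) θ ε = m.L lamStar z₀
        + ε • (m.L lamStar z₁ + m.M (0, (θ, lamStar)) z₀ z₀)
        + ε ^ 2 • (m.L lamStar z₂ + lam₂ • deriv m.L lamStar z₀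
          + (m.M (0, (θ, lamStar)) z₀ z₁ + m.M (0, (θ, lamStar)) z₁ z₀)
          + m.M₃ (0, (θ, lamStar)) z₀ z₀ z₀)
        + ε ^ 3 • R ε := by
  obtain ⟨l, hl, hL, hl0⟩ := exists_first_order (f := fun t => m.L (lamStar + t))
    (m.contDiff_L.comp (by fun_prop))
  obtain ⟨s, hs, hls, -⟩ := exists_first_order hl
  obtain ⟨r, hr, hM, -⟩ := exists_first_order (f := fun t => m.M (0, (θ, lamStar + t)))
    (m.smooth_M.comp (by fun_prop))
  obtain ⟨n, hn, hN, -⟩ := exists_first_order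
    (f := fun ε : ℝ => m.M₃ (ε • (z₀ + ε • z₁ + ε ^ 2 • z₂), (θ, lamStar + ε ^ 2 * lam₂)))
    (m.smooth_M₃.comp (by fun_prop))
  have hl0' : l 0 = deriv m.L lamStar := by
    rw [hl0, deriv_comp_const_add, add_zero]
  have hlc := hl.continuous
  have hsc := hs.continuous
  have hrc := hr.continuous
  have hnc := hn.continuous
  -- All the terms of order at least three, divided by `ε ^ 3`.
  refine ⟨fun ε => lam₂ • deriv m.L lamStar (z₁ + ε • z₂)
    + (ε * lam₂ ^ 2) • s (ε ^ 2 * lam₂) (z₀ + ε • z₁ + ε ^ 2 • z₂)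
    + lam₂ • r (ε ^ 2 * lam₂) (z₀ + ε • z₁ + ε ^ 2 • z₂) (z₀ + ε • z₁ + ε ^ 2 • z₂)
    + (m.M (0, (θ, lamStar)) z₀ z₂ + m.M (0, (θ, lamStar)) z₂ z₀
      + m.M (0, (θ, lamStar)) (z₁ + ε • z₂) (z₁ + ε • z₂))
    + (m.M₃ (0, (θ, lamStar)) (z₁ + ε • z₂) (z₀ + ε • z₁ + ε ^ 2 • z₂) (z₀ + ε • z₁ + ε ^ 2 • z₂)
      + m.M₃ (0, (θ, lamStar)) z₀ (z₁ + ε • z₂) (z₀ + ε • z₁ + ε ^ 2 • z₂)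
      + m.M₃ (0, (θ, lamStar)) z₀ z₀ (z₁ + ε • z₂))
    + n ε (z₀ + ε • z₁ + ε ^ 2 • z₂) (z₀ + ε • z₁ + ε ^ 2 • z₂) (z₀ + ε • z₁ + ε ^ 2 • z₂),
    by fun_prop, fun ε => ?_⟩
  have hL' : m.L (lamStar + ε ^ 2 * lam₂) = m.L lamStar + (ε ^ 2 * lam₂) • deriv m.L lamStar
      + (ε ^ 2 * lam₂) ^ 2 • s (ε ^ 2 * lam₂) := by
    rw [hL, hls, hl0', add_zero]; module
  have hM' := hM (ε ^ 2 * lam₂)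
  have hN' := hN ε
  simp only [add_zero, zero_smul, ne_eq, OfNat.ofNat_ne_zero, not_false_eq_true, zero_pow,
    zero_mul] at hM' hN'
  rw [Model.g, m.M_eq, hL', hM', hN']
  simp only [map_add, map_smul, add_apply, smul_apply, smul_add, smul_smul]
  module

/-- The unit vectors of the critical plane. -/
def e₁ : State k := Sum.elim ![1, 0] 0

def e₂ : State k := Sum.elim ![0, 1] 0

theorem aStar_eq_unit (φ : ℝ) : aStar (k := k) φ = cos φ • e₁ + sin φ • e₂ := by
  refine state_ext ?_ ?_ fun i => ?_ <;> simp [aStar, e₁, e₂]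

/-- The Fourier coefficients of a quadratic form on the unit circle. -/
def quadCoef (B : State k →L[ℝ] State k →L[ℝ] State k) : Fin 7 → State k :=
  ![(1 / 2 : ℝ) • (B e₁ e₁ + B e₂ e₂), 0, 0, (1 / 2 : ℝ) • (B e₁ e₁ - B e₂ e₂),
    (1 / 2 : ℝ) • (B e₁ e₂ + B e₂ e₁), 0, 0]

theorem trig_quadCoef (B : State k →L[ℝ] State k →L[ℝ] State k) (φ : ℝ) :
    trig φ (quadCoef B) = B (aStar φ) (aStar φ) := by
  rw [aStar_eq_unit, trig_apply', quadCoef]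
  simp
  rw [cos_two_mul, sin_two_mul]
  have h := sin_sq_add_cos_sq φ
  match_scalars <;> first
    | ring1
    | linear_combination (-(1 / 2 : ℝ)) * h
    | linear_combination (-1 : ℝ) * h

/-- The Fourier coefficients of the third order terms on the unit circle. -/
def cubicCoef (B : State k →L[ℝ] State k →L[ℝ] State k)
    (D : State k →L[ℝ] State k →L[ℝ] State k →L[ℝ] State k) (u : Fin 7 → State k) :
    Fin 7 → State k :=
  let T := B + B.flip
  let D₁ := D e₁ e₁ e₂ + D e₁ e₂ e₁ + D e₂ e₁ e₁
  let D₂ := D e₁ e₂ e₂ + D e₂ e₁ e₂ + D e₂ e₂ e₁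
  ![0,
    T e₁ (u 0) + (1 / 2 : ℝ) • (T e₁ (u 3) + T e₂ (u 4))
      + ((3 / 4 : ℝ) • D e₁ e₁ e₁ + (1 / 4 : ℝ) • D₂),
    T e₂ (u 0) + (1 / 2 : ℝ) • (T e₁ (u 4) - T e₂ (u 3))
      + ((1 / 4 : ℝ) • D₁ + (3 / 4 : ℝ) • D e₂ e₂ e₂),
    0, 0,
    (1 / 2 : ℝ) • (T e₁ (u 3) - T e₂ (u 4)) + ((1 / 4 : ℝ) • D e₁ e₁ e₁ - (1 / 4 : ℝ) • D₂),
    (1 / 2 : ℝ) • (T e₂ (u 3) + T e₁ (u 4)) + ((1 / 4 : ℝ) • D₁ - (1 / 4 : ℝ) • D e₂ e₂ e₂)]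

/-- By `hu` only the modes `0` and `2` of `u` are present, so products with `a⋆` have modes `1` and
`3`: degree three suffices and the truncation loses nothing. -/
theorem trig_cubicCoef (B : State k →L[ℝ] State k →L[ℝ] State k)
    (D : State k →L[ℝ] State k →L[ℝ] State k →L[ℝ] State k) (u : Fin 7 → State k)
    (hu : parity u = -u) (φ : ℝ) :
    trig φ (cubicCoef B D u) = B (aStar φ) (trig φ u) + B (trig φ u) (aStar φ)
      + D (aStar φ) (aStar φ) (aStar φ) := by
  have h0 : ∀ x : State k, x = -x → x = 0 := fun x h => self_eq_neg.1 h
  rw [parity_apply] at hu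
  have h1 : u 1 = 0 := h0 _ (congrFun hu 1)
  have h2 : u 2 = 0 := h0 _ (congrFun hu 2)
  have h5 : u 5 = 0 := h0 _ (congrFun hu 5)
  have h6 : u 6 = 0 := h0 _ (congrFun hu 6)
  rw [aStar_eq_unit, trig_apply', trig_apply', cubicCoef, h1, h2, h5, h6]
  simp
  rw [cos_two_mul, sin_two_mul, cos_three_mul, sin_three_mul]
  have h : sin φ ^ 2 = 1 - cos φ ^ 2 := by linarith [sin_sq_add_cos_sq φ]
  have h' : sin φ ^ 3 = (1 - cos φ ^ 2) * sin φ := by rw [← h]; ring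
  match_scalars <;> ring_nf <;> (try rw [h']) <;> (try rw [h]) <;> ring

end Expansion

/-! ### The formal solution to second order. -/

section Formal

/-- Bootstrap: the equation makes `w'` as smooth as `w`. -/
theorem IsPerSol.contDiff {W K : Type} [NormedAddCommGroup W] [NormedSpace ℝ W]
    [FiniteDimensional ℝ W] [NormedAddCommGroup K] [NormedSpace ℝ K] [FiniteDimensional ℝ K] {A : W →L[ℝ] W} {κ : K →L[ℝ] W} {ℓ : W →L[ℝ] K}
    {f w : ℝ → W} {q : K} (h : IsPerSol A κ ℓ f w q) (hf : ContDiff ℝ ∞ f) : ContDiff ℝ ∞ w := by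
  rw [contDiff_infty]
  intro n
  induction n with
  | zero => exact contDiff_zero.2 h.continuous
  | succ n ih =>
    rw [Nat.cast_succ, contDiff_succ_iff_deriv]
    refine ⟨fun t => (h.hasDerivAt t).differentiableAt, by simp, ?_⟩
    rw [show deriv w = fun t => A (w t) + κ q + f t from funext fun t => (h.hasDerivAt t).deriv]
    exact ((A.contDiff.comp ih).add contDiff_const).add (hf.of_le (by exact_mod_cast le_top))

variable {k : ℕ}

theorem parity_quadCoef (B : State k →L[ℝ] State k →L[ℝ] State k) :
    parity (quadCoef B) = -quadCoef B := by
  rw [parity_apply, quadCoef]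
  funext j
  fin_cases j <;> simp

theorem parity_cubicCoef (B : State k →L[ℝ] State k →L[ℝ] State k)
    (D : State k →L[ℝ] State k →L[ℝ] State k →L[ℝ] State k) (u : Fin 7 → State k) :
    parity (cubicCoef B D u) = cubicCoef B D u := by
  rw [parity_apply, cubicCoef]
  funext j
  fin_cases j <;> simp

namespace Model

variable (m : Model k) (lam : ℝ)

/-- The second order terms along the unit circle. -/
def quad (θ : ℝ) : Fin 7 → State k := quadCoef (m.M (0, (θ, lam)))

/-- The third order terms along the unit circle with second order correction `u`. -/
def cubic (u : Fin 7 → State k) (θ : ℝ) : Fin 7 → State k :=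
  cubicCoef (m.M (0, (θ, lam))) (m.M₃ (0, (θ, lam))) u

theorem contDiff_quad : ContDiff ℝ ∞ (m.quad lam) := by
  have h : ContDiff ℝ ∞ fun θ => m.M (0, (θ, lam)) := m.smooth_M.comp (by fun_prop)
  have hB : ∀ x y, ContDiff ℝ ∞ fun θ => m.M (0, (θ, lam)) x y := fun x y =>
    (h.clm_apply contDiff_const).clm_apply contDiff_const
  refine contDiff_pi.2 fun j => ?_
  have h1 := hB e₁ e₁
  have h2 := hB e₁ e₂
  have h3 := hB e₂ e₁
  have h4 := hB e₂ e₂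
  fin_cases j <;> simp [quad, quadCoef] <;> fun_prop

theorem contDiff_cubic {u : ℝ → Fin 7 → State k} (hu : ContDiff ℝ ∞ u) :
    ContDiff ℝ ∞ fun θ => m.cubic lam (u θ) θ := by
  have h : ContDiff ℝ ∞ fun θ => m.M (0, (θ, lam)) := m.smooth_M.comp (by fun_prop)
  have h' : ContDiff ℝ ∞ fun θ => m.M₃ (0, (θ, lam)) := m.smooth_M₃.comp (by fun_prop)
  have hD : ∀ x y z, ContDiff ℝ ∞ fun θ => m.M₃ (0, (θ, lam)) x y z := fun x y z =>
    ((h'.clm_apply contDiff_const).clm_apply contDiff_const).clm_apply contDiff_const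
  have hB : ∀ x j, ContDiff ℝ ∞ fun θ => m.M (0, (θ, lam)) x (u θ j) := fun x j =>
    (h.clm_apply contDiff_const).clm_apply (contDiff_pi.1 hu j)
  have hB' : ∀ x j, ContDiff ℝ ∞ fun θ => m.M (0, (θ, lam)) (u θ j) x := fun x j =>
    (h.clm_apply (contDiff_pi.1 hu j)).clm_apply contDiff_const
  have hT : ∀ x j, ContDiff ℝ ∞ fun θ => (m.M (0, (θ, lam)) + (m.M (0, (θ, lam))).flip) x (u θ j) :=
    fun x j => (hB x j).add (hB' x j)
  refine contDiff_pi.2 fun j => ?_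
  have c : ∀ a : ℝ, ContDiff ℝ ∞ fun _ : ℝ => a := fun a => contDiff_const
  fin_cases j
  · exact contDiff_const
  · exact ((hT _ _).add ((c _).smul ((hT _ _).add (hT _ _)))).add
      (((c _).smul (hD _ _ _)).add ((c _).smul (((hD _ _ _).add (hD _ _ _)).add (hD _ _ _))))
  · exact ((hT _ _).add ((c _).smul ((hT _ _).sub (hT _ _)))).add
      (((c _).smul (((hD _ _ _).add (hD _ _ _)).add (hD _ _ _))).add ((c _).smul (hD _ _ _)))
  · exact contDiff_const
  · exact contDiff_const
  · exact ((c _).smul ((hT _ _).sub (hT _ _))).add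
      (((c _).smul (hD _ _ _)).sub ((c _).smul (((hD _ _ _).add (hD _ _ _)).add (hD _ _ _))))
  · exact ((c _).smul ((hT _ _).add (hT _ _))).add
      (((c _).smul (((hD _ _ _).add (hD _ _ _)).add (hD _ _ _))).sub ((c _).smul (hD _ _ _)))

/-- The leading terms of the solution of the Galerkin equations. -/
structure Formal (m : Model k) (lam om : ℝ) where
  w₁ : ℝ → Fin 7 → State k
  w₂ : ℝ → Fin 7 → State k
  β : ℝ × ℝ
  smooth₁ : ContDiff ℝ ∞ w₁
  smooth₂ : ContDiff ℝ ∞ w₂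
  parity₁ : ∀ θ, parity (w₁ θ) = -w₁ θ
  parity₂ : ∀ θ, parity (w₂ θ) = w₂ θ
  sol₁ : IsPerSol (linOp (m.L lam) om) kap ell (m.quad lam) w₁ 0
  sol₂ : IsPerSol (linOp (m.L lam) om) kap ell (fun θ => m.cubic lam (w₁ θ) θ) w₂ (-β)

/-- `1 + parity` annihilates the quadratic forcing, so by uniqueness it annihilates `w₁` and the
parameter `q` is zero. `1 - parity` annihilates the cubic forcing, hence also `w₂`. What remains of
solvability is the parameter of the second problem, which defines `β`. -/
theorem exists_formal {om : ℝ} (hA : IsNonresonant (linOp (m.L lam) om) kap ell) :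
    Nonempty (m.Formal lam om) := by
  obtain ⟨_, _, h⟩ := exists_isPerSol hA
  obtain ⟨w₁, q, h₁, -⟩ := h (m.quad lam) (m.contDiff_quad lam).continuous fun θ => by
    simp only [quad, m.periodic_M]
  have s₁ := h₁.contDiff (m.contDiff_quad lam)
  have p₁ := h₁.map (T := 1 + parity) (U := (2 : ℝ) • 1) (fun x => by simp [parity_linOp])
    (fun q => by simp [parity_kap, two_smul]) fun x => by simp [ell_parity, two_smul]
  simp only [add_apply, one_apply_eq_self, quad, parity_quadCoef, add_neg_cancel] at p₁
  obtain ⟨hq, hp⟩ := p₁.eq_zero hA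
  have hq0 : q = 0 := by simpa using hq
  rw [hq0] at h₁
  obtain ⟨w₂, β, h₂, -⟩ := h (fun θ => m.cubic lam (w₁ θ) θ)
    (m.contDiff_cubic lam s₁).continuous fun θ => by
      simp only [cubic, m.periodic_M, m.periodic_M₃, h₁.periodic θ]
  have s₂ := h₂.contDiff (m.contDiff_cubic lam s₁)
  have p₂ := h₂.map (T := 1 - parity) (U := 0) (fun x => by simp [parity_linOp])
    (fun q => by simp [parity_kap]) fun x => by simp [ell_parity]
  simp only [sub_apply, one_apply_eq_self, cubic, parity_cubicCoef, sub_self] at p₂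
  obtain ⟨-, hp'⟩ := p₂.eq_zero hA
  exact ⟨⟨w₁, w₂, -β, s₁, s₂, fun θ => eq_neg_of_add_eq_zero_right (hp θ),
    fun θ => (sub_eq_zero.1 (hp' θ)).symm, h₁, by rwa [neg_neg]⟩⟩

end Model

end Formal

/-! ### The residual of the formal solution. -/

section Residual

variable {k : ℕ}

theorem dphi_kap (x : ℝ × ℝ) : dphi (kap (k := k) x) = kap (-x.2, x.1) := by
  rw [dphi_apply, kap_apply, kap_apply]
  funext j
  fin_cases j <;> refine state_ext ?_ ?_ fun i => ?_ <;> simp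

namespace Model

variable {m : Model k} {lam om : ℝ}

theorem L_trig_kap (m : Model k) (lam φ : ℝ) :
    m.L lam (aStar φ) = trig φ (kap (m.p lam, m.q lam)) := by
  have h := trig_linOp (m.L lam) 0 φ (kap (1, 0))
  rw [zero_smul, sub_zero, L, linOp_kap] at h
  rw [aStar_eq, L, ← h]
  simp

theorem deriv_L_aStar (m : Model k) (lam φ : ℝ) :
    deriv m.L lam (aStar φ) = trig φ (kap (deriv m.p lam, deriv m.q lam)) := by
  have h1 : HasDerivAt (fun s => m.L s (aStar φ)) (deriv m.L lam (aStar φ)) lam := by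
    have := (m.contDiff_L.differentiable (by simp) lam).hasDerivAt.clm_apply
      (hasDerivAt_const lam (aStar (k := k) φ))
    simpa using this
  have h2 : HasDerivAt (fun s => m.L s (aStar φ))
      (trig φ (kap (deriv m.p lam, deriv m.q lam))) lam := by
    simp only [L_trig_kap]
    have h3 := ((m.smooth_p.differentiable (by simp) lam).hasDerivAt).prodMk
      ((m.smooth_q.differentiable (by simp) lam).hasDerivAt)
    exact ((trig (V := State k) φ).comp kap).hasFDerivAt.comp_hasDerivAt lam h3
  exact h1.unique h2

/-- `M` depends on `z` only through `ε z` and is then applied twice to `z`, so a sign change of `z`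
can be traded for one of `ε`. -/
theorem g_neg (m : Model k) (z : State k) (lam θ ε : ℝ) :
    m.g (-z) lam θ ε = -m.g z lam θ (-ε) := by
  simp only [g, map_neg, smul_neg, neg_apply, neg_neg, neg_smul]
  abel

namespace Formal

/-- The two leading terms of the expansion. -/
def approx (s : m.Formal lam om) (ε θ : ℝ) : Fin 7 → State k := ε • s.w₁ θ + ε ^ 2 • s.w₂ θ

def approxDeriv (s : m.Formal lam om) (ε θ : ℝ) : Fin 7 → State k :=
  ε • deriv s.w₁ θ + ε ^ 2 • deriv s.w₂ θ

/-- The residual of the approximation on the torus. -/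
def torusResidual (s : m.Formal lam om) (x : ℝ × ℝ) (y : (ℝ × ℝ) × ℝ) : State k :=
  m.g (trig y.1.2 (kap (1, 0) + s.approx y.2 y.1.1)) (lam + y.2 ^ 2 * x.1) y.1.1 y.2
    - (om + y.2 ^ 2 * x.2) • trig y.1.2 (dphi (kap (1, 0) + s.approx y.2 y.1.1))
    - trig y.1.2 (s.approxDeriv y.2 y.1.1)

variable (s : m.Formal lam om)

theorem hasDerivAt₁ (θ : ℝ) : HasDerivAt s.w₁ (deriv s.w₁ θ) θ :=
  (s.smooth₁.differentiable (by simp) θ).hasDerivAt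

theorem hasDerivAt₂ (θ : ℝ) : HasDerivAt s.w₂ (deriv s.w₂ θ) θ :=
  (s.smooth₂.differentiable (by simp) θ).hasDerivAt

theorem hasDerivAt_approx (ε θ : ℝ) : HasDerivAt (s.approx ε) (s.approxDeriv ε θ) θ :=
  ((s.hasDerivAt₁ θ).const_smul ε).add ((s.hasDerivAt₂ θ).const_smul (ε ^ 2))

theorem parity_deriv₁ (θ : ℝ) : parity (deriv s.w₁ θ) = -deriv s.w₁ θ := by
  have h := parity.hasFDerivAt.comp_hasDerivAt θ (s.hasDerivAt₁ θ)
  rw [show (parity ∘ s.w₁ : ℝ → Fin 7 → State k) = fun θ => -s.w₁ θ from funext s.parity₁] at h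
  exact h.unique (s.hasDerivAt₁ θ).neg

theorem parity_deriv₂ (θ : ℝ) : parity (deriv s.w₂ θ) = deriv s.w₂ θ := by
  have h := parity.hasFDerivAt.comp_hasDerivAt θ (s.hasDerivAt₂ θ)
  rw [show (parity ∘ s.w₂ : ℝ → Fin 7 → State k) = s.w₂ from funext s.parity₂] at h
  exact h.unique (s.hasDerivAt₂ θ)

theorem parity_approx (ε θ : ℝ) : parity (s.approx ε θ) = s.approx (-ε) θ := by
  rw [approx, approx, map_add, map_smul, map_smul, s.parity₁, s.parity₂]; simp

theorem parity_approxDeriv (ε θ : ℝ) : parity (s.approxDeriv ε θ) = s.approxDeriv (-ε) θ := by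
  rw [approxDeriv, approxDeriv, map_add, map_smul, map_smul, s.parity_deriv₁, s.parity_deriv₂]
  simp

theorem parity_dphi (u : Fin 7 → State k) : parity (dphi u) = dphi (parity u) := by
  rw [parity_apply, dphi_apply, dphi_apply, parity_apply]
  funext j
  fin_cases j <;> simp

/-- The symmetry `z ↦ -z(θ, φ + π)`, `ε ↦ -ε` of the equation; the parities of `w₁` and `w₂` make
the approximation invariant under it. -/
theorem torusResidual_neg (x : ℝ × ℝ) (θ φ ε : ℝ) :
    s.torusResidual x ((θ, φ), -ε) = -s.torusResidual x ((θ, φ + π), ε) := by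
  simp only [torusResidual, trig_add_pi, map_add, parity_kap, parity_approx, parity_approxDeriv,
    parity_dphi, neg_sq]
  rw [← neg_add, g_neg]
  module

theorem deriv₁_eq (θ : ℝ) : deriv s.w₁ θ = linOp (m.L lam) om (s.w₁ θ) + m.quad lam θ := by
  rw [(s.sol₁.hasDerivAt θ).deriv, map_zero, add_zero]

theorem deriv₂_eq (θ : ℝ) : deriv s.w₂ θ
    = linOp (m.L lam) om (s.w₂ θ) - kap s.β + m.cubic lam (s.w₁ θ) θ := by
  rw [(s.sol₂.hasDerivAt θ).deriv, map_neg, sub_eq_add_neg]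

/-- Order zero cancels because `a⋆` lies in the kernel, order one by the equation of `w₁`, and order
two by that of `w₂`, where `hx` balances `β` against the parameter shift. -/
theorem torusResidual_isBigO (hp : m.p lam = 0) (hq : m.q lam = om) {x : ℝ × ℝ}
    (hx : s.β + x.1 • (deriv m.p lam, deriv m.q lam) - x.2 • (0, 1) = 0) (y : ℝ × ℝ) :
    (fun ε : ℝ => s.torusResidual x (y, ε)) =O[nhdsWithin 0 {0}ᶜ] fun ε : ℝ => ε ^ 3 := by
  obtain ⟨θ, φ⟩ := y
  obtain ⟨R, hR, h⟩ := m.g_expansion lam x.1 θ (aStar φ) (trig φ (s.w₁ θ)) (trig φ (s.w₂ θ))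
  have h0 : m.L lam (aStar φ) = om • trig φ (dphi (kap (1, 0))) := by
    rw [L_trig_kap, hp, hq, dphi_kap, ← map_smul, ← map_smul]; simp
  have h1 : trig φ (deriv s.w₁ θ) = m.L lam (trig φ (s.w₁ θ)) - om • trig φ (dphi (s.w₁ θ))
      + m.M (0, (θ, lam)) (aStar φ) (aStar φ) := by
    rw [deriv₁_eq, map_add, trig_linOp, quad, trig_quadCoef]
  have h2 : trig φ (deriv s.w₂ θ) = m.L lam (trig φ (s.w₂ θ)) - om • trig φ (dphi (s.w₂ θ))
      - trig φ (kap s.β) + (m.M (0, (θ, lam)) (aStar φ) (trig φ (s.w₁ θ))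
        + m.M (0, (θ, lam)) (trig φ (s.w₁ θ)) (aStar φ)
        + m.M₃ (0, (θ, lam)) (aStar φ) (aStar φ) (aStar φ)) := by
    rw [deriv₂_eq, map_add, map_sub, trig_linOp, cubic, trig_cubicCoef _ _ _ (s.parity₁ θ)]
  have h3 : trig φ (kap (k := k) s.β) + x.1 • deriv m.L lam (aStar φ)
      - x.2 • trig φ (dphi (kap (1, 0))) = 0 := by
    rw [deriv_L_aStar, dphi_kap, ← map_smul, ← map_smul, ← map_smul, ← map_smul, ← map_add,
      ← map_add, ← map_sub, ← map_sub]
    simp only [neg_zero]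
    rw [hx, map_zero, map_zero]
  have h4 : (fun ε : ℝ => s.torusResidual x ((θ, φ), ε)) = fun ε : ℝ => ε ^ 3 •
      (R ε - x.2 • trig φ (dphi (s.w₁ θ)) - (ε * x.2) • trig φ (dphi (s.w₂ θ))) := by
    funext ε
    have h5 : trig φ (kap (1, 0) + s.approx ε θ)
        = aStar φ + ε • trig φ (s.w₁ θ) + ε ^ 2 • trig φ (s.w₂ θ) := by
      rw [approx, aStar_eq]; simp only [map_add, map_smul]; abel
    rw [torusResidual, h5, h, h0, approx, approxDeriv]
    simp only [map_add, map_smul, h1, h2]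
    have h6 := congrArg (fun v => ε ^ 2 • v) h3
    simp only [smul_zero] at h6
    rw [← sub_eq_zero, ← h6]
    module
  rw [h4]
  have h5 : Continuous fun ε : ℝ => R ε - x.2 • trig φ (dphi (s.w₁ θ))
      - (ε * x.2) • trig φ (dphi (s.w₂ θ)) := by fun_prop
  have h6 := ((h5.tendsto 0).mono_left (nhdsWithin_le_nhds (s := {0}ᶜ))).isBigO_one ℝ
  have h7 := (Asymptotics.isBigO_refl (fun ε : ℝ => ε ^ 3) (nhdsWithin 0 {0}ᶜ)).smul h6
  simpa using h7

theorem contDiff_deriv {w : ℝ → Fin 7 → State k} (hw : ContDiff ℝ ∞ w) : ContDiff ℝ ∞ (deriv w) :=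
  (contDiff_infty_iff_deriv.1 hw).2

theorem contDiff_torusResidual (x : ℝ × ℝ) : ContDiff ℝ ∞ (s.torusResidual x) := by
  have e : ContDiff ℝ ∞ fun y : (ℝ × ℝ) × ℝ => y.2 := by fun_prop
  have t : ContDiff ℝ ∞ fun y : (ℝ × ℝ) × ℝ => y.1.1 := by fun_prop
  have ph : ContDiff ℝ ∞ fun y : (ℝ × ℝ) × ℝ => y.1.2 := by fun_prop
  have h1 : ContDiff ℝ ∞ fun y : (ℝ × ℝ) × ℝ => kap (1, 0) + s.approx y.2 y.1.1 :=
    contDiff_const.add ((e.smul (s.smooth₁.comp t)).add ((e.pow 2).smul (s.smooth₂.comp t)))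
  have h2 : ContDiff ℝ ∞ fun y : (ℝ × ℝ) × ℝ => s.approxDeriv y.2 y.1.1 :=
    (e.smul ((contDiff_deriv s.smooth₁).comp t)).add
      ((e.pow 2).smul ((contDiff_deriv s.smooth₂).comp t))
  have h3 := contDiff_trig_comp ph h1
  have h4 := contDiff_trig_comp ph h2
  have h5 := contDiff_trig_comp ph (dphi.contDiff.comp h1)
  have l : ContDiff ℝ ∞ fun y : (ℝ × ℝ) × ℝ => lam + y.2 ^ 2 * x.1 := by fun_prop
  have o : ContDiff ℝ ∞ fun y : (ℝ × ℝ) × ℝ => om + y.2 ^ 2 * x.2 := by fun_prop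
  have h6 := (m.contDiff_L.comp l).clm_apply h3
  have h7 := ((m.smooth_M.comp ((e.smul h3).prodMk (t.prodMk l))).clm_apply h3).clm_apply h3
  exact ((h6.add (e.smul h7)).sub (o.smul h5)).sub h4

/-- The residual of the approximation in the Galerkin equations. -/
def residual (x : ℝ × ℝ) (ε θ : ℝ) : Fin 7 → State k :=
  m.gal (kap (1, 0) + s.approx ε θ) (lam + ε ^ 2 * x.1) (om + ε ^ 2 * x.2) θ ε
    - s.approxDeriv ε θ

theorem coef_torusResidual (x : ℝ × ℝ) (ε θ : ℝ) :
    coef (fun φ => s.torusResidual x ((θ, φ), ε)) = s.residual x ε θ := by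
  have h1 := continuous_trig (kap (1, 0) + s.approx ε θ)
  have h2 : ∀ φ, s.torusResidual x ((θ, φ), ε)
      = m.g (trig φ (kap (1, 0) + s.approx ε θ)) (lam + ε ^ 2 * x.1) θ ε
        + trig φ (-((om + ε ^ 2 * x.2) • dphi (kap (1, 0) + s.approx ε θ) + s.approxDeriv ε θ)) := by
    intro φ
    simp only [torusResidual, map_neg, map_add, map_smul]; abel
  have hM := m.smooth_M.continuous
  have hg : Continuous fun φ => m.g (trig φ (kap (1, 0) + s.approx ε θ)) (lam + ε ^ 2 * x.1) θ ε := by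
    simp only [g]
    fun_prop
  simp only [h2]
  rw [coef_add hg (continuous_trig _), coef_trig, m.coef_g _ _ (om + ε ^ 2 * x.2), residual]
  abel

theorem periodic_approx (ε : ℝ) : Function.Periodic (s.approx ε) (2 * π) := fun θ => by
  rw [approx, s.sol₁.periodic, s.sol₂.periodic, approx]

theorem periodic_approxDeriv (ε : ℝ) : Function.Periodic (s.approxDeriv ε) (2 * π) := fun θ => by
  have h : ∀ w : ℝ → Fin 7 → State k, Function.Periodic w (2 * π) →
      deriv w (θ + 2 * π) = deriv w θ := fun w hw => by
    rw [← deriv_comp_add_const w (2 * π) θ, funext hw]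
  rw [approxDeriv, h _ s.sol₁.periodic, h _ s.sol₂.periodic, approxDeriv]

theorem periodic_residual (x : ℝ × ℝ) (ε : ℝ) :
    Function.Periodic (s.residual x ε) (2 * π) := fun θ => by
  simp only [residual, s.periodic_approx ε θ, s.periodic_approxDeriv ε θ]
  congr 1
  exact m.gal_periodic _ _ _ _ θ

theorem parity_residual (x : ℝ × ℝ) (ε θ : ℝ) :
    parity (s.residual x ε θ) = s.residual x (-ε) θ := by
  rw [← coef_torusResidual, ← coef_torusResidual, ← coef_neg_add_pi]
  · simp only [torusResidual_neg]
  · intro φ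
    have h := s.torusResidual_neg x θ φ ε
    have h' := s.torusResidual_neg x θ (φ + π) ε
    have h'' := s.torusResidual_neg x θ (φ + π) (-ε)
    rw [neg_neg] at h''
    have h3 := s.torusResidual_neg x θ φ (-ε)
    rw [neg_neg] at h3
    simp only [show φ + 2 * π = φ + π + π by ring, h3, h', neg_neg]

/-- The residual is `ε³ c(θ, ε)` with `c` smooth. Parity reverses the sign of `ε`, so the
symmetrized residual is `ε³ (c(θ, ε) - c(θ, -ε))`, one order smaller. -/
theorem exists_residual_bound (hp : m.p lam = 0) (hq : m.q lam = om) {x : ℝ × ℝ}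
    (hx : s.β + x.1 • (deriv m.p lam, deriv m.q lam) - x.2 • (0, 1) = 0) :
    ∃ C ≥ (0 : ℝ), ∀ ε θ : ℝ, |ε| ≤ 1 → ‖s.residual x ε θ‖ ≤ C * |ε| ^ 3 ∧
      ‖s.residual x ε θ + parity (s.residual x ε θ)‖ ≤ C * |ε| ^ 4 := by
  obtain ⟨r, hr, h⟩ := exists_eq_pow_smul 3 (s.contDiff_torusResidual x)
    (s.torusResidual_isBigO hp hq hx)
  let c : ℝ × ℝ → Fin 7 → State k := fun y => coef fun φ => r ((y.1, φ), y.2)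
  have hc : ContDiff ℝ ∞ c := contDiff_coef (E := ℝ × ℝ)
    (g := fun y : (ℝ × ℝ) × ℝ => r ((y.1.1, y.2), y.1.2)) (hr.comp (by fun_prop))
  have hres : ∀ ε θ, s.residual x ε θ = ε ^ 3 • c (θ, ε) := fun ε θ => by
    rw [← coef_torusResidual]
    simp only [h]
    rw [coef_smul]
  have hK : IsCompact (Set.Icc 0 (2 * π) ×ˢ Set.Icc (-1 : ℝ) 1) := isCompact_Icc.prod isCompact_Icc
  obtain ⟨C₁, h₁⟩ := hK.exists_bound_of_continuousOn hc.continuous.continuousOn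
  obtain ⟨C₂, hC₂, h₂⟩ := exists_lipschitz_bound (hc.of_le (by exact_mod_cast le_top)) hK
  refine ⟨max C₁ (2 * C₂), le_max_of_le_right (by positivity), fun ε θ hε => ?_⟩
  obtain ⟨t, ht, hte⟩ := exists_mem_Icc_periodic (s.periodic_residual x ε) θ
  rw [← hte]
  have m1 : (t, ε) ∈ Set.Icc 0 (2 * π) ×ˢ Set.Icc (-1 : ℝ) 1 := ⟨ht, abs_le.1 hε⟩
  have m2 : (t, -ε) ∈ Set.Icc 0 (2 * π) ×ˢ Set.Icc (-1 : ℝ) 1 :=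
    ⟨ht, abs_le.1 (by rwa [abs_neg])⟩
  constructor
  · rw [hres, norm_smul, norm_pow, norm_eq_abs, mul_comm]
    gcongr
    exact (h₁ _ m1).trans (le_max_left _ _)
  · rw [parity_residual, hres, hres, show ε ^ 3 • c (t, ε) + (-ε) ^ 3 • c (t, -ε)
      = ε ^ 3 • (c (t, ε) - c (t, -ε)) by module, norm_smul, norm_pow, norm_eq_abs]
    have h5 : ‖((t, ε) : ℝ × ℝ) - (t, -ε)‖ = 2 * |ε| := by
      rw [Prod.mk_sub_mk, sub_self, sub_neg_eq_add, ← two_mul, Prod.norm_mk]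
      simp
    calc |ε| ^ 3 * ‖c (t, ε) - c (t, -ε)‖ ≤ |ε| ^ 3 * (C₂ * (2 * |ε|)) := by
          gcongr; rw [← h5]; exact h₂ _ m1 _ m2
      _ = 2 * C₂ * |ε| ^ 4 := by ring
      _ ≤ _ := by gcongr; exact le_max_right _ _

end Formal
end Model

end Residual

/-! ### The solution branch and its leading terms. -/

section Branch

variable {k : ℕ}

namespace Model

variable {m : Model k} {lam om : ℝ}

/-- `w` solves the Galerkin equations on Fourier coefficients at `(λ, ω) + p`. -/
structure IsGalerkin (m : Model k) (lam om ε : ℝ) (w : ℝ → Fin 7 → State k) (p : ℝ × ℝ) :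
    Prop where
  periodic : Function.Periodic w (2 * π)
  hasDerivAt : ∀ θ, HasDerivAt w (m.gal (kap (1, 0) + w θ) (lam + p.1) (om + p.2) θ ε) θ
  mean : ∫ θ in (0 : ℝ)..2 * π, ell (w θ) = 0

theorem gal_eq (b : (ℝ × ℝ) ≃L[ℝ] (ℝ × ℝ)) (w : Fin 7 → State k) (p : ℝ × ℝ) (θ ε : ℝ) :
    linOp (m.L lam) om w + kap (b p) + m.nonlin lam om b ((w, p), θ, ε)
      = m.gal (kap (1, 0) + w) (lam + p.1) (om + p.2) θ ε := by
  rw [nonlin]; abel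

theorem isPerSol_iff (b : (ℝ × ℝ) ≃L[ℝ] (ℝ × ℝ)) {ε : ℝ} {w : ℝ → Fin 7 → State k} {p : ℝ × ℝ} :
    IsPerSol (linOp (m.L lam) om) kap ell (fun t => m.nonlin lam om b ((w t, p), t, ε)) w (b p)
      ↔ m.IsGalerkin lam om ε w p :=
  ⟨fun h => ⟨h.periodic, fun θ => (h.hasDerivAt θ).congr_deriv (gal_eq b _ _ _ _), h.mean⟩,
    fun h => ⟨h.periodic, fun θ => (h.hasDerivAt θ).congr_deriv (gal_eq b _ _ _ _).symm, h.mean⟩⟩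

namespace Formal

theorem exists_approx_bound (s : m.Formal lam om) :
    ∃ C ≥ (0 : ℝ), ∀ ε θ : ℝ, |ε| ≤ 1 → ‖s.approx ε θ‖ ≤ C * |ε| := by
  obtain ⟨C₁, h₁⟩ := (isCompact_Icc (a := 0) (b := 2 * π)).exists_bound_of_continuousOn
    s.smooth₁.continuous.continuousOn
  obtain ⟨C₂, h₂⟩ := (isCompact_Icc (a := 0) (b := 2 * π)).exists_bound_of_continuousOn
    s.smooth₂.continuous.continuousOn
  have h0 : (0 : ℝ) ∈ Set.Icc 0 (2 * π) := ⟨le_rfl, two_pi_pos.le⟩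
  have hC₁ := (norm_nonneg _).trans (h₁ 0 h0)
  have hC₂ := (norm_nonneg _).trans (h₂ 0 h0)
  refine ⟨C₁ + C₂, by positivity, fun ε θ hε => ?_⟩
  obtain ⟨t, ht, hte⟩ := exists_mem_Icc_periodic (s.periodic_approx ε) θ
  rw [← hte, approx]
  calc ‖ε • s.w₁ t + ε ^ 2 • s.w₂ t‖ ≤ |ε| * C₁ + |ε| ^ 2 * C₂ := by
        refine norm_add_le_of_le ?_ ?_
        · rw [norm_smul, norm_eq_abs]; gcongr; exact h₁ t ht
        · rw [norm_smul, norm_pow, norm_eq_abs]; gcongr; exact h₂ t ht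
    _ ≤ |ε| * C₁ + |ε| * C₂ := by
        gcongr; nlinarith [abs_nonneg ε]
    _ = _ := by ring

theorem continuous_residual (s : m.Formal lam om) (x : ℝ × ℝ) (ε : ℝ) :
    Continuous (s.residual x ε) := by
  have h1 : Continuous (s.approx ε) :=
    continuous_iff_continuousAt.2 fun θ => (s.hasDerivAt_approx ε θ).continuousAt
  have h2 : Continuous (s.approxDeriv ε) :=
    ((contDiff_deriv s.smooth₁).continuous.const_smul ε).add
      ((contDiff_deriv s.smooth₂).continuous.const_smul (ε ^ 2))
  exact (m.continuous_gal (continuous_const.add h1) _ _ _).sub h2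

/-- Once its residual is subtracted, the approximation is an exact solution, which is the form
required by `exists_periodic_error_bound`. -/
theorem isPerSol_approx (s : m.Formal lam om) (b : (ℝ × ℝ) ≃L[ℝ] (ℝ × ℝ)) (x : ℝ × ℝ) (ε : ℝ) :
    IsPerSol (linOp (m.L lam) om) kap ell
      (fun t => m.nonlin lam om b ((s.approx ε t, ε ^ 2 • x), t, ε) - s.residual x ε t)
      (s.approx ε) (b (ε ^ 2 • x)) where
  periodic := s.periodic_approx ε
  hasDerivAt θ := by
    refine (s.hasDerivAt_approx ε θ).congr_deriv ?_
    rw [add_sub, gal_eq, residual]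
    exact (sub_sub_cancel _ _).symm
  mean := by
    have h1 : Continuous fun t => ε • ell (s.w₁ t) :=
      ((ell (k := k)).continuous.comp s.sol₁.continuous).const_smul ε
    have h2 : Continuous fun t => ε ^ 2 • ell (s.w₂ t) :=
      ((ell (k := k)).continuous.comp s.sol₂.continuous).const_smul (ε ^ 2)
    simp only [approx, map_add, map_smul]
    rw [intervalIntegral.integral_add (h1.intervalIntegrable _ _) (h2.intervalIntegrable _ _),
      intervalIntegral.integral_smul,
      intervalIntegral.integral_smul, s.sol₁.mean, s.sol₂.mean]
    simp

/-- The branch of solutions of the Galerkin equations and its leading terms. -/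
theorem exists_branch (s : m.Formal lam om) (hA : IsNonresonant (linOp (m.L lam) om) kap ell)
    (hp : m.p lam = 0) (hq : m.q lam = om) (ha : deriv m.p lam ≠ 0) :
    ∃ δ > (0 : ℝ), ∃ C ≥ (0 : ℝ), ∃ ε₁ > (0 : ℝ), ∃ sol : ℝ → (ℝ → Fin 7 → State k) × (ℝ × ℝ),
      ∀ ε, |ε| < ε₁ → m.IsGalerkin lam om ε (sol ε).1 (sol ε).2 ∧
        (∀ θ, ‖(sol ε).1 θ‖ ≤ C * |ε|) ∧ ‖(sol ε).2‖ ≤ C * |ε| ∧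
        (∀ w p, m.IsGalerkin lam om ε w p → (∀ θ, ‖w θ‖ ≤ δ) → ‖p‖ ≤ δ →
          w = (sol ε).1 ∧ p = (sol ε).2) ∧
        ‖paramEquiv (deriv m.p lam) (deriv m.q lam) ha (sol ε).2 + ε ^ 2 • s.β‖ ≤ C * |ε| ^ 4 ∧
        ∀ θ, ‖(sol ε).1 θ - s.approx ε θ‖ ≤ C * |ε| ^ 3 ∧
          ‖deriv (fun t => (sol ε).1 t - s.approx ε t) θ‖ ≤ C * |ε| ^ 3 ∧
          ‖(sol ε).1 θ - s.approx ε θ + parity ((sol ε).1 θ - s.approx ε θ)‖ ≤ C * |ε| ^ 4 ∧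
          ‖deriv (fun t => (sol ε).1 t - s.approx ε t) θ
            + parity (deriv (fun t => (sol ε).1 t - s.approx ε t) θ)‖ ≤ C * |ε| ^ 4 := by
  set b := paramEquiv (deriv m.p lam) (deriv m.q lam) ha
  obtain ⟨δ, hδ, C₁, hC₁, ε₁, hε₁, sol, hsol⟩ := exists_periodic_branch hA b
    (m.contDiff_nonlin lam om b) (m.nonlin_periodic lam om b) (m.nonlin_zero lam om b hp hq)
    (m.hasFDerivAt_nonlin lam om ha)
  -- The second-order corrections of `(λ, ω)`, chosen so that the linear parameter term cancels `β`.
  let x := b.symm (-s.β)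
  have hx : s.β + x.1 • (deriv m.p lam, deriv m.q lam) - x.2 • (0, 1) = 0 := by
    have h1 : b x = -s.β := b.apply_symm_apply _
    rw [← neg_eq_iff_eq_neg.2 h1, paramEquiv_apply]
    ext <;> simp <;> ring
  obtain ⟨C₂, hC₂, h₂⟩ := s.exists_approx_bound
  obtain ⟨C₃, hC₃, h₃⟩ := s.exists_residual_bound hp hq hx
  let C₄ := C₁ + C₂ + C₃ + ‖x‖
  have hC₄ : 0 ≤ C₄ := by positivity
  have i1 : C₁ ≤ C₄ := by simp only [C₄]; linarith [norm_nonneg x]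
  have i2 : C₂ ≤ C₄ := by simp only [C₄]; linarith [norm_nonneg x]
  have i3 : C₃ ≤ C₄ := by simp only [C₄]; linarith [norm_nonneg x]
  have i4 : ‖x‖ ≤ C₄ := by simp only [C₄]; linarith [norm_nonneg x]
  -- `1 + parity` doubles the odd modes, the kernel among them, and removes the even ones.
  obtain ⟨ε₂, hε₂, C₅, hC₅, h₅⟩ := exists_periodic_error_bound hA b
    (m.contDiff_nonlin lam om b) (m.nonlin_periodic lam om b) (m.nonlin_zero lam om b hp hq)
    (m.hasFDerivAt_nonlin lam om ha) (T := 1 + parity) (fun x => by simp [parity_linOp])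
    (fun q => by simp [parity_kap, two_smul]) (fun x => by simp [ell_parity, two_smul]) C₄ hC₄
  refine ⟨δ, hδ, C₁ + C₅ + ‖(b : (ℝ × ℝ) →L[ℝ] (ℝ × ℝ))‖ * C₅, by positivity,
    min (min ε₁ ε₂) 1, by positivity, sol, fun ε hε => ?_⟩
  have e1 : |ε| < ε₁ := hε.trans_le ((min_le_left _ _).trans (min_le_left _ _))
  have e2 : |ε| < ε₂ := hε.trans_le ((min_le_left _ _).trans (min_le_right _ _))
  have e3 : |ε| ≤ 1 := (hε.trans_le (min_le_right _ _)).le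
  obtain ⟨g1, g2, g3, g4⟩ := hsol ε e1
  have h6 := h₅ ε e2 (sol ε).1 (s.approx ε) (sol ε).2 (ε ^ 2 • x) (s.residual x ε) g1
    (fun t => (g2 t).trans (by gcongr)) (g3.trans (by gcongr)) (s.isPerSol_approx b x ε)
    (fun t => (h₂ ε t e3).trans (by gcongr)) (by
      rw [norm_smul, norm_pow, norm_eq_abs, mul_comm]
      have : |ε| ^ 2 ≤ |ε| := by nlinarith [abs_nonneg ε]
      gcongr) (s.continuous_residual x ε) (s.periodic_residual x ε)
    (fun t => ((h₃ ε t e3).1).trans (by gcongr)) fun t => ((h₃ ε t e3).2).trans (by gcongr)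
  have hB := norm_nonneg (b : (ℝ × ℝ) →L[ℝ] (ℝ × ℝ))
  have j : ∀ n : ℕ, C₅ * |ε| ^ n ≤ (C₁ + C₅ + ‖(b : (ℝ × ℝ) →L[ℝ] (ℝ × ℝ))‖ * C₅) * |ε| ^ n := by
    intro n
    gcongr
    have := mul_nonneg hB hC₅
    linarith
  have j' : C₁ * |ε| ≤ (C₁ + C₅ + ‖(b : (ℝ × ℝ) →L[ℝ] (ℝ × ℝ))‖ * C₅) * |ε| := by
    gcongr
    have := mul_nonneg hB hC₅
    linarith
  refine ⟨(isPerSol_iff b).1 g1, fun θ => (g2 θ).trans j', g3.trans j', fun w p hw hw1 hp1 =>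
    g4 w p ((isPerSol_iff b).2 hw) hw1 hp1, ?_, fun θ => ?_⟩
  · have h7 : b (sol ε).2 + ε ^ 2 • s.β = (b : (ℝ × ℝ) →L[ℝ] (ℝ × ℝ)) ((sol ε).2 - ε ^ 2 • x) := by
      rw [map_sub, map_smul]
      show _ = b (sol ε).2 - ε ^ 2 • b x
      rw [b.apply_symm_apply, smul_neg, sub_neg_eq_add]
    rw [h7]
    refine (ContinuousLinearMap.le_opNorm _ _).trans ?_
    calc _ ≤ ‖(b : (ℝ × ℝ) →L[ℝ] (ℝ × ℝ))‖ * (C₅ * |ε| ^ 4) := by gcongr; exact h6.1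
      _ = ‖(b : (ℝ × ℝ) →L[ℝ] (ℝ × ℝ))‖ * C₅ * |ε| ^ 4 := by ring
      _ ≤ _ := by gcongr; linarith
  · obtain ⟨a1, a2, a3, a4⟩ := h6.2 θ
    exact ⟨a1.trans (j 3), a2.trans (j 3), a3.trans (j 4), a4.trans (j 4)⟩

end Formal
end Model

end Branch

/-! ### The near-identity transformation on circles. -/

section NormalForm

variable {k : ℕ}

namespace NFCoeffs

variable (c : NFCoeffs k)

/-- The quadratic part of the transformation. -/
def quadMap (θ : ℝ) (y : State k) : State k :=
  Sum.elim
    ((y (Sum.inl 0) ^ 2 + y (Sum.inl 1) ^ 2) • c.ha0 θ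
      + (y (Sum.inl 0) ^ 2 - y (Sum.inl 1) ^ 2) • c.ha2 θ
      + (2 * y (Sum.inl 0) * y (Sum.inl 1)) • c.hb2 θ)
    ((y (Sum.inl 0) ^ 2 + y (Sum.inl 1) ^ 2) • c.ta0 θ
      + (y (Sum.inl 0) ^ 2 - y (Sum.inl 1) ^ 2) • c.ta2 θ
      + (2 * y (Sum.inl 0) * y (Sum.inl 1)) • c.tb2 θ)

/-- The cubic part of the transformation. -/
def cubicMap (θ : ℝ) (y : State k) : State k :=
  Sum.elim
    ((y (Sum.inl 0) * (y (Sum.inl 0) ^ 2 + y (Sum.inl 1) ^ 2)) • c.ha1 θ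
      + (y (Sum.inl 1) * (y (Sum.inl 0) ^ 2 + y (Sum.inl 1) ^ 2)) • c.hb1 θ
      + (y (Sum.inl 0) * (y (Sum.inl 0) ^ 2 - 3 * y (Sum.inl 1) ^ 2)) • c.ha3 θ
      + (y (Sum.inl 1) * (3 * y (Sum.inl 0) ^ 2 - y (Sum.inl 1) ^ 2)) • c.hb3 θ) 0

theorem trans_eq (ε θ : ℝ) (y : State k) :
    c.trans ε θ y = y + ε • c.quadMap θ y + ε ^ 2 • c.cubicMap θ y := by
  -- At `ε = 0` the convention `0⁻¹ = 0` makes both sides equal to `y`.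
  by_cases hε : ε = 0
  · subst hε
    funext i
    rcases i with i | i <;> simp [trans, hat, til]
  · funext i
    rcases i with i | i <;>
      simp [trans, hat, til, quadMap, cubicMap, hHat, hTil] <;> field_simp <;> ring

/-- The Fourier coefficients of the quadratic part. -/
def coef₁ (θ : ℝ) : Fin 7 → State k :=
  ![Sum.elim (c.ha0 θ) (c.ta0 θ), 0, 0, Sum.elim (c.ha2 θ) (c.ta2 θ),
    Sum.elim (c.hb2 θ) (c.tb2 θ), 0, 0]

/-- The Fourier coefficients of the cubic part. -/
def coef₂ (θ : ℝ) : Fin 7 → State k :=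
  ![0, Sum.elim (c.ha1 θ) 0, Sum.elim (c.hb1 θ) 0, 0, 0, Sum.elim (c.ha3 θ) 0,
    Sum.elim (c.hb3 θ) 0]

/-- `|y|²`, `y₁² - y₂²` and `2 y₁ y₂` restrict to `r²`, `r² cos 2φ` and `r² sin 2φ`, so the
polynomial coefficients are Fourier coefficients. -/
theorem quadMap_circle (θ r φ : ℝ) :
    c.quadMap θ (r • aStar φ) = r ^ 2 • trig φ (c.coef₁ θ) := by
  have h := sin_sq_add_cos_sq φ
  rw [trig_apply', cos_two_mul, sin_two_mul]
  have h : sin φ ^ 2 = 1 - cos φ ^ 2 := by linarith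
  funext i
  rcases i with i | i <;> simp [quadMap, coef₁, aStar] <;> ring_nf <;> rw [h] <;> ring

theorem cubicMap_circle (θ r φ : ℝ) :
    c.cubicMap θ (r • aStar φ) = r ^ 3 • trig φ (c.coef₂ θ) := by
  have h := sin_sq_add_cos_sq φ
  rw [trig_apply', cos_two_mul, sin_two_mul, cos_three_mul, sin_three_mul]
  have h : sin φ ^ 2 = 1 - cos φ ^ 2 := by linarith
  have h' : sin φ ^ 3 = (1 - cos φ ^ 2) * sin φ := by rw [← h]; ring
  funext i
  rcases i with i | i
  · simp [cubicMap, coef₂, aStar]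
    ring_nf
    rw [h, h']
    ring
  · simp [cubicMap, coef₂, aStar]

theorem contDiff_quadMap (θ : ℝ) : ContDiff ℝ ∞ (c.quadMap θ) := by
  refine contDiff_pi.2 fun i => ?_
  rcases i with i | i <;> simp [quadMap] <;> fun_prop

theorem contDiff_cubicMap (θ : ℝ) : ContDiff ℝ ∞ (c.cubicMap θ) := by
  refine contDiff_pi.2 fun i => ?_
  rcases i with i | i <;> simp [cubicMap] <;> fun_prop

/-- The derivative of the transformation minus the identity. -/
def transDeriv (ε θ : ℝ) (y : State k) : State k →L[ℝ] State k :=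
  ε • fderiv ℝ (c.quadMap θ) y + ε ^ 2 • fderiv ℝ (c.cubicMap θ) y

theorem hasFDerivAt_quadMap (θ : ℝ) (y : State k) :
    HasFDerivAt (c.quadMap θ) (fderiv ℝ (c.quadMap θ) y) y :=
  ((c.contDiff_quadMap θ).differentiable (by simp) y).hasFDerivAt

theorem hasFDerivAt_cubicMap (θ : ℝ) (y : State k) :
    HasFDerivAt (c.cubicMap θ) (fderiv ℝ (c.cubicMap θ) y) y :=
  ((c.contDiff_cubicMap θ).differentiable (by simp) y).hasFDerivAt

theorem fderiv_trans (ε θ : ℝ) (y : State k) :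
    fderiv ℝ (c.trans ε θ) y = 1 + c.transDeriv ε θ y := by
  rw [show c.trans ε θ = fun y => y + ε • c.quadMap θ y + ε ^ 2 • c.cubicMap θ y from
    funext fun y => c.trans_eq ε θ y]
  have h := ((hasFDerivAt_id (𝕜 := ℝ) y).add ((c.hasFDerivAt_quadMap θ y).const_smul ε)).add
    ((c.hasFDerivAt_cubicMap θ y).const_smul (ε ^ 2))
  rw [transDeriv, ← add_assoc]
  exact h.fderiv

theorem hasDerivAt_line (y x : State k) : HasDerivAt (fun t : ℝ => y + t • x) x 0 := by
  simpa using ((hasDerivAt_id (0 : ℝ)).smul_const x).const_add y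

/-- The nonlinear part of the transformation depends on the critical components alone, hence is
constant in the direction `x`. -/
theorem transDeriv_of_hat_eq_zero (ε θ : ℝ) (y : State k) {x : State k} (hx : hat x = 0) :
    c.transDeriv ε θ y x = 0 := by
  have h0 : ∀ i, x (Sum.inl i) = 0 := fun i => congrFun hx i
  have hq : fderiv ℝ (c.quadMap θ) y x = 0 := by
    have h1 : HasFDerivAt (c.quadMap θ) (fderiv ℝ (c.quadMap θ) y) (y + (0 : ℝ) • x) := by
      simpa using c.hasFDerivAt_quadMap θ y
    refine (h1.comp_hasDerivAt 0 (hasDerivAt_line y x)).unique ?_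
    convert hasDerivAt_const (0 : ℝ) (c.quadMap θ y) using 2 with t
    simp [quadMap, h0]
  have hc : fderiv ℝ (c.cubicMap θ) y x = 0 := by
    have h1 : HasFDerivAt (c.cubicMap θ) (fderiv ℝ (c.cubicMap θ) y) (y + (0 : ℝ) • x) := by
      simpa using c.hasFDerivAt_cubicMap θ y
    refine (h1.comp_hasDerivAt 0 (hasDerivAt_line y x)).unique ?_
    convert hasDerivAt_const (0 : ℝ) (c.cubicMap θ y) using 2 with t
    simp [cubicMap, h0]
  simp [transDeriv, hq, hc]

/-- The chain rule along the circle: the formulas of `quadMap_circle` and `cubicMap_circle`,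
differentiated in `φ`. -/
theorem transDeriv_circle (ε θ r φ : ℝ) :
    c.transDeriv ε θ (r • aStar φ) (r • trig φ (dphi (kap (1, 0))))
      = (ε * r ^ 2) • trig φ (dphi (c.coef₁ θ)) + (ε ^ 2 * r ^ 3) • trig φ (dphi (c.coef₂ θ)) := by
  have h0 : HasDerivAt (fun φ => r • aStar φ) (r • trig φ (dphi (kap (k := k) (1, 0)))) φ := by
    simp only [aStar_eq]
    exact (hasDerivAt_trig φ _).const_smul r
  have h1 : fderiv ℝ (c.quadMap θ) (r • aStar φ) (r • trig φ (dphi (kap (1, 0))))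
      = r ^ 2 • trig φ (dphi (c.coef₁ θ)) := by
    refine ((c.hasFDerivAt_quadMap θ (r • aStar φ)).comp_hasDerivAt φ h0).unique ?_
    simp only [Function.comp_def, quadMap_circle]
    exact (hasDerivAt_trig φ _).const_smul (r ^ 2)
  have h2 : fderiv ℝ (c.cubicMap θ) (r • aStar φ) (r • trig φ (dphi (kap (1, 0))))
      = r ^ 3 • trig φ (dphi (c.coef₂ θ)) := by
    refine ((c.hasFDerivAt_cubicMap θ (r • aStar φ)).comp_hasDerivAt φ h0).unique ?_
    simp only [Function.comp_def, cubicMap_circle]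
    exact (hasDerivAt_trig φ _).const_smul (r ^ 3)
  rw [transDeriv, add_apply, smul_apply, smul_apply, h1, h2, smul_smul, smul_smul]

end NFCoeffs

end NormalForm

/-! ### From the conditions on `G†` to defect equations. -/

section NormalFormAsymptotics

variable {k : ℕ}

/-- The projection onto the critical components. -/
def hatL : State k →L[ℝ] (Fin 2 → ℝ) :=
  ContinuousLinearMap.pi fun i => ContinuousLinearMap.proj (Sum.inl i)

/-- The projection onto the hyperbolic components. -/
def tilL : State k →L[ℝ] (Fin k → ℝ) :=
  ContinuousLinearMap.pi fun i => ContinuousLinearMap.proj (Sum.inr i)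

open Asymptotics Filter in
-- `K` is small and controlled by the critical components alone. Hence the lower accuracy `ε²` of
-- the other components never contaminates the critical ones, and the factor `1 + K` can be removed.
theorem isBigO_iff_of_near_identity {e y ρ : ℝ → State k} {K : ℝ → State k →L[ℝ] State k}
    (hK : (fun ε => K ε (e ε)) =O[nhdsWithin 0 {0}ᶜ] fun ε => ε • hat (e ε))
    (hρ : ρ =O[nhdsWithin 0 {0}ᶜ] fun ε : ℝ => ε ^ 3)
    (h : ∀ᶠ ε in nhdsWithin 0 {0}ᶜ, e ε + K ε (e ε) = y ε + ρ ε) :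
    ((fun ε => hat (e ε)) =O[nhdsWithin 0 {0}ᶜ] (fun ε : ℝ => ε ^ 3) ∧
      (fun ε => til (e ε)) =O[nhdsWithin 0 {0}ᶜ] (fun ε : ℝ => ε ^ 2)) ↔
    ((fun ε => hat (y ε)) =O[nhdsWithin 0 {0}ᶜ] (fun ε : ℝ => ε ^ 3) ∧
      (fun ε => til (y ε)) =O[nhdsWithin 0 {0}ᶜ] (fun ε : ℝ => ε ^ 2)) := by
  have hT : Tendsto (fun ε : ℝ => ε) (nhdsWithin 0 {0}ᶜ) (nhds 0) :=
    tendsto_id.mono_left nhdsWithin_le_nhds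
  have h32 : (fun ε : ℝ => ε ^ 3) =O[nhdsWithin 0 {0}ᶜ] fun ε : ℝ => ε ^ 2 :=
    ((isLittleO_pow_pow (𝕜 := ℝ) (by norm_num : 2 < 3)).mono nhdsWithin_le_nhds).isBigO
  have hsmall : (fun ε => ε • hat (e ε)) =o[nhdsWithin 0 {0}ᶜ] fun ε => hat (e ε) := by
    have := ((isLittleO_one_iff ℝ).2 hT).smul_isBigO
      (isBigO_refl (fun ε => hat (e ε)) (nhdsWithin 0 {0}ᶜ))
    simpa using this
  have hKo := hK.trans_isLittleO hsmall
  have hhat : ∀ f : ℝ → State k, (fun ε => hat (f ε)) =O[nhdsWithin 0 {0}ᶜ] f := fun f =>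
    hatL.isBigO_comp f _
  have htil : ∀ f : ℝ → State k, (fun ε => til (f ε)) =O[nhdsWithin 0 {0}ᶜ] f := fun f =>
    tilL.isBigO_comp f _
  have e1 : (fun ε => hat (e ε) + hat (K ε (e ε))) =ᶠ[nhdsWithin 0 {0}ᶜ]
      fun ε => hat (y ε) + hat (ρ ε) := by
    filter_upwards [h] with ε hε using congrArg hat hε
  have e2 : (fun ε => til (e ε) + til (K ε (e ε))) =ᶠ[nhdsWithin 0 {0}ᶜ]
      fun ε => til (y ε) + til (ρ ε) := by
    filter_upwards [h] with ε hε using congrArg til hε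
  have hKh := ((hhat fun ε => K ε (e ε)).trans_isLittleO hKo)
  have hρh := (hhat ρ).trans hρ
  have hρt := ((htil ρ).trans hρ).trans h32
  have hKt := ((htil fun ε => K ε (e ε)).trans hKo.isBigO)
  constructor
  · rintro ⟨h1, h2⟩
    have a1 := ((h1.add (hKh.isBigO.trans h1)).congr' e1 .rfl).sub hρh
    have a2 := ((h2.add ((hKt.trans h1).trans h32)).congr' e2 .rfl).sub hρt
    exact ⟨by simpa using a1, by simpa using a2⟩
  · rintro ⟨h1, h2⟩
    have a1 : (fun ε => hat (e ε)) =O[nhdsWithin 0 {0}ᶜ] (fun ε : ℝ => ε ^ 3) :=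
      hKh.right_isBigO_add'.trans (((h1.add hρh).congr' e1.symm .rfl))
    have a2 := ((h2.add hρt).congr' e2.symm .rfl).sub ((hKt.trans a1).trans h32)
    exact ⟨a1, by simpa using a2⟩

open Asymptotics in
theorem eq_zero_of_pow_smul_isBigO {V : Type} [NormedAddCommGroup V] [NormedSpace ℝ V] {v : V}
    {n : ℕ} (hv : (fun ε : ℝ => ε ^ n • v) =O[nhdsWithin 0 {0}ᶜ] fun ε : ℝ => ε ^ (n + 1)) :
    v = 0 := by
  have h1 : (fun _ : ℝ => v) =O[nhdsWithin 0 {0}ᶜ] fun ε : ℝ => ε := by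
    have h2 := (isBigO_refl (fun ε : ℝ => (ε ^ n)⁻¹) (nhdsWithin 0 {0}ᶜ)).smul hv
    refine h2.congr' ?_ ?_ <;> filter_upwards [self_mem_nhdsWithin] with ε hε
    · have : ε ≠ 0 := hε
      rw [smul_smul, inv_mul_cancel₀ (pow_ne_zero n this), one_smul]
    · have : ε ≠ 0 := hε
      rw [smul_eq_mul, pow_succ, inv_mul_cancel_left₀ (pow_ne_zero n this)]
  have h3 : Filter.Tendsto (fun _ : ℝ => v) (nhdsWithin 0 {0}ᶜ) (nhds 0) :=
    h1.trans_tendsto (Filter.tendsto_id.mono_left nhdsWithin_le_nhds)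
  exact tendsto_nhds_unique tendsto_const_nhds h3

open Asymptotics in
theorem isBigO_sq_smul {V : Type} [NormedAddCommGroup V] [NormedSpace ℝ V] (b : V) :
    (fun ε : ℝ => ε ^ 2 • b) =O[nhdsWithin 0 {0}ᶜ] fun ε : ℝ => ε ^ 2 := by
  simpa using (isBigO_refl (fun ε : ℝ => ε ^ 2) (nhdsWithin 0 {0}ᶜ)).smul
    (isBigO_const_const b (one_ne_zero (α := ℝ)) (nhdsWithin (0 : ℝ) {0}ᶜ))

theorem eq_zero_of_isBigO_sq {V : Type} [NormedAddCommGroup V] [NormedSpace ℝ V] {a b : V}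
    (h : (fun ε : ℝ => ε • a + ε ^ 2 • b) =O[nhdsWithin 0 {0}ᶜ] fun ε : ℝ => ε ^ 2) : a = 0 :=
  eq_zero_of_pow_smul_isBigO (n := 1) (by simpa using h.sub (isBigO_sq_smul b))

theorem eq_zero_of_isBigO_cube {V : Type} [NormedAddCommGroup V] [NormedSpace ℝ V] {a b : V}
    (h : (fun ε : ℝ => ε • a + ε ^ 2 • b) =O[nhdsWithin 0 {0}ᶜ] fun ε : ℝ => ε ^ 3) :
    a = 0 ∧ b = 0 := by
  have ha : a = 0 := eq_zero_of_isBigO_sq (h.trans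
    ((Asymptotics.isLittleO_pow_pow (by norm_num : 2 < 3)).mono nhdsWithin_le_nhds).isBigO)
  exact ⟨ha, eq_zero_of_pow_smul_isBigO (n := 2) (by simpa [ha] using h)⟩

namespace NFCoeffs

variable {m : Model k} {S : ForcedSystem k} {lam om : ℝ} (c : NFCoeffs k)

theorem parity_coef₁ (θ : ℝ) : parity (c.coef₁ θ) = -c.coef₁ θ := by
  rw [parity_apply, coef₁]
  funext j
  fin_cases j <;> simp

/-- The obstruction to the normal form at second order. -/
def defect₁ (m : Model k) (lam om θ : ℝ) : Fin 7 → State k :=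
  linOp (m.L lam) om (c.coef₁ θ) + m.quad lam θ - deriv c.coef₁ θ

/-- The obstruction to the normal form at third order. -/
def defect₂ (m : Model k) (lam om : ℝ) (β : ℝ × ℝ) (θ : ℝ) : Fin 7 → State k :=
  linOp (m.L lam) om (c.coef₂ θ) + m.cubic lam (c.coef₁ θ) θ - kap β - deriv c.coef₂ θ

/-- The difference between the transformed map and its normal form, at `y = r a⋆(φ)`. -/
def error (S : ForcedSystem k) (lam om : ℝ) (β : ℝ × ℝ) (θ r φ ε : ℝ) : State k :=
  c.Gdag S (r • aStar φ) lam θ ε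
    - (om • r • trig φ (dphi (kap (1, 0))) + (ε ^ 2 * r ^ 3) • trig φ (kap β))

/-- Multiplication by the derivative `1 + transDeriv` of the transformation removes the inverse from
`G†`. Expanding what is left along the circle, order zero matches the linear part, and the two
defects are the mismatches at orders one and two. -/
theorem exists_error_expansion (hG : ∀ z θ ε, ε ≠ 0 → S.G z lam θ ε = m.g z lam θ ε)
    (hp : m.p lam = 0) (hq : m.q lam = om) (h₁ : Differentiable ℝ c.coef₁)
    (h₂ : Differentiable ℝ c.coef₂) (β : ℝ × ℝ) (θ r φ : ℝ) :
    ∃ ρ : ℝ → State k, (ρ =O[nhdsWithin 0 {0}ᶜ] fun ε : ℝ => ε ^ 3) ∧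
      ∀ᶠ ε in nhdsWithin 0 {0}ᶜ,
        c.error S lam om β θ r φ ε
            + c.transDeriv ε θ (r • aStar φ) (c.error S lam om β θ r φ ε)
          = (ε • (r ^ 2 • trig φ (c.defect₁ m lam om θ))
            + ε ^ 2 • (r ^ 3 • trig φ (c.defect₂ m lam om β θ))) + ρ ε := by
  obtain ⟨R, hR, h⟩ := m.g_expansion lam 0 θ (r • aStar φ) (r ^ 2 • trig φ (c.coef₁ θ))
    (r ^ 3 • trig φ (c.coef₂ θ))
  let A := fderiv ℝ (c.quadMap θ) (r • aStar φ)
  let B := fderiv ℝ (c.cubicMap θ) (r • aStar φ)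
  have hK : ∀ ε, c.transDeriv ε θ (r • aStar φ) = ε • A + ε ^ 2 • B := fun ε => rfl
  refine ⟨fun ε => ε ^ 3 • (R ε - r ^ 3 • (A (trig φ (kap β)) + ε • B (trig φ (kap β)))), ?_, ?_⟩
  · have h5 : Continuous fun ε : ℝ =>
        R ε - r ^ 3 • (A (trig φ (kap β)) + ε • B (trig φ (kap β))) := by fun_prop
    have h6 := ((h5.tendsto 0).mono_left (nhdsWithin_le_nhds (s := {0}ᶜ))).isBigO_one ℝ
    have h7 := (Asymptotics.isBigO_refl (fun ε : ℝ => ε ^ 3) (nhdsWithin 0 {0}ᶜ)).smul h6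
    simpa using h7
  -- For small `ε` the derivative of the transformation is a unit; otherwise `inverse` would take
  -- its default value zero.
  · have hinv : ∀ᶠ ε : ℝ in nhdsWithin 0 {0}ᶜ, IsUnit (1 + (ε • A + ε ^ 2 • B)) := by
      have hc : Continuous fun ε : ℝ => 1 + (ε • A + ε ^ 2 • B) := by fun_prop
      refine nhdsWithin_le_nhds (hc.continuousAt.eventually ?_)
      refine Units.isOpen.mem_nhds ?_
      show IsUnit _
      simp
    filter_upwards [hinv, self_mem_nhdsWithin] with ε hε hε0
    have hε0 : ε ≠ 0 := hε0
    obtain ⟨u, hu⟩ := hε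
    have hI : (fderiv ℝ (c.trans ε θ) (r • aStar φ)).IsInvertible := by
      rw [fderiv_trans, hK, ← hu]
      exact ⟨ContinuousLinearEquiv.unitsEquiv ℝ _ u, rfl⟩
    have hT : HasDerivAt (fun t => c.trans ε t (r • aStar φ))
        (ε • r ^ 2 • trig φ (deriv c.coef₁ θ) + ε ^ 2 • r ^ 3 • trig φ (deriv c.coef₂ θ)) θ := by
      simp only [trans_eq, quadMap_circle, cubicMap_circle, add_assoc]
      have a1 := (trig (V := State k) φ).hasFDerivAt.comp_hasDerivAt θ (h₁ θ).hasDerivAt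
      have a2 := (trig (V := State k) φ).hasFDerivAt.comp_hasDerivAt θ (h₂ θ).hasDerivAt
      exact (((a1.const_smul (r ^ 2)).const_smul ε).add
        ((a2.const_smul (r ^ 3)).const_smul (ε ^ 2))).const_add _
    have hD := hI.self_apply_inverse
      (S.G (c.trans ε θ (r • aStar φ)) lam θ ε - deriv (fun t => c.trans ε t (r • aStar φ)) θ)
    change fderiv ℝ (c.trans ε θ) (r • aStar φ) (c.Gdag S (r • aStar φ) lam θ ε) = _ at hD
    have h' := h ε
    rw [mul_zero, add_zero] at h'
    rw [hG _ _ _ hε0, hT.deriv, trans_eq, quadMap_circle, cubicMap_circle, h', fderiv_trans,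
      add_apply, one_apply_eq_self] at hD
    have h0 : m.L lam (aStar φ) = om • trig φ (dphi (kap (1, 0))) := by
      rw [m.L_trig_kap, hp, hq, dphi_kap, ← map_smul, ← map_smul]; simp
    have hd1 : trig φ (c.defect₁ m lam om θ) = m.L lam (trig φ (c.coef₁ θ))
        - om • trig φ (dphi (c.coef₁ θ)) + m.M (0, (θ, lam)) (aStar φ) (aStar φ)
        - trig φ (deriv c.coef₁ θ) := by
      rw [defect₁, map_sub, map_add, trig_linOp, Model.quad, trig_quadCoef]
    have hd2 : trig φ (c.defect₂ m lam om β θ) = m.L lam (trig φ (c.coef₂ θ))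
        - om • trig φ (dphi (c.coef₂ θ)) + (m.M (0, (θ, lam)) (aStar φ) (trig φ (c.coef₁ θ))
        + m.M (0, (θ, lam)) (trig φ (c.coef₁ θ)) (aStar φ)
        + m.M₃ (0, (θ, lam)) (aStar φ) (aStar φ) (aStar φ)) - trig φ (kap β)
        - trig φ (deriv c.coef₂ θ) := by
      rw [defect₂, map_sub, map_sub, map_add, trig_linOp, Model.cubic,
        trig_cubicCoef _ _ _ (c.parity_coef₁ θ)]
    have hN : c.transDeriv ε θ (r • aStar φ)
        (om • r • trig φ (dphi (kap (1, 0))) + (ε ^ 2 * r ^ 3) • trig φ (kap β))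
        = om • ((ε * r ^ 2) • trig φ (dphi (c.coef₁ θ))
          + (ε ^ 2 * r ^ 3) • trig φ (dphi (c.coef₂ θ)))
          + (ε ^ 2 * r ^ 3) • (ε • A (trig φ (kap β)) + ε ^ 2 • B (trig φ (kap β))) := by
      rw [map_add, map_smul, transDeriv_circle, map_smul, hK]; rfl
    rw [error, map_sub, hN, hd1, hd2]
    simp only [map_smul, smul_apply, h0] at hD
    rw [← sub_eq_zero] at hD ⊢
    refine Eq.trans ?_ hD
    module

end NFCoeffs

end NormalFormAsymptotics

/-! ### Normal forms correspond to formal solutions. -/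

section NormalFormSolution

variable {k : ℕ}

theorem elim_hat_til (x : State k) : Sum.elim (hat x) (til x) = x := by
  funext i
  rcases i with i | i <;> rfl

/-- The projection onto the critical plane. -/
def critL : State k →L[ℝ] State k :=
  ContinuousLinearMap.pi (Sum.elim (fun i => ContinuousLinearMap.proj (Sum.inl i)) 0)

theorem critL_apply (x : State k) : critL x = Sum.elim (hat x) 0 := by
  funext i
  rcases i with i | i <;> rfl

/-- The projection of Fourier coefficients onto the critical plane. -/
def critProj : (Fin 7 → State k) →L[ℝ] (Fin 7 → State k) :=
  ContinuousLinearMap.pi fun j => critL.comp (ContinuousLinearMap.proj j)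

theorem critProj_apply (u : Fin 7 → State k) (j : Fin 7) :
    critProj u j = Sum.elim (hat (u j)) 0 := critL_apply _

theorem trig_critProj (φ : ℝ) (u : Fin 7 → State k) :
    trig φ (critProj u) = Sum.elim (hat (trig φ u)) 0 := by
  rw [← critL_apply, trig_comp]; rfl

theorem critL_blockL (p q : ℝ) (B : Matrix (Fin k) (Fin k) ℝ) (x : State k) :
    critL (blockL p q B x) = blockL p q B (critL x) := by
  rw [critL_apply, critL_apply]
  refine state_ext ?_ ?_ fun i => ?_
  · simp [blockL_inl_zero, hat]
  · simp [blockL_inl_one, hat]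
  · rw [blockL_inr]
    simp [show til (Sum.elim (hat x) 0 : State k) = 0 from rfl]

theorem critProj_linOp (m : Model k) (lam om : ℝ) (u : Fin 7 → State k) :
    critProj (linOp (m.L lam) om u) = linOp (m.L lam) om (critProj u) := by
  have h : ∀ x, critL (m.L lam x) = m.L lam (critL x) := critL_blockL _ _ _
  rw [linOp_apply, linOp_apply]
  funext j
  show critL _ = _
  fin_cases j <;> simp [h] <;> rfl

theorem critProj_kap (q : ℝ × ℝ) : critProj (kap (k := k) q) = kap q := by
  funext j
  rw [critProj_apply, kap_apply]
  fin_cases j <;> refine state_ext ?_ ?_ fun i => ?_ <;> simp [hat]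

theorem ell_critProj (u : Fin 7 → State k) : ell (critProj u) = ell u := by
  simp [ell_apply, critProj_apply, hat]

namespace NFCoeffs

variable {m : Model k} {S : ForcedSystem k} {lam om : ℝ} (c : NFCoeffs k)

theorem isBigO_transDeriv (θ : ℝ) (y : State k) (e : ℝ → State k) :
    (fun ε => c.transDeriv ε θ y (e ε)) =O[nhdsWithin 0 {0}ᶜ] fun ε => ε • hat (e ε) := by
  let A := fderiv ℝ (c.quadMap θ) y
  let B := fderiv ℝ (c.cubicMap θ) y
  refine Asymptotics.IsBigO.of_bound (‖A‖ + ‖B‖) ?_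
  have h1 : ∀ᶠ ε : ℝ in nhdsWithin 0 {0}ᶜ, |ε| < 1 := by
    refine nhdsWithin_le_nhds ?_
    filter_upwards [Metric.ball_mem_nhds (0 : ℝ) one_pos] with ε hε
    simpa using hε
  filter_upwards [h1] with ε hε
  have h2 : c.transDeriv ε θ y (e ε) = c.transDeriv ε θ y (critL (e ε)) := by
    rw [← sub_eq_zero, ← map_sub]
    refine c.transDeriv_of_hat_eq_zero ε θ y ?_
    rw [critL_apply]
    funext i
    simp [hat]
  have h3 : ‖critL (e ε)‖ ≤ ‖hat (e ε)‖ := by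
    rw [critL_apply, pi_norm_le_iff_of_nonneg (norm_nonneg _)]
    intro i
    rcases i with i | i
    · exact norm_le_pi_norm (hat (e ε)) i
    · simp
  rw [h2, norm_smul, norm_eq_abs]
  have h4 : ‖c.transDeriv ε θ y‖ ≤ (‖A‖ + ‖B‖) * |ε| := by
    refine (norm_add_le _ _).trans ?_
    rw [norm_smul, norm_smul, norm_pow, norm_eq_abs]
    have : |ε| ^ 2 ≤ |ε| := by nlinarith [abs_nonneg ε]
    calc |ε| * ‖A‖ + |ε| ^ 2 * ‖B‖ ≤ |ε| * ‖A‖ + |ε| * ‖B‖ := by gcongr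
      _ = _ := by ring
  calc ‖c.transDeriv ε θ y (critL (e ε))‖ ≤ ‖c.transDeriv ε θ y‖ * ‖critL (e ε)‖ :=
        ContinuousLinearMap.le_opNorm _ _
    _ ≤ (‖A‖ + ‖B‖) * |ε| * ‖hat (e ε)‖ := by gcongr
    _ = _ := by ring

theorem isBigO_error_iff (hG : ∀ z θ ε, ε ≠ 0 → S.G z lam θ ε = m.g z lam θ ε)
    (hp : m.p lam = 0) (hq : m.q lam = om) (h₁ : Differentiable ℝ c.coef₁)
    (h₂ : Differentiable ℝ c.coef₂) (β : ℝ × ℝ) (θ r φ : ℝ) :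
    ((fun ε => hat (c.error S lam om β θ r φ ε)) =O[nhdsWithin 0 {0}ᶜ] (fun ε : ℝ => ε ^ 3) ∧
      (fun ε => til (c.error S lam om β θ r φ ε)) =O[nhdsWithin 0 {0}ᶜ] (fun ε : ℝ => ε ^ 2)) ↔
    ((fun ε => ε • hat (r ^ 2 • trig φ (c.defect₁ m lam om θ))
        + ε ^ 2 • hat (r ^ 3 • trig φ (c.defect₂ m lam om β θ)))
        =O[nhdsWithin 0 {0}ᶜ] (fun ε : ℝ => ε ^ 3) ∧
      (fun ε => ε • til (r ^ 2 • trig φ (c.defect₁ m lam om θ))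
        + ε ^ 2 • til (r ^ 3 • trig φ (c.defect₂ m lam om β θ)))
        =O[nhdsWithin 0 {0}ᶜ] (fun ε : ℝ => ε ^ 2)) := by
  obtain ⟨ρ, hρ, h⟩ := c.exists_error_expansion hG hp hq h₁ h₂ β θ r φ
  exact isBigO_iff_of_near_identity (c.isBigO_transDeriv θ _ _) hρ h

theorem hat_error (hR : S.alphaR lam = 0) (hI : S.alphaI lam = om) (β : ℝ × ℝ) (θ r φ ε : ℝ) :
    hat (c.error S lam om β θ r φ ε) =
      hat (c.Gdag S (Sum.elim ![r * cos φ, r * sin φ] 0) lam θ ε)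
        - (rot (S.alphaR lam) (S.alphaI lam) *ᵥ ![r * cos φ, r * sin φ]
          + ε ^ 2 • ((![r * cos φ, r * sin φ] 0 ^ 2 + ![r * cos φ, r * sin φ] 1 ^ 2) •
            (rot β.1 β.2 *ᵥ ![r * cos φ, r * sin φ]))) := by
  have h0 : r • aStar φ = (Sum.elim ![r * cos φ, r * sin φ] 0 : State k) := by
    refine state_ext ?_ ?_ fun i => ?_ <;> simp [aStar]
  have h := sin_sq_add_cos_sq φ
  rw [error, h0, hR, hI]
  have h1 : hat (k := k) (om • r • trig φ (dphi (kap (1, 0)))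
      + (ε ^ 2 * r ^ 3) • trig φ (kap β)) = rot 0 om *ᵥ ![r * cos φ, r * sin φ]
          + ε ^ 2 • ((![r * cos φ, r * sin φ] 0 ^ 2 + ![r * cos φ, r * sin φ] 1 ^ 2) •
            (rot β.1 β.2 *ᵥ ![r * cos φ, r * sin φ])) := by
    have h2 : ![r * cos φ, r * sin φ] 0 ^ 2 + ![r * cos φ, r * sin φ] 1 ^ 2 = r ^ 2 := by
      simp only [Matrix.cons_val_zero, Matrix.cons_val_one]
      linear_combination r ^ 2 * h
    rw [h2, dphi_kap, trig_apply', trig_apply', kap_apply, kap_apply]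
    funext i
    fin_cases i <;> simp [hat, rot, Matrix.mulVec, dotProduct, Fin.sum_univ_two] <;> ring
  rw [← h1]
  rfl

theorem til_error (β : ℝ × ℝ) (θ r φ ε : ℝ) : til (c.error S lam om β θ r φ ε) =
      til (c.Gdag S (Sum.elim ![r * cos φ, r * sin φ] 0) lam θ ε) := by
  have h0 : r • aStar φ = (Sum.elim ![r * cos φ, r * sin φ] 0 : State k) := by
    refine state_ext ?_ ?_ fun i => ?_ <;> simp [aStar]
  rw [error, h0, dphi_kap, trig_apply', trig_apply', kap_apply, kap_apply]
  funext i
  simp [til]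

theorem exists_polar (y : Fin 2 → ℝ) : ∃ r φ : ℝ, y = ![r * cos φ, r * sin φ] := by
  let z : ℂ := ⟨y 0, y 1⟩
  refine ⟨‖z‖, Complex.arg z, ?_⟩
  rw [Complex.norm_mul_cos_arg, Complex.norm_mul_sin_arg]
  funext i
  fin_cases i <;> rfl

theorem ell_coef₂ (θ : ℝ) : ell (c.coef₂ θ)
    = ((c.ha1 θ 0 + c.hb1 θ 1) / 2, (c.ha1 θ 1 - c.hb1 θ 0) / 2) := by
  simp [ell_apply, coef₂]

theorem integral_ell_coef₂ (h : Continuous c.coef₂) : ∫ θ in (0 : ℝ)..2 * π, ell (c.coef₂ θ)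
    = ((∫ θ in (0 : ℝ)..2 * π, (c.ha1 θ 0 + c.hb1 θ 1)) / 2,
      (∫ θ in (0 : ℝ)..2 * π, (c.ha1 θ 1 - c.hb1 θ 0)) / 2) := by
  have h1 : Continuous fun θ => ell (c.coef₂ θ) := by fun_prop
  have a := (ContinuousLinearMap.fst ℝ ℝ ℝ).intervalIntegral_comp_comm
    (h1.intervalIntegrable (μ := MeasureTheory.volume) 0 (2 * π))
  have b := (ContinuousLinearMap.snd ℝ ℝ ℝ).intervalIntegral_comp_comm
    (h1.intervalIntegrable (μ := MeasureTheory.volume) 0 (2 * π))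
  simp only [ell_coef₂, ContinuousLinearMap.coe_fst', ContinuousLinearMap.coe_snd',
    intervalIntegral.integral_div] at a b
  simp only [ell_coef₂]
  exact Prod.ext a.symm b.symm

variable {c}

theorem IsNormalForm.contDiff_coef₁ {bR bI : ℝ} (h : c.IsNormalForm S lam bR bI) :
    ContDiff ℝ ∞ c.coef₁ := by
  have hh := h.smooth_hat
  have ht := h.smooth_til
  have he : ∀ {f : ℝ → Fin 2 → ℝ} {g : ℝ → Fin k → ℝ}, ContDiff ℝ ∞ f → ContDiff ℝ ∞ g →
      ContDiff ℝ ∞ fun θ => (Sum.elim (f θ) (g θ) : State k) := fun hf hg =>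
    contDiff_pi.2 fun i => by
      rcases i with i | i
      · exact contDiff_pi.1 hf i
      · exact contDiff_pi.1 hg i
  refine contDiff_pi.2 fun j => ?_
  fin_cases j
  exacts [he (hh c.ha0 (by simp)) (ht c.ta0 (by simp)), contDiff_const, contDiff_const,
    he (hh c.ha2 (by simp)) (ht c.ta2 (by simp)), he (hh c.hb2 (by simp)) (ht c.tb2 (by simp)),
    contDiff_const, contDiff_const]

theorem IsNormalForm.contDiff_coef₂ {bR bI : ℝ} (h : c.IsNormalForm S lam bR bI) :
    ContDiff ℝ ∞ c.coef₂ := by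
  have hh := h.smooth_hat
  have he : ∀ {f : ℝ → Fin 2 → ℝ}, ContDiff ℝ ∞ f →
      ContDiff ℝ ∞ fun θ => (Sum.elim (f θ) 0 : State k) := fun hf =>
    contDiff_pi.2 fun i => by
      rcases i with i | i
      · exact contDiff_pi.1 hf i
      · exact contDiff_const
  refine contDiff_pi.2 fun j => ?_
  fin_cases j
  exacts [contDiff_const, he (hh c.ha1 (by simp)), he (hh c.hb1 (by simp)), contDiff_const,
    contDiff_const, he (hh c.ha3 (by simp)), he (hh c.hb3 (by simp))]

/-- On the unit circle the powers `ε` and `ε²` must drop out of the critical components, but only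
`ε` out of the others; so the second defect is zero only after projection. A trigonometric
polynomial that vanishes for all `φ` has zero coefficients. -/
theorem IsNormalForm.defect_eq_zero {bR bI : ℝ} (h : c.IsNormalForm S lam bR bI)
    (hG : ∀ z θ ε, ε ≠ 0 → S.G z lam θ ε = m.g z lam θ ε) (hp : m.p lam = 0) (hq : m.q lam = om)
    (hR : S.alphaR lam = 0) (hI : S.alphaI lam = om) (θ : ℝ) :
    c.defect₁ m lam om θ = 0 ∧ critProj (c.defect₂ m lam om (bR, bI) θ) = 0 := by
  have key : ∀ φ, trig φ (c.defect₁ m lam om θ) = 0 ∧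
      hat (trig φ (c.defect₂ m lam om (bR, bI) θ)) = 0 := by
    intro φ
    have h1 := h.hat_terms ![1 * cos φ, 1 * sin φ] θ
    have h2 := h.til_terms ![1 * cos φ, 1 * sin φ] θ
    have h3 := (c.isBigO_error_iff hG hp hq (h.contDiff_coef₁.differentiable (by simp))
      (h.contDiff_coef₂.differentiable (by simp)) (bR, bI) θ 1 φ).1
      ⟨by simpa only [c.hat_error hR hI] using h1, by simpa only [c.til_error] using h2⟩
    simp only [one_pow, one_smul] at h3
    obtain ⟨a1, a2⟩ := eq_zero_of_isBigO_cube h3.1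
    have a3 := eq_zero_of_isBigO_sq h3.2
    refine ⟨?_, a2⟩
    rw [← elim_hat_til (trig φ (c.defect₁ m lam om θ)), a1, a3]
    funext i
    rcases i with i | i <;> rfl
  refine ⟨eq_of_trig_eq fun φ => ?_, eq_of_trig_eq fun φ => ?_⟩
  · rw [(key φ).1, map_zero]
  · rw [trig_critProj, (key φ).2, map_zero]
    funext i
    rcases i with i | i <;> rfl

/-- `coef₁` has no mode one, so the mean condition is automatic. -/
theorem IsNormalForm.isPerSol₁ {bR bI : ℝ} (h : c.IsNormalForm S lam bR bI)
    (hd : ∀ θ, c.defect₁ m lam om θ = 0) :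
    IsPerSol (linOp (m.L lam) om) kap ell (m.quad lam) c.coef₁ 0 where
  periodic θ := by
    have hh := fun f hf => h.periodic_hat f hf θ
    have ht := fun f hf => h.periodic_til f hf θ
    simp only [coef₁]
    rw [hh c.ha0 (by simp), ht c.ta0 (by simp), hh c.ha2 (by simp), ht c.ta2 (by simp),
      hh c.hb2 (by simp), ht c.tb2 (by simp)]
  hasDerivAt θ := by
    refine (h.contDiff_coef₁.differentiable (by simp) θ).hasDerivAt.congr_deriv ?_
    rw [map_zero, add_zero]
    exact (sub_eq_zero.1 (hd θ)).symm
  mean := by simp [ell_apply, coef₁]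

theorem critProj_coef₂ (θ : ℝ) : critProj (c.coef₂ θ) = c.coef₂ θ := by
  funext j
  rw [critProj_apply, coef₂]
  fin_cases j <;> refine state_ext ?_ ?_ fun i => ?_ <;> simp [hat]

/-- The projection commutes with the linear problem, and the two integral restrictions are the mean
condition for `ell`. -/
theorem IsNormalForm.isPerSol₂ {bR bI : ℝ} (h : c.IsNormalForm S lam bR bI)
    (hd : ∀ θ, critProj (c.defect₂ m lam om (bR, bI) θ) = 0) :
    IsPerSol (linOp (m.L lam) om) kap ell (fun θ => critProj (m.cubic lam (c.coef₁ θ) θ)) c.coef₂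
      (-(bR, bI)) where
  periodic θ := by
    have hh := fun f hf => h.periodic_hat f hf θ
    simp only [coef₂]
    rw [hh c.ha1 (by simp), hh c.hb1 (by simp), hh c.ha3 (by simp), hh c.hb3 (by simp)]
  hasDerivAt θ := by
    have h1 := (h.contDiff_coef₂.differentiable (by simp) θ).hasDerivAt
    have h2 : critProj (deriv c.coef₂ θ) = deriv c.coef₂ θ := by
      have h3 := critProj.hasFDerivAt.comp_hasDerivAt θ h1
      rw [show (critProj ∘ c.coef₂ : ℝ → Fin 7 → State k) = c.coef₂ from
        funext fun θ => critProj_coef₂ θ] at h3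
      exact h3.unique h1
    refine h1.congr_deriv ?_
    have h4 := hd θ
    rw [defect₂, map_sub, map_sub, map_add, critProj_linOp, critProj_kap, critProj_coef₂, h2,
      sub_eq_zero] at h4
    rw [← h4, map_neg]
    abel
  mean := by
    have r1 := h.restriction₁
    have r2 := h.restriction₂
    have hpi : (1 / (2 * π)) ≠ 0 := by positivity
    rw [c.integral_ell_coef₂ h.contDiff_coef₂.continuous, (mul_eq_zero.1 r1).resolve_left hpi,
      (mul_eq_zero.1 r2).resolve_left hpi]
    simp

/-- The coefficients of a normal form transformation are unique. -/
theorem IsNormalForm.eq_formal {bR bI : ℝ} (h : c.IsNormalForm S lam bR bI)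
    (hA : IsNonresonant (linOp (m.L lam) om) kap ell) (s : m.Formal lam om)
    (hG : ∀ z θ ε, ε ≠ 0 → S.G z lam θ ε = m.g z lam θ ε) (hp : m.p lam = 0) (hq : m.q lam = om)
    (hR : S.alphaR lam = 0) (hI : S.alphaI lam = om) :
    c.coef₁ = s.w₁ ∧ (∀ θ, c.coef₂ θ = critProj (s.w₂ θ)) ∧ (bR, bI) = s.β := by
  have hd := h.defect_eq_zero hG hp hq hR hI
  have h1 := (h.isPerSol₁ fun θ => (hd θ).1).sub s.sol₁
  simp only [sub_self] at h1
  have h2 : c.coef₁ = s.w₁ := funext fun θ => sub_eq_zero.1 ((h1.eq_zero hA).2 θ)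
  have h3 := h.isPerSol₂ fun θ => (hd θ).2
  have h4 := s.sol₂.map (T := critProj) (U := 1) (critProj_linOp m lam om) (critProj_kap)
    (ell_critProj)
  have h5 := h3.sub h4
  simp only [h2, sub_self] at h5
  obtain ⟨h6, h7⟩ := h5.eq_zero hA
  refine ⟨h2, fun θ => sub_eq_zero.1 (h7 θ), ?_⟩
  rw [one_apply_eq_self, sub_eq_zero] at h6
  exact neg_injective h6

/-- The normal form transformation given by the leading terms of the Galerkin solution. -/
def ofFormal (s : m.Formal lam om) : NFCoeffs k where
  ha0 θ := hat (s.w₁ θ 0)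
  ha1 θ := hat (s.w₂ θ 1)
  hb1 θ := hat (s.w₂ θ 2)
  ha2 θ := hat (s.w₁ θ 3)
  hb2 θ := hat (s.w₁ θ 4)
  ha3 θ := hat (s.w₂ θ 5)
  hb3 θ := hat (s.w₂ θ 6)
  ta0 θ := til (s.w₁ θ 0)
  ta2 θ := til (s.w₁ θ 3)
  tb2 θ := til (s.w₁ θ 4)

/-- Parity makes `w₁` vanish in exactly the modes that `coef₁` sets to zero. -/
theorem coef₁_ofFormal (s : m.Formal lam om) : (ofFormal s).coef₁ = s.w₁ := by
  funext θ
  have h := s.parity₁ θ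
  rw [parity_apply] at h
  have h1 : ∀ j, (s.w₁ θ) j = -(s.w₁ θ) j → 0 = s.w₁ θ j := fun j h => (self_eq_neg.1 h).symm
  funext j
  fin_cases j
  exacts [elim_hat_til _, h1 1 (congrFun h 1), h1 2 (congrFun h 2), elim_hat_til _,
    elim_hat_til _, h1 5 (congrFun h 5), h1 6 (congrFun h 6)]

theorem coef₂_ofFormal (s : m.Formal lam om) (θ : ℝ) :
    (ofFormal s).coef₂ θ = critProj (s.w₂ θ) := by
  have h := s.parity₂ θ
  rw [parity_apply] at h
  have h1 : ∀ j, -(s.w₂ θ) j = (s.w₂ θ) j → s.w₂ θ j = 0 := fun j h => neg_eq_self.1 h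
  have h2 : ∀ j, s.w₂ θ j = 0 → (0 : State k) = Sum.elim (hat (s.w₂ θ j)) 0 := fun j h => by
    rw [h]
    funext i
    rcases i with i | i <;> rfl
  funext j
  rw [critProj_apply]
  fin_cases j
  exacts [h2 0 (h1 0 (congrFun h 0)), rfl, rfl, h2 3 (h1 3 (congrFun h 3)),
    h2 4 (h1 4 (congrFun h 4)), rfl, rfl]

/-- Polar coordinates reduce the conditions at `y` to a circle, where `isBigO_error_iff` turns them
into conditions on the defects, met by the equations of `w₁` and of the projected `w₂`. The
hyperbolic part of the second defect may remain, since only `O(ε²)` is asked there. -/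
theorem isNormalForm_ofFormal (s : m.Formal lam om)
    (hG : ∀ z θ ε, ε ≠ 0 → S.G z lam θ ε = m.g z lam θ ε) (hp : m.p lam = 0) (hq : m.q lam = om)
    (hR : S.alphaR lam = 0) (hI : S.alphaI lam = om) :
    (ofFormal s).IsNormalForm S lam s.β.1 s.β.2 := by
  have c₁ := coef₁_ofFormal s
  have c₂ : (ofFormal s).coef₂ = fun θ => critProj (s.w₂ θ) := funext (coef₂_ofFormal s)
  have s₂ : ContDiff ℝ ∞ fun θ => critProj (s.w₂ θ) := critProj.contDiff.comp s.smooth₂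
  have sol₂ := s.sol₂.map (T := critProj) (U := 1) (critProj_linOp m lam om) (critProj_kap)
    (ell_critProj)
  have hmean := (ofFormal s).integral_ell_coef₂ (by rw [c₂]; exact s₂.continuous)
  rw [c₂, sol₂.mean] at hmean
  have d₁ : ∀ θ, (ofFormal s).defect₁ m lam om θ = 0 := fun θ => by
    rw [defect₁, c₁, (s.sol₁.hasDerivAt θ).deriv, map_zero]; abel
  have d₂ : ∀ θ, critProj ((ofFormal s).defect₂ m lam om s.β θ) = 0 := fun θ => by
    rw [defect₂, c₁, c₂, (sol₂.hasDerivAt θ).deriv]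
    simp only [one_apply_eq_self, map_sub, map_add, map_neg, critProj_kap, critProj_linOp]
    have h : ∀ u : Fin 7 → State k, critProj (critProj u) = critProj u := fun u => by
      funext j; simp only [critProj_apply]; rfl
    simp only [h]
    abel
  have hterms : ∀ (y : Fin 2 → ℝ) (θ : ℝ), ∃ r φ : ℝ, y = ![r * cos φ, r * sin φ] ∧
      (fun ε => hat ((ofFormal s).error S lam om s.β θ r φ ε))
        =O[nhdsWithin 0 {0}ᶜ] (fun ε : ℝ => ε ^ 3) ∧
      (fun ε => til ((ofFormal s).error S lam om s.β θ r φ ε))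
        =O[nhdsWithin 0 {0}ᶜ] (fun ε : ℝ => ε ^ 2) := by
    intro y θ
    obtain ⟨r, φ, hy⟩ := exists_polar y
    refine ⟨r, φ, hy, ((ofFormal s).isBigO_error_iff hG hp hq
      (by rw [c₁]; exact s.smooth₁.differentiable (by simp))
      (by rw [c₂]; exact s₂.differentiable (by simp)) s.β θ r φ).2 ?_⟩
    rw [d₁, map_zero, smul_zero]
    have e1 : hat (r ^ 3 • trig φ ((ofFormal s).defect₂ m lam om s.β θ)) = 0 := by
      have h := trig_critProj φ ((ofFormal s).defect₂ m lam om s.β θ)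
      rw [d₂, map_zero] at h
      funext i
      have := congrFun h (Sum.inl i)
      simp only [Pi.zero_apply, Sum.elim_inl] at this
      simp only [hat, Pi.smul_apply, Pi.zero_apply] at this ⊢
      rw [← this, smul_zero]
    rw [e1, show hat (0 : State k) = 0 from rfl, show til (0 : State k) = 0 from rfl]
    simp only [smul_zero, add_zero, zero_add]
    exact ⟨Asymptotics.isBigO_zero _ _, isBigO_sq_smul _⟩
  refine ⟨?_, ?_, ?_, ?_, ?_, ?_, fun y θ => ?_, fun y θ => ?_⟩
  · simp only [Set.mem_insert_iff, Set.mem_singleton_iff]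
    have a₁ := fun j => (hatL.contDiff (n := ∞)).comp (contDiff_pi.1 s.smooth₁ j)
    have a₂ := fun j => (hatL.contDiff (n := ∞)).comp (contDiff_pi.1 s.smooth₂ j)
    rintro f (rfl | rfl | rfl | rfl | rfl | rfl | rfl)
    exacts [a₁ 0, a₂ 1, a₂ 2, a₁ 3, a₁ 4, a₂ 5, a₂ 6]
  · simp only [Set.mem_insert_iff, Set.mem_singleton_iff]
    have a₁ := fun j => (tilL.contDiff (n := ∞)).comp (contDiff_pi.1 s.smooth₁ j)
    rintro f (rfl | rfl | rfl)
    exacts [a₁ 0, a₁ 3, a₁ 4]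
  · simp only [Set.mem_insert_iff, Set.mem_singleton_iff]
    rintro f (rfl | rfl | rfl | rfl | rfl | rfl | rfl) θ <;>
      simp only [ofFormal, s.sol₁.periodic θ, s.sol₂.periodic θ]
  · simp only [Set.mem_insert_iff, Set.mem_singleton_iff]
    rintro f (rfl | rfl | rfl) θ <;> simp only [ofFormal, s.sol₁.periodic θ]
  · have h := (Prod.ext_iff.1 hmean).1
    simp only [Prod.fst_zero] at h
    rw [show (∫ θ in (0 : ℝ)..2 * π, ((ofFormal s).ha1 θ 0 + (ofFormal s).hb1 θ 1)) = 0 by linarith,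
      mul_zero]
  · have h := (Prod.ext_iff.1 hmean).2
    simp only [Prod.snd_zero] at h
    rw [show (∫ θ in (0 : ℝ)..2 * π, ((ofFormal s).ha1 θ 1 - (ofFormal s).hb1 θ 0)) = 0 by linarith,
      mul_zero]
  · obtain ⟨r, φ, rfl, h, -⟩ := hterms y θ
    simpa only [(ofFormal s).hat_error hR hI] using h
  · obtain ⟨r, φ, rfl, -, h⟩ := hterms y θ
    simpa only [(ofFormal s).til_error] using h

end NFCoeffs

end NormalFormSolution

/-! ### Transfer of the error bounds to the coefficients. -/

section Estimates

variable {k : ℕ}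

theorem norm_hat_apply_le (u : Fin 7 → State k) (j : Fin 7) : ‖hat (u j)‖ ≤ ‖u‖ :=
  (pi_norm_le_iff_of_nonneg (norm_nonneg _)).2 fun i =>
    (norm_le_pi_norm (u j) (Sum.inl i)).trans (norm_le_pi_norm u j)

theorem norm_til_apply_le (u : Fin 7 → State k) (j : Fin 7) : ‖til (u j)‖ ≤ ‖u‖ :=
  (pi_norm_le_iff_of_nonneg (norm_nonneg _)).2 fun i =>
    (norm_le_pi_norm (u j) (Sum.inr i)).trans (norm_le_pi_norm u j)

/-- On odd modes `1 + parity` is multiplication by two, so the bound on the symmetrized error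
controls the coefficient itself. -/
theorem norm_hat_apply_le_parity (u : Fin 7 → State k) {j : Fin 7} (h : parity u j = u j) :
    ‖hat (u j)‖ ≤ ‖u + parity u‖ := by
  have h1 := norm_hat_apply_le (u + parity u) j
  rw [Pi.add_apply, h, show hat (u j + u j) = (2 : ℝ) • hat (u j) from (two_smul ℝ _).symm,
    norm_smul, norm_two] at h1
  linarith [norm_nonneg (hat (u j))]

theorem c1Le_of_error {d : ℕ} {g : ℝ → Fin d → ℝ} {P : (Fin 7 → State k) →L[ℝ] (Fin d → ℝ)}
    {e : ℝ → Fin 7 → State k} {a D M : ℝ} (he : Differentiable ℝ e)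
    (hg : ∀ θ, g θ = -(a • P (e θ))) (h0 : ∀ θ, ‖P (e θ)‖ ≤ D) (h1 : ∀ θ, ‖P (deriv e θ)‖ ≤ D)
    (hM : |a| * D ≤ M) : C1Le g M := by
  intro θ
  have hd : HasDerivAt g (-(a • P (deriv e θ))) θ := by
    rw [funext hg]
    exact ((P.hasFDerivAt.comp_hasDerivAt θ (he θ).hasDerivAt).const_smul a).neg
  rw [hd.deriv, hg, norm_neg, norm_neg, norm_smul, norm_smul, norm_eq_abs]
  constructor
  · refine le_trans ?_ hM
    gcongr
    exact h0 θ
  · refine le_trans ?_ hM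
    gcongr
    exact h1 θ

/-- The critical components of the `j`-th Fourier coefficient. -/
def hatProj (j : Fin 7) : (Fin 7 → State k) →L[ℝ] (Fin 2 → ℝ) :=
  hatL.comp (ContinuousLinearMap.proj j)

/-- The hyperbolic components of the `j`-th Fourier coefficient. -/
def tilProj (j : Fin 7) : (Fin 7 → State k) →L[ℝ] (Fin k → ℝ) :=
  tilL.comp (ContinuousLinearMap.proj j)

namespace Model.Formal

variable {m : Model k} {lam om : ℝ} (s : m.Formal lam om)

theorem apply₂_eq_zero (θ : ℝ) {j : Fin 7} (hj : ∀ u : Fin 7 → State k, parity u j = -u j) :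
    s.w₂ θ j = 0 := by
  have h := congrFun (s.parity₂ θ) j
  rw [hj] at h
  exact neg_eq_self.1 h

theorem apply₁_eq_zero (θ : ℝ) {j : Fin 7} (hj : ∀ u : Fin 7 → State k, parity u j = u j) :
    s.w₁ θ j = 0 := by
  have h := congrFun (s.parity₁ θ) j
  rw [hj] at h
  exact self_eq_neg.1 h

/-- `w₂` has no even modes, so there the approximation is `ε w₁` alone. -/
theorem sub_even {ε : ℝ} (hε : ε ≠ 0) (w : ℝ → Fin 7 → State k)
    (θ : ℝ) {j : Fin 7} (hj : ∀ u : Fin 7 → State k, parity u j = -u j) :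
    s.w₁ θ j - ε⁻¹ • w θ j = -(ε⁻¹ • (w θ - s.approx ε θ) j) := by
  simp only [approx, Pi.sub_apply, Pi.add_apply, Pi.smul_apply, s.apply₂_eq_zero θ hj, smul_zero,
    add_zero, smul_sub, smul_smul, inv_mul_cancel₀ hε, one_smul]
  abel

theorem sub_odd {ε : ℝ} (hε : ε ≠ 0) (w : ℝ → Fin 7 → State k)
    (θ : ℝ) {j : Fin 7} (hj : ∀ u : Fin 7 → State k, parity u j = u j) :
    s.w₂ θ j - (ε ^ 2)⁻¹ • w θ j = -((ε ^ 2)⁻¹ • (w θ - s.approx ε θ) j) := by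
  simp only [approx, Pi.sub_apply, Pi.add_apply, Pi.smul_apply, s.apply₁_eq_zero θ hj, smul_zero,
    zero_add, smul_sub, smul_smul, inv_mul_cancel₀ (pow_ne_zero 2 hε), one_smul]
  abel

end Model.Formal

theorem parity_even {j : Fin 7} (hj : j = 0 ∨ j = 3 ∨ j = 4) (u : Fin 7 → State k) :
    parity u j = -u j := by
  rw [parity_apply]
  rcases hj with rfl | rfl | rfl <;> rfl

theorem parity_odd {j : Fin 7} (hj : j = 1 ∨ j = 2 ∨ j = 5 ∨ j = 6) (u : Fin 7 → State k) :
    parity u j = u j := by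
  rw [parity_apply]
  rcases hj with rfl | rfl | rfl | rfl <;> rfl

namespace NFCoeffs

variable {m : Model k} {lam om : ℝ} {s : m.Formal lam om} {ε C : ℝ} {w : ℝ → Fin 7 → State k}

theorem c1Le_hat_even {f : ℝ → Fin 2 → ℝ} {j : Fin 7} (hj : j = 0 ∨ j = 3 ∨ j = 4)
    (hf : ∀ θ, f θ = hat (s.w₁ θ j)) (hε : ε ≠ 0)
    (hw : Differentiable ℝ fun t => w t - s.approx ε t)
    (h0 : ∀ θ, ‖w θ - s.approx ε θ‖ ≤ C * |ε| ^ 3)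
    (h1 : ∀ θ, ‖deriv (fun t => w t - s.approx ε t) θ‖ ≤ C * |ε| ^ 3) :
    C1Le (fun θ => f θ - ε⁻¹ • hat (w θ j)) (C * ε ^ 2) := by
  refine c1Le_of_error (P := hatProj j) hw (a := ε⁻¹) (fun θ => ?_)
    (fun θ => (norm_hat_apply_le _ j).trans (h0 θ)) (fun θ => (norm_hat_apply_le _ j).trans (h1 θ))
    (le_of_eq ?_)
  · rw [hf]
    exact congrArg hat (s.sub_even hε w θ (parity_even hj))
  · have := abs_pos.2 hε
    rw [abs_inv, ← sq_abs]
    field_simp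

theorem c1Le_til_even {f : ℝ → Fin k → ℝ} {j : Fin 7} (hj : j = 0 ∨ j = 3 ∨ j = 4)
    (hf : ∀ θ, f θ = til (s.w₁ θ j)) (hε : ε ≠ 0)
    (hw : Differentiable ℝ fun t => w t - s.approx ε t)
    (h0 : ∀ θ, ‖w θ - s.approx ε θ‖ ≤ C * |ε| ^ 3)
    (h1 : ∀ θ, ‖deriv (fun t => w t - s.approx ε t) θ‖ ≤ C * |ε| ^ 3) :
    C1Le (fun θ => f θ - ε⁻¹ • til (w θ j)) (C * ε ^ 2) := by
  refine c1Le_of_error (P := tilProj j) hw (a := ε⁻¹) (fun θ => ?_)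
    (fun θ => (norm_til_apply_le _ j).trans (h0 θ)) (fun θ => (norm_til_apply_le _ j).trans (h1 θ))
    (le_of_eq ?_)
  · rw [hf]
    exact congrArg til (s.sub_even hε w θ (parity_even hj))
  · have := abs_pos.2 hε
    rw [abs_inv, ← sq_abs]
    field_simp

/-- After division by `ε²` the plain error `O(ε³)` would leave only `O(ε)`; the symmetrized bound
`O(ε⁴)` gives the stated order. -/
theorem c1Le_hat_odd {f : ℝ → Fin 2 → ℝ} {j : Fin 7} (hj : j = 1 ∨ j = 2 ∨ j = 5 ∨ j = 6)
    (hf : ∀ θ, f θ = hat (s.w₂ θ j)) (hε : ε ≠ 0)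
    (hw : Differentiable ℝ fun t => w t - s.approx ε t)
    (h0 : ∀ θ, ‖w θ - s.approx ε θ + parity (w θ - s.approx ε θ)‖ ≤ C * |ε| ^ 4)
    (h1 : ∀ θ, ‖deriv (fun t => w t - s.approx ε t) θ
      + parity (deriv (fun t => w t - s.approx ε t) θ)‖ ≤ C * |ε| ^ 4) :
    C1Le (fun θ => f θ - (ε ^ 2)⁻¹ • hat (w θ j)) (C * ε ^ 2) := by
  refine c1Le_of_error (P := hatProj j) hw (a := (ε ^ 2)⁻¹) (fun θ => ?_)
    (fun θ => (norm_hat_apply_le_parity _ (parity_odd hj _)).trans (h0 θ))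
    (fun θ => (norm_hat_apply_le_parity _ (parity_odd hj _)).trans (h1 θ)) (le_of_eq ?_)
  · rw [hf]
    exact congrArg hat (s.sub_odd hε w θ (parity_odd hj))
  · have := abs_pos.2 hε
    rw [abs_inv, abs_pow, ← sq_abs ε]
    field_simp

end NFCoeffs

/-- The coefficients are recovered from `z - a⋆` by `coef`, whose norm on bounded functions is at
most two. -/
theorem norm_le_of_near {s : FourierTorus k} {lamStar omStar δ : ℝ} (h : s.Near lamStar omStar δ)
    (θ : ℝ) : ‖s.toCoef θ‖ ≤ 2 * δ := by
  rw [← coef_trig (s.toCoef θ)]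
  refine norm_coef_le fun φ _ => ?_
  have h1 := h.2.2 θ φ
  rw [s.z_eq, map_add, ← aStar_eq, add_sub_cancel_left] at h1
  exact h1.le

end Estimates

end NeimarkSacker

end

/-! ### Assembly of the main theorem. -/

theorem mainTheorem1 (k : ℕ) (S : NeimarkSacker.ForcedSystem k) (lamStar omStar : ℝ)
    (hNS : S.IsNeimarkSackerPoint lamStar omStar)
    (hres : omStar ≠ 1 / 3 ∧ omStar ≠ 1 / 4) :
    (∃ (c : NeimarkSacker.NFCoeffs k) (betaR betaI : ℝ),
      c.IsNormalForm S lamStar betaR betaI) ∧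
    ∃ δ > (0 : ℝ), ∃ ε₀ > (0 : ℝ), ∃ zF : ℝ → NeimarkSacker.FourierTorus k,
      (∀ ε : ℝ, 0 < |ε| → |ε| < ε₀ →
        (zF ε).Solves S ε ∧ (zF ε).Near lamStar omStar δ ∧
        ∀ s : NeimarkSacker.FourierTorus k,
          s.Solves S ε → s.Near lamStar omStar δ → s = zF ε) ∧
      ∀ (c : NeimarkSacker.NFCoeffs k) (betaR betaI : ℝ),
        c.IsNormalForm S lamStar betaR betaI →
        ∃ C : ℝ, ∀ ε : ℝ, 0 < |ε| → |ε| < ε₀ →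
          |betaR - (-deriv S.alphaR lamStar * (((zF ε).lam - lamStar) / ε ^ 2))| ≤ C * ε ^ 2 ∧
          |betaI - (((zF ε).om - omStar) / ε ^ 2
            - deriv S.alphaI lamStar * (((zF ε).lam - lamStar) / ε ^ 2))| ≤ C * ε ^ 2 ∧
          NeimarkSacker.C1Le
            (fun θ => c.ha0 θ - ε⁻¹ • NeimarkSacker.hat ((zF ε).a0 θ)) (C * ε ^ 2) ∧
          NeimarkSacker.C1Le
            (fun θ => c.ha2 θ - ε⁻¹ • NeimarkSacker.hat ((zF ε).a2 θ)) (C * ε ^ 2) ∧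
          NeimarkSacker.C1Le
            (fun θ => c.hb2 θ - ε⁻¹ • NeimarkSacker.hat ((zF ε).b2 θ)) (C * ε ^ 2) ∧
          NeimarkSacker.C1Le
            (fun θ => c.ta0 θ - ε⁻¹ • NeimarkSacker.til ((zF ε).a0 θ)) (C * ε ^ 2) ∧
          NeimarkSacker.C1Le
            (fun θ => c.ta2 θ - ε⁻¹ • NeimarkSacker.til ((zF ε).a2 θ)) (C * ε ^ 2) ∧
          NeimarkSacker.C1Le
            (fun θ => c.tb2 θ - ε⁻¹ • NeimarkSacker.til ((zF ε).b2 θ)) (C * ε ^ 2) ∧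
          NeimarkSacker.C1Le
            (fun θ => c.ha1 θ - (ε ^ 2)⁻¹ • NeimarkSacker.hat ((zF ε).a1 θ)) (C * ε ^ 2) ∧
          NeimarkSacker.C1Le
            (fun θ => c.hb1 θ - (ε ^ 2)⁻¹ • NeimarkSacker.hat ((zF ε).b1 θ)) (C * ε ^ 2) ∧
          NeimarkSacker.C1Le
            (fun θ => c.ha3 θ - (ε ^ 2)⁻¹ • NeimarkSacker.hat ((zF ε).a3 θ)) (C * ε ^ 2) ∧
          NeimarkSacker.C1Le
            (fun θ => c.hb3 θ - (ε ^ 2)⁻¹ • NeimarkSacker.hat ((zF ε).b3 θ)) (C * ε ^ 2) := by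
  obtain ⟨m, r, hr, hm⟩ := NeimarkSacker.exists_model hNS
  obtain ⟨hmp, hmq, hmB, hG⟩ := hm lamStar (by simpa using hr)
  have hp : m.p lamStar = 0 := hmp.trans hNS.alphaR_star
  have hq : m.q lamStar = omStar := hmq.trans hNS.alphaI_star
  have hnear : ∀ᶠ lam in nhds lamStar, |lam - lamStar| < r := by
    filter_upwards [Metric.ball_mem_nhds lamStar hr] with lam h
    rwa [Metric.mem_ball, Real.dist_eq] at h
  have hdp : deriv m.p lamStar = deriv S.alphaR lamStar :=
    Filter.EventuallyEq.deriv_eq (hnear.mono fun lam h => (hm lam h).1)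
  have hdq : deriv m.q lamStar = deriv S.alphaI lamStar :=
    Filter.EventuallyEq.deriv_eq (hnear.mono fun lam h => (hm lam h).2.1)
  have ha : deriv m.p lamStar ≠ 0 := hdp ▸ hNS.transversal
  have hA : NeimarkSacker.IsNonresonant (NeimarkSacker.linOp (m.L lamStar) omStar)
      NeimarkSacker.kap NeimarkSacker.ell := by
    rw [NeimarkSacker.Model.L, hp, hq, hmB]
    exact NeimarkSacker.isNonresonant_linOp hNS.omStar_pos hNS.omStar_lt hres.1 hres.2
      hNS.hyperbolic
  obtain ⟨F⟩ := m.exists_formal lamStar hA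
  refine ⟨⟨NeimarkSacker.NFCoeffs.ofFormal F, F.β.1, F.β.2,
    NeimarkSacker.NFCoeffs.isNormalForm_ofFormal F hG hp hq hNS.alphaR_star hNS.alphaI_star⟩, ?_⟩
  obtain ⟨δ₀, hδ₀, C, hC, ε₁, hε₁, sol, hsol⟩ := F.exists_branch hA hp hq ha
  -- Within `r` the model agrees with the given system. The half is needed because a torus within
  -- `δ` of `a⋆` has coefficients bounded by `2 δ`.
  let δ := min r (δ₀ / 2)
  have hδ : 0 < δ := by positivity
  have hδr : δ ≤ r := min_le_left _ _
  have hδδ : δ ≤ δ₀ / 2 := min_le_right _ _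
  let zF : ℝ → NeimarkSacker.FourierTorus k := fun ε =>
    NeimarkSacker.FourierTorus.ofCoef (lamStar + (sol ε).2.1) (omStar + (sol ε).2.2) (sol ε).1
  -- The `7` counts the monomials in `norm_trig_le`. The same `C` serves every normal form because
  -- the coefficients are unique.
  refine ⟨δ, hδ, min ε₁ (δ / (7 * C + 1)), by positivity, zF, fun ε hε0 hε => ?_,
    fun c betaR betaI hc => ⟨C, fun ε hε0 hε => ?_⟩⟩
  · have hε' : ε ≠ 0 := abs_pos.1 hε0
    have hεδ := hε.trans_le (min_le_right _ _)
    rw [lt_div_iff₀ (by positivity)] at hεδ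
    have hCδ : 7 * (C * |ε|) < δ := by linarith
    have hCδ' : C * |ε| < δ := by linarith [mul_nonneg hC hε0.le]
    obtain ⟨h1, h2, h3, h4, -⟩ := hsol ε (hε.trans_le (min_le_left _ _))
    have hzF : (zF ε).toCoef = (sol ε).1 := NeimarkSacker.FourierTorus.toCoef_ofCoef _ _ _
    have hlam : |(zF ε).lam - lamStar| < δ := by
      rw [show (zF ε).lam - lamStar = (sol ε).2.1 from add_sub_cancel_left _ _]
      exact ((norm_fst_le (sol ε).2).trans h3).trans_lt hCδ'
    have hom : |(zF ε).om - omStar| < δ := by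
      rw [show (zF ε).om - omStar = (sol ε).2.2 from add_sub_cancel_left _ _]
      exact ((norm_snd_le (sol ε).2).trans h3).trans_lt hCδ'
    refine ⟨?_, ⟨hlam, hom, fun θ φ => ?_⟩, fun s hs hsn => ?_⟩
    · rw [NeimarkSacker.FourierTorus.solves_iff
        (fun z θ => (hm _ (hlam.trans_le hδr)).2.2.2 z θ ε hε'), hzF]
      exact ⟨h1.periodic, h1.hasDerivAt, h1.mean⟩
    · rw [(zF ε).z_eq, map_add, ← NeimarkSacker.aStar_eq, add_sub_cancel_left, hzF]
      exact ((NeimarkSacker.norm_trig_le φ _).trans (by gcongr; exact h2 θ)).trans_lt hCδ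
    · rw [NeimarkSacker.FourierTorus.solves_iff
        (fun z θ => (hm _ (hsn.1.trans_le hδr)).2.2.2 z θ ε hε')] at hs
      have hs' : m.IsGalerkin lamStar omStar ε s.toCoef (s.lam - lamStar, s.om - omStar) :=
        ⟨hs.1, by simpa only [add_sub_cancel] using hs.2.1, hs.2.2⟩
      obtain ⟨g1, g2⟩ := h4 _ _ hs'
        (fun θ => (NeimarkSacker.norm_le_of_near hsn θ).trans (by linarith))
        (max_le (hsn.1.le.trans (by linarith)) (hsn.2.1.le.trans (by linarith)))
      refine NeimarkSacker.FourierTorus.eq_ofCoef ?_ ?_ g1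
      · rw [← g2]; simp
      · rw [← g2]; simp
  · have hε' : ε ≠ 0 := abs_pos.1 hε0
    have hε2 : (0 : ℝ) < ε ^ 2 := by positivity
    obtain ⟨h1, -, -, -, h5, h6⟩ := hsol ε (hε.trans_le (min_le_left _ _))
    obtain ⟨c₁, c₂, hβ⟩ := hc.eq_formal hA F hG hp hq hNS.alphaR_star hNS.alphaI_star
    rw [← hβ, NeimarkSacker.paramEquiv_apply, hdp, hdq] at h5
    have hpow : C * |ε| ^ 4 = C * ε ^ 2 * ε ^ 2 := by
      rw [show |ε| ^ 4 = (|ε| ^ 2) ^ 2 by ring, sq_abs]; ring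
    have hw : Differentiable ℝ fun t => (sol ε).1 t - F.approx ε t := fun t =>
      (h1.hasDerivAt t).differentiableAt.sub (F.hasDerivAt_approx ε t).differentiableAt
    have even : ∀ j θ, c.coef₁ θ j = F.w₁ θ j := fun j θ => by rw [c₁]
    have odd : ∀ j θ, NeimarkSacker.hat (c.coef₂ θ j) = NeimarkSacker.hat (F.w₂ θ j) :=
      fun j θ => by rw [c₂, NeimarkSacker.critProj_apply]; rfl
    have e0 := fun θ => (h6 θ).1
    have e1 := fun θ => (h6 θ).2.1
    have o0 := fun θ => (h6 θ).2.2.1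
    have o1 := fun θ => (h6 θ).2.2.2
    refine ⟨?_, ?_,
      NeimarkSacker.NFCoeffs.c1Le_hat_even (s := F) (w := (sol ε).1) (j := 0) (by decide)
        (fun θ => congrArg NeimarkSacker.hat (even 0 θ)) hε' hw e0 e1,
      NeimarkSacker.NFCoeffs.c1Le_hat_even (s := F) (w := (sol ε).1) (j := 3) (by decide)
        (fun θ => congrArg NeimarkSacker.hat (even 3 θ)) hε' hw e0 e1,
      NeimarkSacker.NFCoeffs.c1Le_hat_even (s := F) (w := (sol ε).1) (j := 4) (by decide)
        (fun θ => congrArg NeimarkSacker.hat (even 4 θ)) hε' hw e0 e1,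
      NeimarkSacker.NFCoeffs.c1Le_til_even (s := F) (w := (sol ε).1) (j := 0) (by decide)
        (fun θ => congrArg NeimarkSacker.til (even 0 θ)) hε' hw e0 e1,
      NeimarkSacker.NFCoeffs.c1Le_til_even (s := F) (w := (sol ε).1) (j := 3) (by decide)
        (fun θ => congrArg NeimarkSacker.til (even 3 θ)) hε' hw e0 e1,
      NeimarkSacker.NFCoeffs.c1Le_til_even (s := F) (w := (sol ε).1) (j := 4) (by decide)
        (fun θ => congrArg NeimarkSacker.til (even 4 θ)) hε' hw e0 e1,
      NeimarkSacker.NFCoeffs.c1Le_hat_odd (s := F) (w := (sol ε).1) (j := 1) (by decide)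
        (odd 1) hε' hw o0 o1,
      NeimarkSacker.NFCoeffs.c1Le_hat_odd (s := F) (w := (sol ε).1) (j := 2) (by decide)
        (odd 2) hε' hw o0 o1,
      NeimarkSacker.NFCoeffs.c1Le_hat_odd (s := F) (w := (sol ε).1) (j := 5) (by decide)
        (odd 5) hε' hw o0 o1,
      NeimarkSacker.NFCoeffs.c1Le_hat_odd (s := F) (w := (sol ε).1) (j := 6) (by decide)
        (odd 6) hε' hw o0 o1⟩
    -- The first component of the bound on `b p + ε² β`, divided by `ε²`.
    · have h := (norm_fst_le _).trans h5
      simp only [Prod.fst_add, Prod.smul_fst, smul_eq_mul, Real.norm_eq_abs] at h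
      rw [show (zF ε).lam - lamStar = (sol ε).2.1 from add_sub_cancel_left _ _,
        show betaR - -deriv S.alphaR lamStar * ((sol ε).2.1 / ε ^ 2)
          = (deriv S.alphaR lamStar * (sol ε).2.1 + ε ^ 2 * betaR) / ε ^ 2 by field_simp; ring,
        abs_div, abs_of_pos hε2, div_le_iff₀ hε2, ← hpow]
      exact h
    · have h := (norm_snd_le _).trans h5
      simp only [Prod.snd_add, Prod.smul_snd, smul_eq_mul, Real.norm_eq_abs] at h
      rw [show (zF ε).lam - lamStar = (sol ε).2.1 from add_sub_cancel_left _ _,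
        show (zF ε).om - omStar = (sol ε).2.2 from add_sub_cancel_left _ _,
        show betaI - ((sol ε).2.2 / ε ^ 2 - deriv S.alphaI lamStar * ((sol ε).2.1 / ε ^ 2))
          = (deriv S.alphaI lamStar * (sol ε).2.1 - (sol ε).2.2 + ε ^ 2 * betaI) / ε ^ 2 by
            field_simp; ring,
        abs_div, abs_of_pos hε2, div_le_iff₀ hε2, ← hpow]
      exact h
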